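/- Proposition (parameter-free radius of the confidence set for the ML framework). For $x,y\in\mathbb{R}_+^D$ (nonnegative entries) let the I-divergence be $$I(x\|y)=\sum_{j=1}^{D}\Big(x(j)\log\frac{x(j)}{y(j)}+y(j)-x(j)\Big)\ \text{ if } \operatorname{supp}(x)\subseteq\operatorname{supp}(y),\qquad I(x\|y)=+\infty\ \text{ otherwise},$$ with the convention that a logarithmic term with $x(j)=0$ is $0$. There are absolute constants $C_\mu\approx 0.5801$ and $C_{\sigma^2}\approx 0.5178$ (precisely, $|C_\mu-0.5801|\le 2\cdot 10^{-4}$ and $|C_{\sigma^2}-0.5178|\le 5\cdot 10^{-5}$) such that the following holds for all dimensions $K,M,N$. Let $\tilde X\in\mathbb{R}_+^{K\times N}$ be a matrix with columns $\tilde x_1,\dots,\tilde x_N$, let $A_1,\dots,A_N\in\mathbb{R}_+^{M\times K}$, and put $\lambda_i=A_i\tilde x_i$. Let $Y\in\mathbb{N}_0^{M\times N}$ be a random matrix with columns $y_1,\dots,y_N$ whose entries are independent with $y_i(j)\sim\mathrm{Poisson}(\lambda_i(j))$ for $i=1,\dots,N$, $j=1,\dots,M$ (a Poisson variable with mean $0$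 being almost surely $0$). For $p\in(0,1)$ set $$\epsilon_{ML}(p)=C_\mu MN+\sqrt{\tfrac1p-1}\,\sqrt{C_{\sigma^2}MN},$$ which depends only on $p$, $M$, $N$ and not on the unknown intensities $\lambda_i(j)$. Then $$\mathbb{P}\big(\tilde X\in S_{\epsilon_{ML}}\big)\ \ge\ 1-p,\qquad S_{\epsilon}=\Big\{X\in\mathbb{R}_+^{K\times N}:\ \sum_{i=1}^N I(y_i\|A_ix_i)\le\epsilon\Big\},$$ where $x_i$ is the $i$-th column of $X$; that is, with probability at least $1-p$, $\sum_{i=1}^N I(y_i\|A_i\tilde x_i)\le\epsilon_{ML}(p)$. -/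

import Mathlib

open MeasureTheory ProbabilityTheory
open scoped Matrix

noncomputable section

/-- The I-divergence (generalized Kullback-Leibler divergence) of vectors with nonnegative
entries: `∑ i, (x i * log (x i / y i) + y i - x i)` if `supp x ⊆ supp y`, and `+∞` otherwise.
Terms with `x i = 0` contribute `y i`, by the convention `0 * log 0 = 0`. -/
def iDivergence {D : ℕ} (x y : Fin D → ℝ) : EReal :=
  open Classical in
  if Function.support x ⊆ Function.support y then
    ((∑ i, (x i * Real.log (x i / y i) + y i - x i) : ℝ) : EReal)
  else ⊤

/-- The maximum likelihood confidence set of radius `ε`, for the mixing matrices `A i` and the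
matrix of counts `Y`: all nonnegative matrices `X` (with columns `x_i = X.col i`) such that
`∑ i, I(y_i ‖ A_i x_i) ≤ ε`. -/
def mlConfidenceSet {K M N : ℕ} (A : Fin N → Matrix (Fin M) (Fin K) ℝ)
    (Y : Matrix (Fin M) (Fin N) ℕ) (ε : ℝ) : Set (Matrix (Fin K) (Fin N) ℝ) :=
  {X | (∀ l i, 0 ≤ X l i) ∧
    ∑ i, iDivergence (fun j => (Y j i : ℝ)) (A i *ᵥ X.col i) ≤ (ε : EReal)}

/-- The Poisson observation model: the entries of the random matrix `Y` are independent, and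
`y_i(j)` has the Poisson law with mean `λ_i(j)`, where `λ_i = A_i x_i` and `x_i` is the `i`-th
column of `X`. (A Poisson variable with mean `0` is almost surely `0`.) -/
structure IsPoissonObservation {K M N : ℕ} {Ω : Type*} [MeasurableSpace Ω] (P : Measure Ω)
    (A : Fin N → Matrix (Fin M) (Fin K) ℝ) (X : Matrix (Fin K) (Fin N) ℝ)
    (Y : Ω → Matrix (Fin M) (Fin N) ℕ) : Prop where
  hasLaw : ∀ j i, HasLaw (fun ω => Y ω j i) (poissonMeasure ((A i *ᵥ X.col i) j).toNNReal) P
  indep : iIndepFun (fun (q : Fin M × Fin N) ω => Y ω q.1 q.2) P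

/-- The radius `C_μ M N + √(1/p - 1) √(C_{σ²} M N)`. -/
def mlRadius (Cμ Cσ2 : ℝ) (M N : ℕ) (p : ℝ) : ℝ :=
  Cμ * (M * N) + Real.sqrt (1 / p - 1) * Real.sqrt (Cσ2 * (M * N))

end

/-!
The sum of the divergences is `∑ Z_i`, where the `n = M N` variables `Z_i = I(Y_i ‖ l_i)`, with
`Y_i` Poisson of mean `l_i`, are independent. With `C = 0.5803`, `v = 0.51785` and
`t = √(1 / p - 1) √(v n)` the claim is the one-sided Chebyshev (Cantelli) bound
`P(∑ Z_i ≥ C n + t) ≤ v n / (v n + t ^ 2)`. It does not follow from Chebyshev's inequality alone: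
the largest mean of `I(Y ‖ l)` is about `0.5802` (near `l = 1.34`), but the variance exceeds `v`
for some `l` (it is about `0.601` near `l = 3`), where however the mean stays well below `C`. The
proof combines uniform estimates for one variable with two tail bounds for the sum.

*One variable* (`HasDivergenceBounds`). For `Z = I(Y ‖ l)` and all `l > 0`:
* `E Z ≤ C`, `Var Z ≤ v + 4.5 (C - E Z)`, `Var Z ≤ 0.608` (`momentBounds`). For `l ≤ 1 / 8` and
  `l ≥ 45` these follow from elementary bounds of the logarithm and the moments of the Poisson
  law. In between, `E I(Y ‖ m) ^ i`, `i = 1, 2`, for `Y` of mean `l` is convex in `l` and in `m`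
  separately, so that on a short interval the diagonal `m = l` is controlled by the four values at
  pairs of end points (`diag_le_of_separately_convex`). These values are bounded in integer
  arithmetic by Horner's scheme with a table of logarithms, and the kernel evaluates the resulting
  conditions (`checkGrid_grid`).
* `P(Z ≥ a) ≤ 1.46 exp (-a)` (`poissonExp_indicator_poissonDiv_le`), from Stirling's formula and a
  comparison of the two tails of the Poisson law with geometric series.
* `E (Z - E Z) ^ 3 ≤ 3.56` (`poissonExp_third_central_le`), by integrating this tail.

*The sum.* Let `D` be `1 / 4.5` times the sum of the excesses `max 0 (Var Z_i - v)`; then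
`E ∑ Z_i ≤ C n - D`, so the excess of the variance is paid for by the deviation needed.
* For `t ≤ 7 + 0.13 n` one summand is singled out and the others are conditioned upon. Its
  exponential tail is bounded by a quadratic polynomial (`min_one_exp_neg_le`), so that only the
  mean and the variance of the other summands enter (`measureReal_le_add_le_of_exp_tail`,
  `peel_bound`).
* For larger `t`, Markov's inequality is applied to `S (S - E S) ^ 2`, for `S = ∑ Z_i`
  (`measureReal_le_of_third_moment`, `cubic_ineq`).
-/

/-! ### Expectations under a Poisson law -/

/-- At most exponential growth of a sequence: `|f k| ≤ C * r ^ k`. Every sequence whose Poisson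
expectation is considered below has this property, which makes all the series involved converge
for every real value of the parameter. -/
def ExpGrowth (f : ℕ → ℝ) : Prop := ∃ C r : ℝ, 0 ≤ C ∧ 0 ≤ r ∧ ∀ k, |f k| ≤ C * r ^ k

namespace ExpGrowth

theorem mono {f g : ℕ → ℝ} (hg : ExpGrowth g) (h : ∀ k, |f k| ≤ |g k|) : ExpGrowth f := by
  obtain ⟨C, r, hC, hr, hb⟩ := hg
  exact ⟨C, r, hC, hr, fun k => (h k).trans (hb k)⟩

theorem const (c : ℝ) : ExpGrowth (fun _ => c) :=
  ⟨|c|, 1, abs_nonneg _, zero_le_one, fun k => by simp⟩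

theorem natCast : ExpGrowth (fun k => (k : ℝ)) :=
  ⟨1, 2, zero_le_one, zero_le_two, fun k => by
    rw [Nat.abs_cast, one_mul]; exact_mod_cast Nat.lt_two_pow_self.le⟩

theorem add {f g : ℕ → ℝ} (hf : ExpGrowth f) (hg : ExpGrowth g) :
    ExpGrowth (fun k => f k + g k) := by
  obtain ⟨C, r, hC, hr, hb⟩ := hf
  obtain ⟨D, s, hD, hs, hc⟩ := hg
  refine ⟨C + D, max r s, by positivity, le_max_of_le_left hr, fun k => ?_⟩
  calc |f k + g k| ≤ |f k| + |g k| := abs_add_le _ _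
    _ ≤ C * r ^ k + D * s ^ k := add_le_add (hb k) (hc k)
    _ ≤ C * max r s ^ k + D * max r s ^ k := by
        gcongr
        · exact le_max_left _ _
        · exact le_max_right _ _
    _ = _ := by ring

theorem mul {f g : ℕ → ℝ} (hf : ExpGrowth f) (hg : ExpGrowth g) :
    ExpGrowth (fun k => f k * g k) := by
  obtain ⟨C, r, hC, hr, hb⟩ := hf
  obtain ⟨D, s, hD, hs, hc⟩ := hg
  refine ⟨C * D, r * s, by positivity, by positivity, fun k => ?_⟩
  rw [abs_mul, mul_pow]
  calc |f k| * |g k| ≤ (C * r ^ k) * (D * s ^ k) :=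
        mul_le_mul (hb k) (hc k) (abs_nonneg _) (by positivity)
    _ = _ := by ring

theorem const_mul (c : ℝ) {f : ℕ → ℝ} (hf : ExpGrowth f) : ExpGrowth (fun k => c * f k) :=
  (const c).mul hf

theorem neg {f : ℕ → ℝ} (hf : ExpGrowth f) : ExpGrowth (fun k => -f k) :=
  hf.mono fun k => by rw [abs_neg]

theorem sub {f g : ℕ → ℝ} (hf : ExpGrowth f) (hg : ExpGrowth g) :
    ExpGrowth (fun k => f k - g k) := by
  simpa only [sub_eq_add_neg] using hf.add hg.neg

theorem pow {f : ℕ → ℝ} (hf : ExpGrowth f) (n : ℕ) : ExpGrowth (fun k => f k ^ n) := by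
  induction n with
  | zero => simpa using const 1
  | succ n ih => simpa only [pow_succ] using ih.mul hf

theorem succ {f : ℕ → ℝ} (hf : ExpGrowth f) : ExpGrowth (fun k => f (k + 1)) := by
  obtain ⟨C, r, hC, hr, hb⟩ := hf
  exact ⟨C * r, r, by positivity, hr, fun k => (hb (k + 1)).trans_eq (by ring)⟩

theorem log : ExpGrowth (fun k => Real.log k) :=
  natCast.mono fun k => by
    rw [abs_of_nonneg (Real.log_natCast_nonneg k), Nat.abs_cast]
    exact Real.log_le_self (Nat.cast_nonneg k)

theorem indicator {f : ℕ → ℝ} (hf : ExpGrowth f) (s : Set ℕ) : ExpGrowth (s.indicator f) :=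
  hf.mono fun k => by
    by_cases h : k ∈ s <;> simp [h]

theorem summable {f : ℕ → ℝ} (hf : ExpGrowth f) (l : ℝ) :
    Summable (fun k : ℕ => l ^ k / (k.factorial : ℝ) * f k) := by
  obtain ⟨C, r, hC, hr, hb⟩ := hf
  refine Summable.of_norm_bounded (g := fun k : ℕ => C * ((|l| * r) ^ k / (k.factorial : ℝ)))
    ((Real.summable_pow_div_factorial _).mul_left C) fun k => ?_
  rw [Real.norm_eq_abs, abs_mul, abs_div, abs_pow, Nat.abs_cast]
  calc |l| ^ k / (k.factorial : ℝ) * |f k| ≤ |l| ^ k / (k.factorial : ℝ) * (C * r ^ k) := by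
        gcongr; exact hb k
    _ = _ := by rw [mul_pow]; ring

end ExpGrowth

/-- The expectation `E f(Y)` for a Poisson variable `Y` with mean `l`, as a power series. It makes
sense for all real `l`, which is convenient for differentiating in `l`. -/
noncomputable def poissonExp (l : ℝ) (f : ℕ → ℝ) : ℝ :=
  Real.exp (-l) * ∑' k : ℕ, l ^ k / (k.factorial : ℝ) * f k

theorem poissonExp_add {f g : ℕ → ℝ} (hf : ExpGrowth f) (hg : ExpGrowth g) (l : ℝ) :
    poissonExp l (fun k => f k + g k) = poissonExp l f + poissonExp l g := by
  simp only [poissonExp, mul_add]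
  rw [(hf.summable l).tsum_add (hg.summable l), mul_add]

theorem poissonExp_const_mul (c : ℝ) (f : ℕ → ℝ) (l : ℝ) :
    poissonExp l (fun k => c * f k) = c * poissonExp l f := by
  simp only [poissonExp]
  rw [show (fun k : ℕ => l ^ k / (k.factorial : ℝ) * (c * f k))
    = fun k : ℕ => c * (l ^ k / (k.factorial : ℝ) * f k) from by ext; ring, tsum_mul_left]
  ring

theorem poissonExp_sub {f g : ℕ → ℝ} (hf : ExpGrowth f) (hg : ExpGrowth g) (l : ℝ) :
    poissonExp l (fun k => f k - g k) = poissonExp l f - poissonExp l g := by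
  simp only [poissonExp, mul_sub]
  rw [(hf.summable l).tsum_sub (hg.summable l), mul_sub]

theorem poissonExp_one (l : ℝ) : poissonExp l (fun _ => 1) = 1 := by
  have h : ∑' k : ℕ, l ^ k / (k.factorial : ℝ) * 1 = Real.exp l := by
    simp only [mul_one]
    rw [Real.exp_eq_exp_ℝ, NormedSpace.exp_eq_tsum_div]
  rw [poissonExp, h, ← Real.exp_add]; simp

theorem poissonExp_const (c l : ℝ) : poissonExp l (fun _ => c) = c := by
  have := poissonExp_const_mul c (fun _ => 1) l
  simpa [poissonExp_one] using this

theorem poissonExp_mono {f g : ℕ → ℝ} (hf : ExpGrowth f) (hg : ExpGrowth g) {l : ℝ} (hl : 0 ≤ l)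
    (h : ∀ k, f k ≤ g k) : poissonExp l f ≤ poissonExp l g := by
  refine mul_le_mul_of_nonneg_left ?_ (Real.exp_pos _).le
  exact (hf.summable l).tsum_le_tsum
    (fun k => mul_le_mul_of_nonneg_left (h k) (by positivity)) (hg.summable l)

theorem poissonExp_nonneg {f : ℕ → ℝ} {l : ℝ} (hl : 0 ≤ l) (h : ∀ k, 0 ≤ f k) :
    0 ≤ poissonExp l f :=
  mul_nonneg (Real.exp_pos _).le (tsum_nonneg fun k => mul_nonneg (by positivity) (h k))

/-- The Stein-Chen identity `E[Y f(Y)] = l E[f(Y + 1)]`. -/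
theorem poissonExp_natCast_mul {f : ℕ → ℝ} (hf : ExpGrowth f) (l : ℝ) :
    poissonExp l (fun k => k * f k) = l * poissonExp l (fun k => f (k + 1)) := by
  simp only [poissonExp]
  rw [((ExpGrowth.natCast.mul hf).summable l).tsum_eq_zero_add]
  have : ∀ k : ℕ, l ^ (k + 1) / ((k + 1).factorial : ℝ) * (((k + 1 : ℕ) : ℝ) * f (k + 1))
      = l * (l ^ k / (k.factorial : ℝ) * f (k + 1)) := fun k => by
    rw [Nat.factorial_succ]; push_cast
    have : (k.factorial : ℝ) ≠ 0 := by positivity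
    have : (k : ℝ) + 1 ≠ 0 := by positivity
    field_simp
    ring
  simp only [this, tsum_mul_left]
  simp
  ring

theorem hasDerivAt_poissonExp {f : ℕ → ℝ} (hf : ExpGrowth f) (l : ℝ) :
    HasDerivAt (fun x => poissonExp x f) (poissonExp l (fun k => f (k + 1) - f k)) l := by
  have hG : HasDerivAt (fun x : ℝ => ∑' k : ℕ, x ^ k / (k.factorial : ℝ) * f k)
      (∑' k : ℕ, l ^ k / (k.factorial : ℝ) * f (k + 1)) l := by
    obtain ⟨C, r, hC, hr, hb⟩ := id hf
    set R := |l| + 1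
    have hR : 0 < R := by positivity
    have hu : Summable (fun k : ℕ => (k : ℝ) * R ^ (k - 1) / (k.factorial : ℝ) * (C * r ^ k)) := by
      rw [← summable_nat_add_iff 1]
      refine ((Real.summable_pow_div_factorial (R * r)).mul_left (C * r)).congr fun k => ?_
      rw [Nat.factorial_succ, Nat.add_sub_cancel]; push_cast
      have : (k.factorial : ℝ) ≠ 0 := by positivity
      have : (k : ℝ) + 1 ≠ 0 := by positivity
      field_simp
      rw [mul_pow]; ring
    have key := hasDerivAt_tsum_of_isPreconnected (t := Metric.ball (0 : ℝ) R)
      (g := fun (k : ℕ) x => x ^ k / (k.factorial : ℝ) * f k)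
      (g' := fun (k : ℕ) x => (k : ℝ) * x ^ (k - 1) / (k.factorial : ℝ) * f k)
      (y₀ := 0) (y := l) hu Metric.isOpen_ball (convex_ball _ _).isPreconnected
      (fun k x _ => ((hasDerivAt_pow k x).div_const _).mul_const _)
      (fun k x hx => by
        rw [Metric.mem_ball, dist_zero_right, Real.norm_eq_abs] at hx
        rw [Real.norm_eq_abs, abs_mul, abs_div, abs_mul, abs_pow, Nat.abs_cast, Nat.abs_cast]
        gcongr
        exact hb k)
      (by simpa using hR) (hf.summable 0)
      (by rw [Metric.mem_ball, dist_zero_right, Real.norm_eq_abs]; exact lt_add_one _)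
    have hs : Summable (fun k : ℕ => (k : ℝ) * l ^ (k - 1) / (k.factorial : ℝ) * f k) := by
      rw [← summable_nat_add_iff 1]
      refine (hf.succ.summable l).congr fun k => ?_
      rw [Nat.factorial_succ, Nat.add_sub_cancel]; push_cast
      have : (k.factorial : ℝ) ≠ 0 := by positivity
      have : (k : ℝ) + 1 ≠ 0 := by positivity
      field_simp
    convert! key using 1
    rw [hs.tsum_eq_zero_add]
    simp only [CharP.cast_eq_zero, zero_mul, zero_div, zero_add]
    refine tsum_congr fun k => ?_
    rw [Nat.factorial_succ, Nat.add_sub_cancel]; push_cast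
    have : (k.factorial : ℝ) ≠ 0 := by positivity
    have : (k : ℝ) + 1 ≠ 0 := by positivity
    field_simp
  have hE : HasDerivAt (fun x : ℝ => Real.exp (-x)) (-Real.exp (-l)) l := by
    simpa using (hasDerivAt_neg l).exp
  convert! hE.mul hG using 1
  rw [poissonExp_sub hf.succ hf]
  simp only [poissonExp]
  ring

theorem convexOn_poissonExp {f : ℕ → ℝ} (hf : ExpGrowth f)
    (h : ∀ k, 0 ≤ f (k + 2) - 2 * f (k + 1) + f k) :
    ConvexOn ℝ (Set.Ici 0) (fun x => poissonExp x f) := by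
  have hd := hasDerivAt_poissonExp hf
  have hd2 := hasDerivAt_poissonExp (hf.succ.sub hf)
  have e1 : deriv (fun x => poissonExp x f) = fun x => poissonExp x (fun k => f (k + 1) - f k) :=
    funext fun x => (hd x).deriv
  refine convexOn_of_deriv2_nonneg (convex_Ici 0)
    (fun x _ => (hd x).continuousAt.continuousWithinAt)
    (fun x _ => (hd x).differentiableAt.differentiableWithinAt) ?_ fun x hx => ?_
  · rw [e1]; exact fun x _ => (hd2 x).differentiableAt.differentiableWithinAt
  · rw [interior_Ici] at hx
    rw [Function.iterate_succ, Function.iterate_one, Function.comp_apply, e1, (hd2 x).deriv]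
    refine poissonExp_nonneg (le_of_lt hx) fun k => ?_
    have := h k
    linarith

theorem ExpGrowth.integrable {f : ℕ → ℝ} (hf : ExpGrowth f) (r : NNReal) :
    Integrable f (poissonMeasure r) := by
  rw [integrable_poissonMeasure_iff]
  have := ((hf.summable r).norm).mul_left (Real.exp (-r))
  refine this.congr fun k => ?_
  rw [norm_mul, norm_div, norm_pow, Real.norm_of_nonneg r.coe_nonneg,
    Real.norm_of_nonneg (Nat.cast_nonneg _)]
  ring

theorem integral_poissonMeasure_eq (r : NNReal) (f : ℕ → ℝ) :
    ∫ k, f k ∂(poissonMeasure r) = poissonExp r f := by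
  rw [integral_poissonMeasure, poissonExp, ← tsum_mul_left]
  refine tsum_congr fun k => ?_
  rw [smul_eq_mul]; ring

/-! ### The I-divergence of a Poisson variable and its tail -/

/-- The I-divergence `I(k ‖ l) = k log (k / l) + l - k` of the count `k` from the mean `l`. -/
noncomputable def poissonDiv (l : ℝ) (k : ℕ) : ℝ := k * Real.log (k / l) + l - k

theorem poissonDiv_eq {l : ℝ} (hl : 0 < l) (k : ℕ) :
    poissonDiv l k = k * (Real.log k - Real.log l) + l - k := by
  rw [poissonDiv]
  rcases Nat.eq_zero_or_pos k with rfl | hk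
  · simp
  · rw [Real.log_div (by positivity) hl.ne']

theorem poissonDiv_zero (l : ℝ) : poissonDiv l 0 = l := by simp [poissonDiv]

theorem poissonDiv_nonneg {l : ℝ} (hl : 0 < l) (k : ℕ) : 0 ≤ poissonDiv l k := by
  rcases Nat.eq_zero_or_pos k with rfl | hk
  · rw [poissonDiv_zero]; exact hl.le
  · have hk' : (0 : ℝ) < k := by exact_mod_cast hk
    have h := Real.one_sub_inv_le_log_of_pos (div_pos hk' hl)
    rw [inv_div] at h
    have := mul_le_mul_of_nonneg_left h hk'.le
    rw [mul_sub, mul_div_cancel₀ _ hk'.ne'] at this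
    rw [poissonDiv]; linarith

theorem expGrowth_poissonDiv {l : ℝ} (hl : 0 < l) : ExpGrowth (poissonDiv l) := by
  have : ExpGrowth fun k : ℕ => k * (Real.log k - Real.log l) + l - k :=
    ((ExpGrowth.natCast.mul (ExpGrowth.log.sub (ExpGrowth.const _))).add
      (ExpGrowth.const l)).sub ExpGrowth.natCast
  exact this.mono fun k => by rw [poissonDiv_eq hl]

theorem poissonDiv_le_of_le {l : ℝ} (hl : 0 < l) {k : ℕ} (hk : l ≤ k) :
    poissonDiv l k ≤ (k - l) ^ 2 / (2 * l) := by
  have hk0 : (0 : ℝ) < k := hl.trans_le hk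
  have hx : 0 < (k : ℝ) / l := div_pos hk0 hl
  have h1 : Real.log (k / l) ≤ Real.sinh (Real.log (k / l)) :=
    Real.self_le_sinh_iff.2 (Real.log_nonneg (by rwa [one_le_div hl]))
  rw [Real.sinh_log hx] at h1
  have h2 := mul_le_mul_of_nonneg_left h1 hk0.le
  rw [poissonDiv]
  have h3 : (k : ℝ) * (((k : ℝ) / l - ((k : ℝ) / l)⁻¹) / 2) + l - k = (k - l) ^ 2 / (2 * l) := by
    field_simp
    ring
  linarith

theorem poissonDiv_le_of_ge {l : ℝ} {k : ℕ} (hk0 : 0 < k) (hk : (k : ℝ) ≤ l) :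
    poissonDiv l k ≤ (l - k) ^ 2 / (2 * k) := by
  have hk' : (0 : ℝ) < k := by exact_mod_cast hk0
  have hl : 0 < l := hk'.trans_le hk
  set u : ℝ := (l - k) / k with hu
  have hu0 : 0 ≤ u := div_nonneg (sub_nonneg.2 hk) hk'.le
  have h1 := Real.le_log_one_add_of_nonneg hu0
  have h2 : u - u ^ 2 / 2 ≤ 2 * u / (u + 2) := by
    rw [le_div_iff₀ (by positivity)]
    nlinarith [pow_nonneg hu0 3]
  have h3 : Real.log (k / l) = -Real.log (1 + u) := by
    rw [← Real.log_inv, show 1 + u = l / k by rw [hu]; field_simp; ring, inv_div]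
  have h4 : (l - k) ^ 2 / (2 * k) = k * (u ^ 2 / 2) := by rw [hu]; field_simp
  have h5 : l - k = k * u := by rw [hu]; field_simp
  rw [poissonDiv, h3, h4]
  nlinarith [mul_le_mul_of_nonneg_left (h2.trans h1) hk'.le]

/-- Stirling's formula bounds the Poisson mass function by `exp (-I(k ‖ l)) / √(2πk)`. -/
theorem poisson_mass_le {l : ℝ} (hl : 0 < l) {k : ℕ} (hk : 0 < k) :
    Real.exp (-l) * (l ^ k / (k.factorial : ℝ)) * √(2 * Real.pi * k)
      ≤ Real.exp (-poissonDiv l k) := by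
  have hk' : (0 : ℝ) < k := by exact_mod_cast hk
  have h := Stirling.le_factorial_stirling k
  have hf : (0 : ℝ) < k.factorial := by positivity
  have e : Real.exp (-poissonDiv l k) = Real.exp (-l) * l ^ k / ((k : ℝ) / Real.exp 1) ^ k := by
    rw [poissonDiv_eq hl, show -((k : ℝ) * (Real.log k - Real.log l) + l - k)
      = -l + (k * Real.log l) - (k * Real.log k - k) from by ring, Real.exp_sub, Real.exp_add,
      div_pow, mul_comm (k : ℝ) (Real.log l), mul_comm (k : ℝ) (Real.log k), Real.exp_sub,
      ← Real.rpow_def_of_pos hl, ← Real.rpow_def_of_pos hk', Real.rpow_natCast, Real.rpow_natCast,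
      ← Real.exp_nat_mul, mul_one]
  rw [e, le_div_iff₀ (by positivity)]
  calc Real.exp (-l) * (l ^ k / (k.factorial : ℝ)) * √(2 * Real.pi * k)
        * ((k : ℝ) / Real.exp 1) ^ k
      = Real.exp (-l) * (l ^ k / (k.factorial : ℝ))
        * (√(2 * Real.pi * k) * ((k : ℝ) / Real.exp 1) ^ k) := by ring
    _ ≤ Real.exp (-l) * (l ^ k / (k.factorial : ℝ)) * k.factorial := by gcongr
    _ = _ := by field_simp

theorem expGrowth_indicator_one (s : Set ℕ) : ExpGrowth (s.indicator fun _ => (1 : ℝ)) :=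
  (ExpGrowth.const 1).indicator s

/-- The upper Poisson tail is at most its first term times a geometric series. -/
theorem poissonExp_indicator_ge_le {l : ℝ} (hl : 0 < l) {m : ℕ} (hm : l < m + 1) :
    poissonExp l ({k | m ≤ k}.indicator fun _ => 1)
      ≤ Real.exp (-l) * (l ^ m / (m.factorial : ℝ)) * ((m + 1) / (m + 1 - l)) := by
  rw [poissonExp, mul_assoc]
  refine mul_le_mul_of_nonneg_left ?_ (Real.exp_pos _).le
  have hs := (expGrowth_indicator_one {k | m ≤ k}).summable l
  rw [← hs.sum_add_tsum_nat_add m, Finset.sum_eq_zero, zero_add]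
  swap
  · intro k hk
    rw [Set.indicator_of_notMem, mul_zero]
    simpa using hk
  have hr0 : 0 ≤ l / (m + 1) := by positivity
  have hr1 : l / (m + 1) < 1 := by rw [div_lt_one (by positivity)]; exact hm
  have hg := hasSum_geometric_of_lt_one hr0 hr1
  have e : (1 - l / (m + 1))⁻¹ = ((m : ℝ) + 1) / (m + 1 - l) := by
    have : (m : ℝ) + 1 - l ≠ 0 := by linarith
    field_simp
  rw [e] at hg
  have hg' := hg.mul_left (l ^ m / (m.factorial : ℝ))
  rw [← hg'.tsum_eq]
  refine ((summable_nat_add_iff m).2 hs).tsum_le_tsum (fun j => ?_) hg'.summable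
  rw [Set.indicator_of_mem (by simp), mul_one]
  have hfac : (m.factorial : ℝ) * (m + 1) ^ j ≤ ((j + m).factorial : ℝ) := by
    rw [add_comm j m]; exact_mod_cast Nat.factorial_mul_pow_le_factorial
  rw [div_pow, div_mul_div_comm, pow_add, mul_comm (l ^ j)]
  gcongr

/-- The lower Poisson tail is at most its last term times a geometric series. -/
theorem sum_pow_div_factorial_le {l : ℝ} {m : ℕ} (hm : (m : ℝ) < l) :
    ∑ k ∈ Finset.range (m + 1), l ^ k / (k.factorial : ℝ)
      ≤ l ^ m / (m.factorial : ℝ) * (l / (l - m)) := by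
  induction m with
  | zero =>
    have : l ≠ 0 := by rintro rfl; simp at hm
    simp [this]
  | succ m ih =>
    push_cast at hm
    have h0 : (0 : ℝ) ≤ m := Nat.cast_nonneg m
    have hl : 0 < l := by linarith
    have hA : 0 < l ^ m / (m.factorial : ℝ) := by positivity
    rw [Finset.sum_range_succ]
    have e : l ^ (m + 1) / ((m + 1).factorial : ℝ) = l ^ m / (m.factorial : ℝ) * (l / (m + 1)) := by
      rw [Nat.factorial_succ, pow_succ]; push_cast; field_simp
    have key : l / (l - m) + l / (m + 1) ≤ l / (m + 1) * (l / (l - (m + 1))) := by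
      have h1 : 0 < l - m := by linarith
      have h2 : 0 < l - (m + 1) := by linarith
      rw [div_mul_div_comm, div_add_div _ _ h1.ne' (by positivity),
        div_le_div_iff₀ (by positivity) (by positivity)]
      nlinarith [mul_pos hl (by positivity : (0 : ℝ) < m + 1), mul_pos hl h2, h2, h1,
        mul_pos (mul_pos hl (by positivity : (0 : ℝ) < m + 1)) (by positivity : (0 : ℝ) < m + 1)]
    push_cast
    rw [e]
    calc _ ≤ l ^ m / (m.factorial : ℝ) * (l / (l - m)) + l ^ m / (m.factorial : ℝ) * (l / (m + 1)) :=
          by gcongr; exact ih (by linarith)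
      _ = l ^ m / (m.factorial : ℝ) * (l / (l - m) + l / (m + 1)) := by ring
      _ ≤ l ^ m / (m.factorial : ℝ) * (l / (m + 1) * (l / (l - (m + 1)))) := by gcongr
      _ = _ := by ring

theorem poissonExp_indicator_le_eq (l : ℝ) (m : ℕ) :
    poissonExp l ({k | k ≤ m}.indicator fun _ => 1)
      = Real.exp (-l) * ∑ k ∈ Finset.range (m + 1), l ^ k / (k.factorial : ℝ) := by
  rw [poissonExp, tsum_eq_sum (s := Finset.range (m + 1))]
  · congr 1
    refine Finset.sum_congr rfl fun k hk => ?_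
    rw [Set.indicator_of_mem, mul_one]
    simpa [Nat.lt_succ_iff] using hk
  · intro k hk
    rw [Set.indicator_of_notMem, mul_zero]
    simpa [Nat.lt_succ_iff] using hk

theorem two_and_half_lt_sqrt_two_pi : 2.5066 < √(2 * Real.pi) := by
  rw [Real.lt_sqrt (by norm_num)]
  have := Real.pi_gt_d6
  nlinarith

theorem poisson_upper_tail_le {l a : ℝ} (hl : 0 < l) (ha : 0.378 ≤ a) {m : ℕ} (hm : l ≤ m)
    (hma : a ≤ poissonDiv l m) :
    poissonExp l ({k | m ≤ k}.indicator fun _ => 1) ≤ 0.46 * Real.exp (-a) := by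
  have hm0 : 0 < m := by
    have : (0 : ℝ) < m := hl.trans_le hm
    exact_mod_cast this
  have hm' : (0 : ℝ) < m := by exact_mod_cast hm0
  have hd : 0 < (m : ℝ) + 1 - l := by linarith
  have h1 := poissonExp_indicator_ge_le hl (m := m) (by linarith)
  rcases Nat.lt_or_ge m 2 with h2 | h2
  · obtain rfl : m = 1 := by omega
    -- here `I(1 ‖ l) ≥ a` forces `l` to be small
    have hl4 : l ≤ 0.4 := by
      by_contra! hc
      have : poissonDiv l 1 ≤ 0.35 := by
        have hlog : -Real.log l ≤ 0.4 / l - 1 + 0.934 := by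
          have h3 := Real.log_le_sub_one_of_pos (div_pos (by norm_num : (0 : ℝ) < 0.4) hl)
          rw [Real.log_div (by norm_num) hl.ne'] at h3
          have h4 : -0.934 ≤ Real.log 0.4 := by
            have h5 : Real.log (0.4 : ℝ) = Real.log 4 - Real.log 10 := by
              rw [← Real.log_div (by norm_num) (by norm_num)]; norm_num
            have h6 : Real.log (10 : ℝ) = Real.log 2 + Real.log 5 := by
              rw [← Real.log_mul (by norm_num) (by norm_num)]; norm_num
            have h7 : Real.log (4 : ℝ) = 2 * Real.log 2 := by
              rw [show (4 : ℝ) = 2 ^ 2 by norm_num, Real.log_pow]; norm_num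
            have h8 : Real.log (5 / 4 : ℝ) ≤ 0.24 := by
              have := Real.log_le_sub_one_of_pos (show (0 : ℝ) < √(5 / 4) by positivity)
              rw [Real.log_sqrt (by norm_num)] at this
              have h9 : √(5 / 4 : ℝ) ≤ 1.1181 := by
                rw [Real.sqrt_le_left (by norm_num)]; norm_num
              linarith
            have h11 : Real.log (5 / 4 : ℝ) = Real.log 5 - 2 * Real.log 2 := by
              rw [Real.log_div (by norm_num) (by norm_num), h7]
            have := Real.log_two_lt_d9
            linarith
          linarith
        rw [poissonDiv_eq hl]
        push_cast
        have h12 : 0.4 / l + l ≤ 1.4 := by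
          rw [div_add' _ _ _ hl.ne', div_le_iff₀ hl]
          push_cast at hm
          nlinarith
        simp only [Real.log_one]
        linarith
      linarith
    have hq : ((1 : ℕ) + 1 : ℝ) / ((1 : ℕ) + 1 - l) ≤ 0.46 * Real.exp 1 := by
      rw [div_le_iff₀ hd]
      have := Real.exp_one_gt_d9
      push_cast
      nlinarith
    have he : Real.exp (-poissonDiv l 1) = Real.exp (-l) * l * Real.exp 1 := by
      rw [poissonDiv_eq hl, Nat.cast_one, Real.log_one, show -(1 * (0 - Real.log l) + l - 1)
        = -l + Real.log l + 1 from by ring, Real.exp_add, Real.exp_add, Real.exp_log hl]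
    calc _ ≤ _ := h1
      _ ≤ Real.exp (-l) * (l ^ 1 / (Nat.factorial 1 : ℝ)) * (0.46 * Real.exp 1) := by gcongr
      _ = 0.46 * Real.exp (-poissonDiv l 1) := by rw [he]; simp; ring
      _ ≤ _ := by gcongr
  · have hsq : 0 < √(2 * Real.pi * m) := Real.sqrt_pos.2 (by positivity)
    have key : ((m : ℝ) + 1) / (m + 1 - l) ≤ 0.46 * √(2 * Real.pi * m) := by
      rw [div_le_iff₀ hd, Real.sqrt_mul (by positivity)]
      have hpi := two_and_half_lt_sqrt_two_pi
      have h2' : (2 : ℝ) ≤ m := by exact_mod_cast h2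
      set s := √(m : ℝ) with hs
      have hs2 : s ^ 2 = m := Real.sq_sqrt hm'.le
      have hs0 : 0 < s := Real.sqrt_pos.2 hm'
      have hs1 : 1.414 ≤ s := Real.le_sqrt_of_sq_le (by norm_num; linarith)
      have hdev := ha.trans (hma.trans (poissonDiv_le_of_le hl hm))
      rw [le_div_iff₀ (by positivity)] at hdev
      have hδ : 0.8694 * s - 0.378 ≤ m - l := by
        by_contra! hc
        have : 0 ≤ m - l := by linarith
        nlinarith
      have hm1 : (m : ℝ) + 1 ≤ 1.153 * s * (m + 1 - l) := by
        have : 1.153 * s * (0.622 + 0.8694 * s) ≤ 1.153 * s * (m + 1 - l) := by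
          gcongr; linarith
        nlinarith
      calc (m : ℝ) + 1 ≤ 1.153 * s * (m + 1 - l) := hm1
        _ ≤ 0.46 * (√(2 * Real.pi) * s) * (m + 1 - l) := by
            have : 1.153 * s ≤ 0.46 * (√(2 * Real.pi) * s) := by nlinarith
            gcongr
    calc _ ≤ _ := h1
      _ ≤ Real.exp (-l) * (l ^ m / (m.factorial : ℝ)) * (0.46 * √(2 * Real.pi * m)) := by gcongr
      _ = 0.46 * (Real.exp (-l) * (l ^ m / (m.factorial : ℝ)) * √(2 * Real.pi * m)) := by ring
      _ ≤ 0.46 * Real.exp (-poissonDiv l m) := by gcongr; exact poisson_mass_le hl hm0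
      _ ≤ _ := by gcongr

theorem poisson_lower_tail_le {l a : ℝ} (hl : 0 < l) (ha : 0.378 ≤ a) {m : ℕ} (hm : (m : ℝ) < l)
    (hma : a ≤ poissonDiv l m) :
    poissonExp l ({k | k ≤ m}.indicator fun _ => 1) ≤ Real.exp (-a) := by
  rw [poissonExp_indicator_le_eq]
  rcases Nat.eq_zero_or_pos m with rfl | hm0
  · rw [poissonDiv_zero] at hma
    simpa using hma
  · have hm' : (0 : ℝ) < m := by exact_mod_cast hm0
    have hd : 0 < l - m := by linarith
    have key : l / (l - m) ≤ √(2 * Real.pi * m) := by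
      rw [div_le_iff₀ hd, Real.sqrt_mul (by positivity)]
      have hpi := two_and_half_lt_sqrt_two_pi
      set s := √(m : ℝ) with hs
      have hs2 : s ^ 2 = m := Real.sq_sqrt hm'.le
      have hs0 : 0 < s := Real.sqrt_pos.2 hm'
      have hs1 : 1 ≤ s := Real.le_sqrt_of_sq_le (by norm_num; exact_mod_cast hm0)
      have hdev := ha.trans (hma.trans (poissonDiv_le_of_ge hm0 hm.le))
      rw [le_div_iff₀ (by positivity)] at hdev
      have hδ : 0.869 * s ≤ l - m := by
        by_contra! hc
        nlinarith
      have h1 : l ≤ 2.5 * s * (l - m) := by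
        have : s * (0.869 * s) ≤ s * (l - m) := by gcongr
        nlinarith
      calc l ≤ 2.5 * s * (l - m) := h1
        _ ≤ √(2 * Real.pi) * s * (l - m) := by gcongr; linarith
    calc _ ≤ Real.exp (-l) * (l ^ m / (m.factorial : ℝ) * (l / (l - m))) := by
          gcongr; exact sum_pow_div_factorial_le hm
      _ ≤ Real.exp (-l) * (l ^ m / (m.factorial : ℝ) * √(2 * Real.pi * m)) := by gcongr
      _ = Real.exp (-l) * (l ^ m / (m.factorial : ℝ)) * √(2 * Real.pi * m) := by ring
      _ ≤ Real.exp (-poissonDiv l m) := poisson_mass_le hl hm0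
      _ ≤ _ := by gcongr

theorem exp_378_le : Real.exp 0.378 ≤ 1.46 := by
  refine (Real.exp_bound' (by norm_num) (by norm_num) (n := 4) (by norm_num)).trans ?_
  norm_num [Finset.sum_range_succ, Nat.factorial]

/-- The uniform exponential tail `P(I(Y ‖ l) ≥ a) ≤ 1.46 exp (-a)`: each one-sided tail is at most
`exp (-a)` by the choice of the I-divergence, and the upper one gains a factor because `Y` has to
deviate by a standard deviation's worth. -/
theorem poissonExp_indicator_poissonDiv_le {l : ℝ} (hl : 0 < l) (a : ℝ) :
    poissonExp l ({k | a ≤ poissonDiv l k}.indicator fun _ => 1) ≤ 1.46 * Real.exp (-a) := by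
  rcases le_total a 0.378 with ha | ha
  · have h1 : poissonExp l ({k | a ≤ poissonDiv l k}.indicator fun _ => 1) ≤ 1 := by
      refine (poissonExp_mono (expGrowth_indicator_one _) (ExpGrowth.const 1) hl.le fun k => ?_).trans_eq
        (poissonExp_one l)
      by_cases h : k ∈ {k | a ≤ poissonDiv l k} <;> simp [Set.indicator, h]
    refine h1.trans ?_
    rw [Real.exp_neg, ← div_eq_mul_inv, one_le_div (Real.exp_pos _)]
    exact (Real.exp_le_exp.2 ha).trans exp_378_le
  set U : Set ℕ := {k | a ≤ poissonDiv l k ∧ l ≤ k}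
  set V : Set ℕ := {k | a ≤ poissonDiv l k ∧ (k : ℝ) < l}
  have hU : poissonExp l (U.indicator fun _ => 1) ≤ 0.46 * Real.exp (-a) := by
    rcases U.eq_empty_or_nonempty with h | h
    · rw [h]
      simp only [Set.indicator_empty, poissonExp_const]
      positivity
    · obtain ⟨m, hm, hmin⟩ := WellFounded.has_min wellFounded_lt U h
      refine (poissonExp_mono (expGrowth_indicator_one _) (expGrowth_indicator_one {k | m ≤ k})
        hl.le fun k => ?_).trans (poisson_upper_tail_le hl ha hm.2 hm.1)
      exact Set.indicator_le_indicator_of_subset (fun k hk => not_lt.1 (hmin k hk))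
        (fun _ => zero_le_one) k
  have hV : poissonExp l (V.indicator fun _ => 1) ≤ Real.exp (-a) := by
    rcases V.eq_empty_or_nonempty with h | h
    · rw [h]
      simp only [Set.indicator_empty, poissonExp_const]
      positivity
    · have hfin : V.Finite := (Set.finite_Iio ⌈l⌉₊).subset fun k hk => Nat.lt_ceil.2 hk.2
      obtain ⟨m, hm, hmax⟩ := Set.exists_max_image V id hfin h
      refine (poissonExp_mono (expGrowth_indicator_one _) (expGrowth_indicator_one {k | k ≤ m})
        hl.le fun k => ?_).trans (poisson_lower_tail_le hl ha hm.2 hm.1)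
      exact Set.indicator_le_indicator_of_subset (fun k hk => hmax k hk)
        (fun _ => zero_le_one) k
  calc _ ≤ poissonExp l (fun k => U.indicator (fun _ => 1) k + V.indicator (fun _ => 1) k) := by
        refine poissonExp_mono (expGrowth_indicator_one _)
          ((expGrowth_indicator_one U).add (expGrowth_indicator_one V)) hl.le fun k => ?_
        by_cases h1 : a ≤ poissonDiv l k <;> by_cases h2 : l ≤ (k : ℝ) <;>
          simp [Set.indicator, U, V, h1, h2, not_le.1, not_lt.2]
    _ = _ := poissonExp_add (expGrowth_indicator_one U) (expGrowth_indicator_one V) l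
    _ ≤ 0.46 * Real.exp (-a) + Real.exp (-a) := add_le_add hU hV
    _ = _ := by ring

/-! ### A verified table of logarithms -/

/-- The entries `(k, t)` with `t ≈ 10 ^ 14 * log k`, for `k ≤ 140`; the entry for `k = 0` is
`log 0 = 0`. -/
def logTable : List (ℕ × ℕ) :=
  [(0, 0), (1, 0), (2, 69314718055995), (3, 109861228866811), (4, 138629436111989),
   (5, 160943791243410), (6, 179175946922806), (7, 194591014905531), (8, 207944154167984),
   (9, 219722457733622), (10, 230258509299405), (11, 239789527279837), (12, 248490664978800),
   (13, 256494935746154), (14, 263905732961526), (15, 270805020110221), (16, 277258872223978),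
   (17, 283321334405622), (18, 289037175789616), (19, 294443897916644), (20, 299573227355399),
   (21, 304452243772342), (22, 309104245335832), (23, 313549421592915), (24, 317805383034795),
   (25, 321887582486820), (26, 325809653802148), (27, 329583686600433), (28, 333220451017520),
   (29, 336729582998647), (30, 340119738166216), (31, 343398720448515), (32, 346573590279973),
   (33, 349650756146648), (34, 352636052461616), (35, 355534806148941), (36, 358351893845611),
   (37, 361091791264422), (38, 363758615972639), (39, 366356164612965), (40, 368887945411394),
   (41, 371357206670431), (42, 373766961828337), (43, 376120011569356), (44, 378418963391826),
   (45, 380666248977032), (46, 382864139648910), (47, 385014760171006), (48, 387120101090789),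
   (49, 389182029811063), (50, 391202300542815), (51, 393182563272433), (52, 395124371858143),
   (53, 397029191355212), (54, 398898404656427), (55, 400733318523247), (56, 402535169073515),
   (57, 404305126783455), (58, 406044301054642), (59, 407753744390572), (60, 409434456222210),
   (61, 411087386417331), (62, 412713438504509), (63, 414313472639153), (64, 415888308335967),
   (65, 417438726989564), (66, 418965474202643), (67, 420469261939097), (68, 421950770517611),
   (69, 423410650459726), (70, 424849524204936), (71, 426267987704132), (72, 427666611901606),
   (73, 429045944114839), (74, 430406509320417), (75, 431748811353631), (76, 433073334028633),
   (77, 434380542185368), (78, 435670882668959), (79, 436944785246702), (80, 438202663467388),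
   (81, 439444915467244), (82, 440671924726425), (83, 441884060779660), (84, 443081679884331),
   (85, 444265125649032), (86, 445434729625351), (87, 446590811865458), (88, 447733681447821),
   (89, 448863636973214), (90, 449980967033027), (91, 451085950651685), (92, 452178857704904),
   (93, 453259949315326), (94, 454329478227000), (95, 455387689160054), (96, 456434819146784),
   (97, 457471097850338), (98, 458496747867057), (99, 459511985013459), (100, 460517018598809),
   (101, 461512051684126), (102, 462497281328427), (103, 463472898822964), (104, 464439089914137),
   (105, 465396035015752), (106, 466343909411207), (107, 467282883446191), (108, 468213122712422),
   (109, 469134788222914), (110, 470048036579242), (111, 470953020131233), (112, 471849887129509),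
   (113, 472738781871234), (114, 473619844839450), (115, 474493212836325), (116, 475359019110636),
   (117, 476217393479776), (118, 477068462446566), (119, 477912349311153), (120, 478749174278205),
   (121, 479579054559674), (122, 480402104473326), (123, 481218435537242), (124, 482028156560504),
   (125, 482831373730230), (126, 483628190695148), (127, 484418708645859), (128, 485203026391962),
   (129, 485981240436167), (130, 486753445045558), (131, 487519732320115), (132, 488280192258637),
   (133, 489034912822175), (134, 489783979995091), (135, 490527477843843), (136, 491265488573605),
   (137, 491998092582812), (138, 492725368515720), (139, 493447393313069), (140, 494164242260930)]

/-- A lower approximation of `10 ^ 14 * log (1 + 1 / k)`, from the first 15 terms of the series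
`log (1 + 1 / k) = ∑ 2 / (2 j + 1) * (2 k + 1) ^ (-(2 j + 1))`, each rounded down. -/
def logIncr (k : ℕ) : ℕ :=
  (List.range 15).foldr (fun j s => 2 * 10 ^ 14 / ((2 * j + 1) * (2 * k + 1) ^ (2 * j + 1)) + s) 0

theorem foldr_range_eq_sum (f : ℕ → ℕ) (n : ℕ) :
    (List.range n).foldr (fun j s => f j + s) 0 = ∑ j ∈ Finset.range n, f j := by
  suffices h : ∀ c, (List.range n).foldr (fun j s => f j + s) c = ∑ j ∈ Finset.range n, f j + c by
    rw [h, add_zero]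
  induction n with
  | zero => simp
  | succ n ih =>
    intro c
    rw [List.range_succ, List.foldr_append, ih, Finset.sum_range_succ, add_assoc]
    rfl

/-- The error consists of at most `1` for each of the 15 rounded terms and `1` for the remaining
terms of the series. -/
theorem logIncr_le {k : ℕ} (hk : 0 < k) :
    (logIncr k : ℝ) ≤ 10 ^ 14 * Real.log (1 + 1 / k) ∧
      10 ^ 14 * Real.log (1 + 1 / k) ≤ logIncr k + 16 := by
  have hk' : (1 : ℝ) ≤ k := by exact_mod_cast hk
  have hs := Real.hasSum_log_one_add_inv (a := (k : ℝ)) (by linarith)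
  rw [show (1 : ℝ) + 1 / k = 1 + (k : ℝ)⁻¹ by rw [one_div]]
  set g : ℕ → ℝ := fun j => 2 * (1 / (2 * (j : ℝ) + 1)) * (1 / (2 * (k : ℝ) + 1)) ^ (2 * j + 1)
    with hg
  have hg0 : ∀ j, 0 ≤ g j := fun j => by positivity
  have hterm : ∀ j : ℕ, (((2 * 10 ^ 14 / ((2 * j + 1) * (2 * k + 1) ^ (2 * j + 1)) : ℕ)) : ℝ)
      ≤ 10 ^ 14 * g j ∧ 10 ^ 14 * g j
        ≤ ((2 * 10 ^ 14 / ((2 * j + 1) * (2 * k + 1) ^ (2 * j + 1)) : ℕ) : ℝ) + 1 := by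
    intro j
    have e : 10 ^ 14 * g j = ((2 * 10 ^ 14 : ℕ) : ℝ)
        / (((2 * j + 1) * (2 * k + 1) ^ (2 * j + 1) : ℕ) : ℝ) := by
      rw [hg]; push_cast; rw [one_div_pow]; field_simp; norm_num
    rw [e]
    exact ⟨Nat.cast_div_le, by rw [← Nat.floor_div_eq_div (K := ℝ)]; exact (Nat.lt_floor_add_one _).le⟩
  have hsum := hs.summable.sum_add_tsum_nat_add 15
  rw [hs.tsum_eq] at hsum
  have htail0 : 0 ≤ ∑' j, g (j + 15) := tsum_nonneg fun j => hg0 _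
  have htail : ∑' j, g (j + 15) ≤ 1 / 10 ^ 14 := by
    have hgeo := (hasSum_geometric_of_lt_one (r := (1 / 9 : ℝ)) (by norm_num) (by norm_num)).mul_left
      ((1 / 3 : ℝ) ^ 31)
    refine (((summable_nat_add_iff 15).2 hs.summable).tsum_le_tsum (fun j => ?_)
      hgeo.summable).trans ?_
    · have h1 : 1 / (2 * (k : ℝ) + 1) ≤ 1 / 3 := by
        apply one_div_le_one_div_of_le <;> linarith
      have h2 : 2 * (1 / (2 * ((j + 15 : ℕ) : ℝ) + 1)) ≤ 1 := by
        push_cast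
        rw [mul_one_div, div_le_one (by positivity)]
        have : (0 : ℝ) ≤ j := Nat.cast_nonneg j
        linarith
      calc g (j + 15) ≤ 1 * (1 / 3 : ℝ) ^ (2 * (j + 15) + 1) := by
            rw [hg]; dsimp only; gcongr
        _ = (1 / 3 : ℝ) ^ 31 * (1 / 9) ^ j := by
            rw [show 2 * (j + 15) + 1 = 31 + 2 * j by ring, pow_add, pow_mul]; norm_num
    · rw [hgeo.tsum_eq]; norm_num
  have hL : (logIncr k : ℝ) = ∑ j ∈ Finset.range 15,
      ((2 * 10 ^ 14 / ((2 * j + 1) * (2 * k + 1) ^ (2 * j + 1)) : ℕ) : ℝ) := by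
    rw [logIncr, foldr_range_eq_sum]; push_cast; rfl
  have h1 := Finset.sum_le_sum fun j (_ : j ∈ Finset.range 15) => (hterm j).1
  have h2 := Finset.sum_le_sum fun j (_ : j ∈ Finset.range 15) => (hterm j).2
  rw [Finset.sum_add_distrib] at h2
  simp only [Finset.sum_const, Finset.card_range, nsmul_eq_mul, mul_one] at h2
  rw [← Finset.mul_sum] at h1 h2
  rw [hL, ← hsum, mul_add]
  constructor
  · have : (0 : ℝ) ≤ 10 ^ 14 * ∑' j, g (j + 15) := by positivity
    exact h1.trans (le_add_of_nonneg_right this)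
  · have : (10 : ℝ) ^ 14 * ∑' j, g (j + 15) ≤ 1 := by
      calc _ ≤ (10 : ℝ) ^ 14 * (1 / 10 ^ 14) := by gcongr
        _ = 1 := by norm_num
    refine (add_le_add h2 this).trans_eq ?_
    push_cast; ring

/-- The list consists of entries `(k, t)` with consecutive first components starting from the
given one, and `|10 ^ 14 * log k - t| ≤ 2400` in each of them. -/
def IsLogTable : ℕ → List (ℕ × ℕ) → Prop
  | _, [] => True
  | k, p :: ps => p.1 = k ∧ |10 ^ 14 * Real.log k - (p.2 : ℝ)| ≤ 2400 ∧ IsLogTable (k + 1) ps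

theorem IsLogTable.take {k : ℕ} {L : List (ℕ × ℕ)} (h : IsLogTable k L) (n : ℕ) :
    IsLogTable k (L.take n) := by
  induction L generalizing k n with
  | nil => simpa using h
  | cons p ps ih =>
    cases n with
    | zero => simp [IsLogTable]
    | succ n => exact ⟨h.1, h.2.1, ih h.2.2 n⟩

theorem IsLogTable.getElem {k : ℕ} {L : List (ℕ × ℕ)} (h : IsLogTable k L) {i : ℕ}
    (hi : i < L.length) : |10 ^ 14 * Real.log ((k + i : ℕ) : ℝ) - (L[i].2 : ℝ)| ≤ 2400 := by
  induction L generalizing k i with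
  | nil => simp at hi
  | cons p ps ih =>
    cases i with
    | zero => exact h.2.1
    | succ i =>
      have := ih h.2.2 (i := i) (by simpa using hi)
      rwa [show k + 1 + i = k + (i + 1) by ring] at this

/-- Compares the differences of successive entries with `logIncr`. -/
def checkLogIncr : List (ℕ × ℕ) → Bool
  | p :: q :: ps => q.1 == p.1 + 1 && Nat.ble (p.2 + logIncr p.1) q.2
      && Nat.ble q.2 (p.2 + logIncr p.1 + 16) && checkLogIncr (q :: ps)
  | _ => true

/-- Every step adds at most `16` to the error, so that it is at most `17 k` at the entry `k`. -/
theorem isLogTable_of_checkLogIncr (L : List (ℕ × ℕ)) (k : ℕ) (p : ℕ × ℕ) (hk : 0 < k)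
    (hL : k + L.length ≤ 140) (h : checkLogIncr (p :: L) = true) (hp1 : p.1 = k)
    (hp : |10 ^ 14 * Real.log k - (p.2 : ℝ)| ≤ (17 : ℝ) * k) : IsLogTable k (p :: L) := by
  have hb : (17 : ℝ) * k ≤ 2400 := by
    have : (k : ℝ) ≤ 140 := by exact_mod_cast (le_of_add_le_left hL)
    linarith
  induction L generalizing k p with
  | nil => exact ⟨hp1, hp.trans hb, trivial⟩
  | cons q ps ih =>
    simp only [checkLogIncr, Bool.and_eq_true, beq_iff_eq, Nat.ble_eq] at h
    obtain ⟨⟨⟨h1, h2⟩, h3⟩, h4⟩ := h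
    simp only [List.length_cons] at hL
    refine ⟨hp1, hp.trans hb, ih (k + 1) q (Nat.succ_pos k) (by omega) h4 (by omega) ?_ ?_⟩
    · have e : Real.log ((k + 1 : ℕ) : ℝ) = Real.log k + Real.log (1 + 1 / k) := by
        have : (k : ℝ) ≠ 0 := by positivity
        rw [← Real.log_mul this (by positivity)]
        congr 1; push_cast; field_simp
      have hi := logIncr_le hk
      rw [hp1] at h2 h3
      have h2' : (p.2 : ℝ) + logIncr k ≤ q.2 := by exact_mod_cast h2
      have h3' : (q.2 : ℝ) ≤ p.2 + logIncr k + 16 := by exact_mod_cast h3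
      rw [abs_le] at hp ⊢
      rw [e]
      push_cast
      constructor <;> linarith [hp.1, hp.2, hi.1, hi.2]
    · have : ((k + 1 : ℕ) : ℝ) ≤ 140 := by exact_mod_cast (by omega : k + 1 ≤ 140)
      linarith

set_option maxRecDepth 10000 in
theorem checkLogIncr_logTable : checkLogIncr logTable.tail = true := by decide +kernel

set_option maxRecDepth 10000 in
theorem isLogTable_logTable : IsLogTable 0 logTable := by
  have h := checkLogIncr_logTable
  refine ⟨rfl, by simp, ?_⟩
  exact isLogTable_of_checkLogIncr (logTable.tail.tail) 1 (1, 0) one_pos (by decide +kernel) h rfl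
    (by simp)

/-! ### Certified evaluation of Poisson expectations -/

/-- The remainder `∑ j, l ^ j * k! / (k + j)! * f (k + j)` of the exponential series after `k`
terms, normalized so that it obeys the Horner recursion. -/
noncomputable def expRem (l : ℝ) (f : ℕ → ℝ) (k : ℕ) : ℝ :=
  ∑' j : ℕ, l ^ j * (k.factorial : ℝ) / ((k + j).factorial : ℝ) * f (k + j)

theorem summable_expRem {f : ℕ → ℝ} (hf : ExpGrowth f) {l : ℝ} (hl : 0 < l) (k : ℕ) :
    Summable fun j : ℕ => l ^ j * (k.factorial : ℝ) / ((k + j).factorial : ℝ) * f (k + j) := by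
  have h := ((summable_nat_add_iff k).2 (hf.summable l)).mul_left ((k.factorial : ℝ) / l ^ k)
  refine h.congr fun j => ?_
  rw [add_comm j k, pow_add]
  field_simp

theorem expRem_eq {f : ℕ → ℝ} (hf : ExpGrowth f) {l : ℝ} (hl : 0 < l) (k : ℕ) :
    expRem l f k = f k + l / (k + 1) * expRem l f (k + 1) := by
  rw [expRem, (summable_expRem hf hl k).tsum_eq_zero_add, expRem, ← tsum_mul_left]
  congr 1
  · simp; field_simp
  · refine tsum_congr fun j => ?_
    rw [show k + (j + 1) = k + 1 + j by ring, Nat.factorial_succ k, pow_succ]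
    push_cast
    field_simp

theorem expRem_zero (l : ℝ) (f : ℕ → ℝ) :
    expRem l f 0 = ∑' k : ℕ, l ^ k / (k.factorial : ℝ) * f k := by
  simp [expRem]

theorem poissonExp_eq_expRem_div (l : ℝ) (f : ℕ → ℝ) :
    poissonExp l f = expRem l f 0 / Real.exp l := by
  rw [poissonExp, expRem_zero, Real.exp_neg]
  ring

theorem expRem_one (l : ℝ) : expRem l (fun _ => 1) 0 = Real.exp l := by
  have h := poissonExp_one l
  rwa [poissonExp_eq_expRem_div, div_eq_one_iff_eq (Real.exp_pos l).ne'] at h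

theorem expRem_nonneg {f : ℕ → ℝ} {l : ℝ} (hl : 0 ≤ l) (h : ∀ k, 0 ≤ f k) (k : ℕ) :
    0 ≤ expRem l f k :=
  tsum_nonneg fun j => mul_nonneg (by positivity) (h _)

/-- Far beyond the mean the terms decrease by a factor `1 / 2`. -/
theorem expRem_le_of_le_pow_four {f : ℕ → ℝ} (hf : ExpGrowth f) {l : ℝ} (hl : 0 < l) {m : ℕ}
    (hm : 20 ≤ m) (hlm : 5 * l ≤ 2 * (m + 1)) (h : ∀ k, m ≤ k → f k ≤ k ^ 4) :
    expRem l f m ≤ 2 * m ^ 4 := by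
  have hm' : (20 : ℝ) ≤ m := by exact_mod_cast hm
  have hterm : ∀ j : ℕ, l ^ j * (m.factorial : ℝ) / ((m + j).factorial : ℝ) * ((m + j : ℕ) : ℝ) ^ 4
      ≤ m ^ 4 * (1 / 2) ^ j := by
    intro j
    induction j with
    | zero => simp; field_simp; rfl
    | succ j ih =>
      have hj : (0 : ℝ) ≤ j := Nat.cast_nonneg j
      have key : l / (m + j + 1) * ((m + j + 1 : ℝ) / (m + j)) ^ 4 ≤ 1 / 2 := by
        have h1 : l / (m + j + 1) ≤ 2 / 5 := by
          rw [div_le_div_iff₀ (by positivity) (by norm_num)]; linarith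
        have h2 : (m + j + 1 : ℝ) / (m + j) ≤ 21 / 20 := by
          rw [div_le_div_iff₀ (by positivity) (by norm_num)]; linarith
        calc _ ≤ 2 / 5 * (21 / 20 : ℝ) ^ 4 := by gcongr
          _ ≤ _ := by norm_num
      calc _ = (l ^ j * (m.factorial : ℝ) / ((m + j).factorial : ℝ) * ((m + j : ℕ) : ℝ) ^ 4)
            * (l / (m + j + 1) * ((m + j + 1 : ℝ) / (m + j)) ^ 4) := by
            rw [← add_assoc, Nat.factorial_succ, pow_succ]
            push_cast
            field_simp
        _ ≤ (m ^ 4 * (1 / 2) ^ j) * (1 / 2) := by gcongr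
        _ = _ := by ring
  have hg := (hasSum_geometric_of_lt_one (r := (1 / 2 : ℝ)) (by norm_num) (by norm_num)).mul_left
    ((m : ℝ) ^ 4)
  refine ((summable_expRem hf hl m).tsum_le_tsum (fun j => ?_) hg.summable).trans_eq ?_
  · refine le_trans ?_ (hterm j)
    gcongr
    exact h _ (Nat.le_add_right _ _)
  · rw [hg.tsum_eq]; ring

/-- Horner's scheme for `10 ^ 14 * expRem (a / b) f k`, rounded up: `g` bounds the scaled values of
`f` at the entries of the list, `t` the scaled remainder. -/
def hornerUp (a b : ℕ) (g : ℕ × ℕ → ℕ) (t : ℕ) (L : List (ℕ × ℕ)) : ℕ :=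
  L.foldr (fun p s => g p + a * s / (b * (p.1 + 1)) + 1) t

/-- Horner's scheme for `10 ^ 14 * expRem (a / b) f k`, rounded down. -/
def hornerDown (a b : ℕ) (g : ℕ × ℕ → ℕ) (L : List (ℕ × ℕ)) : ℕ :=
  L.foldr (fun p s => g p + a * s / (b * (p.1 + 1))) 0

theorem natDiv_le_and_le (a b : ℕ) :
    ((a / b : ℕ) : ℝ) ≤ a / b ∧ (a : ℝ) / b ≤ ((a / b : ℕ) : ℝ) + 1 :=
  ⟨Nat.cast_div_le, by rw [← Nat.floor_div_eq_div (K := ℝ)]; exact (Nat.lt_floor_add_one _).le⟩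

theorem le_hornerUp {f : ℕ → ℝ} (hf : ExpGrowth f) {a b : ℕ} (ha : 0 < a) (hb : 0 < b)
    {g : ℕ × ℕ → ℕ} {t : ℕ}
    (hg : ∀ p : ℕ × ℕ, |10 ^ 14 * Real.log p.1 - (p.2 : ℝ)| ≤ 2400 → 10 ^ 14 * f p.1 ≤ g p)
    {L : List (ℕ × ℕ)} {k : ℕ} (hL : IsLogTable k L)
    (ht : 10 ^ 14 * expRem (a / b) f (k + L.length) ≤ t) :
    10 ^ 14 * expRem (a / b) f k ≤ hornerUp a b g t L := by
  induction L generalizing k with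
  | nil => simpa [hornerUp] using ht
  | cons p ps ih =>
    obtain ⟨rfl, h2, h3⟩ := hL
    have hs := ih h3 (by rwa [List.length_cons, add_comm ps.length, ← add_assoc] at ht)
    have hab : (0 : ℝ) < a / b := by positivity
    have h4 := hg p h2
    change _ ≤ ((g p + a * hornerUp a b g t ps / (b * (p.1 + 1)) + 1 : ℕ) : ℝ)
    rw [expRem_eq hf hab]
    have h5 := (natDiv_le_and_le (a * hornerUp a b g t ps) (b * (p.1 + 1))).2
    push_cast at h5 ⊢
    have h6 : 10 ^ 14 * ((a : ℝ) / b / (p.1 + 1) * expRem (a / b) f (p.1 + 1))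
        ≤ a * hornerUp a b g t ps / (b * (p.1 + 1)) := by
      calc _ = (a : ℝ) / b / (p.1 + 1) * (10 ^ 14 * expRem (a / b) f (p.1 + 1)) := by ring
        _ ≤ (a : ℝ) / b / (p.1 + 1) * hornerUp a b g t ps := by gcongr
        _ = _ := by field_simp
    linarith

theorem hornerDown_le {f : ℕ → ℝ} (hf : ExpGrowth f) {a b : ℕ} (ha : 0 < a) (hb : 0 < b)
    (hf0 : ∀ k, 0 ≤ f k) {g : ℕ × ℕ → ℕ}
    (hg : ∀ p : ℕ × ℕ, |10 ^ 14 * Real.log p.1 - (p.2 : ℝ)| ≤ 2400 → g p ≤ 10 ^ 14 * f p.1)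
    {L : List (ℕ × ℕ)} {k : ℕ} (hL : IsLogTable k L) :
    hornerDown a b g L ≤ 10 ^ 14 * expRem (a / b) f k := by
  induction L generalizing k with
  | nil =>
    have := expRem_nonneg (l := (a : ℝ) / b) (by positivity) hf0 k
    simp only [hornerDown, List.foldr_nil, Nat.cast_zero]
    positivity
  | cons p ps ih =>
    obtain ⟨rfl, h2, h3⟩ := hL
    have hs := ih h3
    have hab : (0 : ℝ) < a / b := by positivity
    have h4 := hg p h2
    change ((g p + a * hornerDown a b g ps / (b * (p.1 + 1)) : ℕ) : ℝ) ≤ _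
    rw [expRem_eq hf hab]
    have h5 := (natDiv_le_and_le (a * hornerDown a b g ps) (b * (p.1 + 1))).1
    push_cast at h5 ⊢
    have h6 : a * hornerDown a b g ps / (b * (p.1 + 1))
        ≤ 10 ^ 14 * ((a : ℝ) / b / (p.1 + 1) * expRem (a / b) f (p.1 + 1)) := by
      calc _ = (a : ℝ) / b / (p.1 + 1) * hornerDown a b g ps := by field_simp
        _ ≤ (a : ℝ) / b / (p.1 + 1) * (10 ^ 14 * expRem (a / b) f (p.1 + 1)) := by gcongr
        _ = _ := by ring
    linarith

/-- The tabulated value of `10 ^ 14 * log k`. -/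
def logEntry (k : ℕ) : ℕ := (logTable.getD k (0, 0)).2

theorem abs_sub_logEntry_le {k : ℕ} (hk : k ≤ 140) :
    |10 ^ 14 * Real.log k - (logEntry k : ℝ)| ≤ 2400 := by
  have hlen : logTable.length = 141 := by decide +kernel
  have hk' : k < logTable.length := by omega
  have h := isLogTable_logTable.getElem hk'
  rw [zero_add] at h
  rwa [logEntry, List.getD_eq_getElem _ _ hk']

/-- An upper bound of `10 ^ 14 * poissonDiv (c / d) k` from the entry `p = (k, 10 ^ 14 * log k)`. -/
def divUp (c d : ℕ) (p : ℕ × ℕ) : ℕ :=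
  p.1 * (p.2 + logEntry d + 7200) + 10 ^ 14 * c / d + 1 - (p.1 * logEntry c + 10 ^ 14 * p.1)

/-- A lower bound of `10 ^ 14 * poissonDiv (c / d) k` from the entry `p = (k, 10 ^ 14 * log k)`. -/
def divDown (c d : ℕ) (p : ℕ × ℕ) : ℕ :=
  p.1 * (p.2 + logEntry d) + 10 ^ 14 * c / d - (p.1 * (logEntry c + 7200) + 10 ^ 14 * p.1)

theorem poissonDiv_div_eq {c d : ℕ} (hc : 0 < c) (hd : 0 < d) (k : ℕ) :
    10 ^ 14 * poissonDiv (c / d) k = k * (10 ^ 14 * Real.log k - 10 ^ 14 * Real.log c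
      + 10 ^ 14 * Real.log d) + 10 ^ 14 * c / d - 10 ^ 14 * k := by
  rw [poissonDiv_eq (by positivity), Real.log_div (by positivity) (by positivity)]
  ring

theorem le_divUp {c d : ℕ} (hc : 0 < c) (hd : 0 < d) (hc' : c ≤ 140) (hd' : d ≤ 140) (p : ℕ × ℕ)
    (hp : |10 ^ 14 * Real.log p.1 - (p.2 : ℝ)| ≤ 2400) :
    10 ^ 14 * poissonDiv (c / d) p.1 ≤ divUp c d p := by
  have h1 := abs_le.1 hp
  have h2 := abs_le.1 (abs_sub_logEntry_le hc')
  have h3 := abs_le.1 (abs_sub_logEntry_le hd')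
  have h4 := (natDiv_le_and_le (10 ^ 14 * c) d).2
  have h5 : ((p.1 * (p.2 + logEntry d + 7200) + 10 ^ 14 * c / d + 1 : ℕ) : ℝ)
      ≤ divUp c d p + ((p.1 * logEntry c + 10 ^ 14 * p.1 : ℕ) : ℝ) := by
    have : p.1 * (p.2 + logEntry d + 7200) + 10 ^ 14 * c / d + 1
        ≤ divUp c d p + (p.1 * logEntry c + 10 ^ 14 * p.1) := by rw [divUp]; omega
    exact_mod_cast this
  rw [poissonDiv_div_eq hc hd]
  have h6 : (p.1 : ℝ) * (10 ^ 14 * Real.log p.1 - 10 ^ 14 * Real.log c + 10 ^ 14 * Real.log d)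
      ≤ p.1 * (p.2 - logEntry c + logEntry d + 7200) :=
    mul_le_mul_of_nonneg_left (by linarith) (Nat.cast_nonneg _)
  push_cast at h4 h5
  linarith

theorem divDown_le {c d : ℕ} (hc : 0 < c) (hd : 0 < d) (hc' : c ≤ 140) (hd' : d ≤ 140) (p : ℕ × ℕ)
    (hp : |10 ^ 14 * Real.log p.1 - (p.2 : ℝ)| ≤ 2400) :
    divDown c d p ≤ 10 ^ 14 * poissonDiv (c / d) p.1 := by
  have h1 := abs_le.1 hp
  have h2 := abs_le.1 (abs_sub_logEntry_le hc')
  have h3 := abs_le.1 (abs_sub_logEntry_le hd')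
  have h4 := (natDiv_le_and_le (10 ^ 14 * c) d).1
  rcases le_total (p.1 * (p.2 + logEntry d) + 10 ^ 14 * c / d)
    (p.1 * (logEntry c + 7200) + 10 ^ 14 * p.1) with h | h
  · rw [divDown, Nat.sub_eq_zero_of_le h, Nat.cast_zero]
    have := poissonDiv_nonneg (l := (c : ℝ) / d) (by positivity) p.1
    positivity
  · rw [divDown, Nat.cast_sub h, poissonDiv_div_eq hc hd]
    have h6 : (p.1 : ℝ) * (p.2 - logEntry c + logEntry d - 7200)
      ≤ p.1 * (10 ^ 14 * Real.log p.1 - 10 ^ 14 * Real.log c + 10 ^ 14 * Real.log d) :=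
      mul_le_mul_of_nonneg_left (by linarith) (Nat.cast_nonneg _)
    push_cast at h4 ⊢
    linarith

theorem poissonDiv_le_sq {l : ℝ} (hl : 1 / 8 ≤ l) {k : ℕ} (hk : 20 ≤ k) (hlk : l ≤ k) :
    poissonDiv l k ≤ k ^ 2 := by
  have hk' : (20 : ℝ) ≤ k := by exact_mod_cast hk
  have h1 : Real.log k ≤ k / 2 - 1 + 1 := by
    have h := Real.log_le_sub_one_of_pos (show (0 : ℝ) < k / 2 by positivity)
    rw [Real.log_div (by positivity) (by norm_num)] at h
    linarith [Real.log_two_lt_d9]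
  have h2 : -3 ≤ Real.log l := by
    have h := Real.log_le_log (by norm_num) hl
    have h3 : Real.log (1 / 8 : ℝ) = -(3 * Real.log 2) := by
      rw [one_div, Real.log_inv, show (8 : ℝ) = 2 ^ 3 by norm_num, Real.log_pow]; norm_num
    linarith [Real.log_two_lt_d9]
  rw [poissonDiv_eq (by linarith)]
  have h4 : (k : ℝ) * (Real.log k - Real.log l) ≤ k * (k / 2 + 3) :=
    mul_le_mul_of_nonneg_left (by linarith) (Nat.cast_nonneg _)
  nlinarith

theorem hornerDown_pos {a b : ℕ} {g : ℕ × ℕ → ℕ} (hg : ∀ p, 0 < g p) {L : List (ℕ × ℕ)}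
    (hL : L ≠ []) : 0 < hornerDown a b g L := by
  cases L with
  | nil => exact absurd rfl hL
  | cons p ps => exact Nat.add_pos_left (hg p) _

/-- An upper bound of `10 ^ 14 * E[I(Y ‖ c / d)]`, for `Y` Poisson with mean `a / b`, from the first
`m` terms of the series. -/
def meanUp (m a b c d : ℕ) : ℕ :=
  hornerUp a b (divUp c d) (2 * 10 ^ 14 * m ^ 4) (logTable.take m) * 10 ^ 14
    / hornerDown a b (fun _ => 10 ^ 14) (logTable.take m) + 1

/-- An upper bound of `10 ^ 14 * E[I(Y ‖ c / d) ^ 2]`. -/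
def sqMeanUp (m a b c d : ℕ) : ℕ :=
  hornerUp a b (fun p => divUp c d p ^ 2 / 10 ^ 14 + 1) (2 * 10 ^ 14 * m ^ 4) (logTable.take m)
    * 10 ^ 14 / hornerDown a b (fun _ => 10 ^ 14) (logTable.take m) + 1

/-- A lower bound of `10 ^ 14 * E[I(Y ‖ c / d)]`. -/
def meanDown (m a b c d : ℕ) : ℕ :=
  hornerDown a b (divDown c d) (logTable.take m) * 10 ^ 14
    / hornerUp a b (fun _ => 10 ^ 14) (2 * 10 ^ 14 * m ^ 4) (logTable.take m)

section Correctness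

variable {m a b : ℕ}

theorem length_take_logTable (hm' : m ≤ 140) : (logTable.take m).length = m := by
  have : logTable.length = 141 := by decide +kernel
  rw [List.length_take]; omega

theorem expRem_le_tail (hm : 20 ≤ m) (hm' : m ≤ 140) (ha : 0 < a) (hb : 0 < b)
    (hab : 5 * a ≤ 2 * (m + 1) * b) {f : ℕ → ℝ} (hf : ExpGrowth f)
    (h : ∀ k, m ≤ k → f k ≤ k ^ 4) :
    10 ^ 14 * expRem (a / b) f (0 + (logTable.take m).length) ≤ ((2 * 10 ^ 14 * m ^ 4 : ℕ) : ℝ) := by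
  rw [length_take_logTable hm', zero_add]
  have hab' : 5 * ((a : ℝ) / b) ≤ 2 * (m + 1) := by
    rw [← mul_div_assoc, div_le_iff₀ (by positivity)]
    exact_mod_cast hab
  have := expRem_le_of_le_pow_four hf (by positivity) hm hab' h
  push_cast
  linarith

theorem hornerDown_exp_le (ha : 0 < a) (hb : 0 < b) :
    (hornerDown a b (fun _ => 10 ^ 14) (logTable.take m) : ℝ) ≤ 10 ^ 14 * Real.exp (a / b) := by
  rw [← expRem_one]
  exact hornerDown_le (ExpGrowth.const 1) ha hb (fun _ => zero_le_one) (fun p _ => by norm_num)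
    (isLogTable_logTable.take m)

theorem le_hornerUp_exp (hm : 20 ≤ m) (hm' : m ≤ 140) (ha : 0 < a) (hb : 0 < b)
    (hab : 5 * a ≤ 2 * (m + 1) * b) :
    10 ^ 14 * Real.exp (a / b)
      ≤ hornerUp a b (fun _ => 10 ^ 14) (2 * 10 ^ 14 * m ^ 4) (logTable.take m) := by
  rw [← expRem_one]
  refine le_hornerUp (ExpGrowth.const 1) ha hb (fun p _ => by norm_num) (isLogTable_logTable.take m)
    (expRem_le_tail hm hm' ha hb hab (ExpGrowth.const 1) fun k hk => ?_)
  have : (1 : ℝ) ≤ k := by exact_mod_cast (by omega : 1 ≤ k)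
  exact one_le_pow₀ this

theorem hornerDown_exp_pos (hm : 20 ≤ m) (a b : ℕ) :
    0 < hornerDown a b (fun _ => 10 ^ 14) (logTable.take m) := by
  refine hornerDown_pos (fun _ => by positivity) ?_
  rw [Ne, List.take_eq_nil_iff, not_or]
  exact ⟨by omega, by simp [logTable]⟩

theorem poissonExp_le_of_horner (hm : 20 ≤ m) (ha : 0 < a) (hb : 0 < b) {f : ℕ → ℝ} {U : ℕ}
    (hU : 10 ^ 14 * expRem (a / b) f 0 ≤ U) :
    10 ^ 14 * poissonExp (a / b) f ≤ ((U * 10 ^ 14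
      / hornerDown a b (fun _ => 10 ^ 14) (logTable.take m) + 1 : ℕ) : ℝ) := by
  have hD := hornerDown_exp_le (m := m) ha hb
  have hD0 : (0 : ℝ) < hornerDown a b (fun _ => 10 ^ 14) (logTable.take m) := by
    exact_mod_cast hornerDown_exp_pos hm a b
  have h := (natDiv_le_and_le (U * 10 ^ 14)
    (hornerDown a b (fun _ => 10 ^ 14) (logTable.take m))).2
  push_cast at h ⊢
  refine le_trans ?_ h
  rw [poissonExp_eq_expRem_div]
  calc 10 ^ 14 * (expRem (a / b) f 0 / Real.exp (a / b))
      = 10 ^ 14 * expRem (a / b) f 0 * 10 ^ 14 / (10 ^ 14 * Real.exp (a / b)) := by field_simp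
    _ ≤ U * 10 ^ 14 / (10 ^ 14 * Real.exp (a / b)) := by gcongr
    _ ≤ U * 10 ^ 14 / hornerDown a b (fun _ => 10 ^ 14) (logTable.take m) := by gcongr
    _ = _ := by norm_num

variable {c d : ℕ} (hm : 20 ≤ m) (hm' : m ≤ 140) (ha : 0 < a) (hb : 0 < b) (hc : 0 < c)
  (hd : 0 < d) (hab : 5 * a ≤ 2 * (m + 1) * b) (hcd : 5 * c ≤ 2 * (m + 1) * d)
  (hcd' : d ≤ 8 * c) (hc' : c ≤ 140) (hd' : d ≤ 140)

include hm hd hcd hcd' in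
theorem poissonDiv_div_le_sq {k : ℕ} (hk : m ≤ k) : poissonDiv (c / d) k ≤ k ^ 2 := by
  refine poissonDiv_le_sq ?_ (by omega) ?_
  · rw [div_le_div_iff₀ (by norm_num) (by positivity)]; exact_mod_cast (by omega)
  · rw [div_le_iff₀ (by positivity)]
    have : c ≤ k * d := by nlinarith
    exact_mod_cast this

include hm hm' ha hb hc hd hab hcd hcd' hc' hd'

theorem le_meanUp :
    10 ^ 14 * poissonExp (a / b) (poissonDiv (c / d)) ≤ meanUp m a b c d := by
  have hcd0 : (0 : ℝ) < c / d := by positivity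
  refine poissonExp_le_of_horner hm ha hb (le_hornerUp (expGrowth_poissonDiv hcd0) ha hb
    (fun p hp => le_divUp hc hd hc' hd' p hp) (isLogTable_logTable.take m)
    (expRem_le_tail hm hm' ha hb hab (expGrowth_poissonDiv hcd0) fun k hk => ?_))
  have h1 := poissonDiv_div_le_sq hm hd hcd hcd' hk
  have h2 : (1 : ℝ) ≤ k := by exact_mod_cast (by omega : 1 ≤ k)
  exact h1.trans (pow_le_pow_right₀ h2 (by norm_num))

theorem le_sqMeanUp :
    10 ^ 14 * poissonExp (a / b) (fun k => poissonDiv (c / d) k ^ 2) ≤ sqMeanUp m a b c d := by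
  have hcd0 : (0 : ℝ) < c / d := by positivity
  refine poissonExp_le_of_horner hm ha hb (le_hornerUp ((expGrowth_poissonDiv hcd0).pow 2) ha hb
    (fun p hp => ?_) (isLogTable_logTable.take m)
    (expRem_le_tail hm hm' ha hb hab ((expGrowth_poissonDiv hcd0).pow 2) fun k hk => ?_))
  · have h1 := le_divUp hc hd hc' hd' p hp
    have h0 := poissonDiv_nonneg hcd0 p.1
    have h2 := (natDiv_le_and_le (divUp c d p ^ 2) (10 ^ 14)).2
    have h3 := pow_le_pow_left₀ (by positivity) h1 2
    push_cast at h2 ⊢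
    refine le_trans ?_ h2
    rw [le_div_iff₀ (by positivity)]
    linarith
  · have h1 := poissonDiv_div_le_sq hm hd hcd hcd' hk
    have h0 := poissonDiv_nonneg hcd0 k
    calc poissonDiv (c / d) k ^ 2 ≤ ((k : ℝ) ^ 2) ^ 2 := by gcongr
      _ = _ := by ring

omit hcd hcd' in
theorem meanDown_le :
    meanDown m a b c d ≤ 10 ^ 14 * poissonExp (a / b) (poissonDiv (c / d)) := by
  have hcd0 : (0 : ℝ) < c / d := by positivity
  have hE := le_hornerUp_exp hm hm' ha hb hab
  have hN := hornerDown_le (expGrowth_poissonDiv hcd0) ha hb (poissonDiv_nonneg hcd0)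
    (fun p hp => divDown_le hc hd hc' hd' p hp) (isLogTable_logTable.take m)
  have h := (natDiv_le_and_le (hornerDown a b (divDown c d) (logTable.take m) * 10 ^ 14)
    (hornerUp a b (fun _ => 10 ^ 14) (2 * 10 ^ 14 * m ^ 4) (logTable.take m))).1
  refine h.trans ?_
  rw [poissonExp_eq_expRem_div, Nat.cast_mul, show ((10 ^ 14 : ℕ) : ℝ) = 10 ^ 14 by norm_num]
  calc _ ≤ (hornerDown a b (divDown c d) (logTable.take m) : ℝ) * 10 ^ 14
        / (10 ^ 14 * Real.exp (a / b)) := by gcongr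
    _ ≤ 10 ^ 14 * expRem (a / b) (poissonDiv (c / d)) 0 * 10 ^ 14
        / (10 ^ 14 * Real.exp (a / b)) := by gcongr
    _ = _ := by field_simp

end Correctness

/-- The numerical conditions on an interval with end points `a / b < c / d` from which the three
moment bounds follow on the whole interval by convexity. The products of the tolerances `0.5803`,
`2.79245191` and `0.608` with `10 ^ 14` appear as integers. -/
def checkCell (a b c d : ℕ) : Bool :=
  let m := 20 + 5 * c / (2 * d)
  let p := max (meanUp m a b a b) (meanUp m c d c d)
  let x := meanUp m a b c d + meanUp m c d a b
  let q := max (sqMeanUp m a b a b) (sqMeanUp m c d c d)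
  let y := sqMeanUp m a b c d + sqMeanUp m c d a b
  let l := min (meanDown m a b a b) (meanDown m c d c d)
    - (10 ^ 14 * (c * b - a * d) ^ 2 / (4 * a * b * d ^ 2) + 1)
  let v := 60800000000000 + l ^ 2 / 10 ^ 14
  let r := max (10000 * sqMeanUp m a b a b + 33394 * meanUp m a b a b)
    (10000 * sqMeanUp m c d c d + 33394 * meanUp m c d c d)
  Nat.ble m 140 && Nat.ble 1 a && Nat.ble 1 b && Nat.ble 1 d && Nat.ble (a * d) (c * b)
    && Nat.ble b (8 * a) && Nat.ble (max (max a b) (max c d)) 140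
    && Nat.ble p 58030000000000 && Nat.ble (x + 2 * p) (4 * 58030000000000)
    && Nat.ble q v && Nat.ble (y + 2 * q) (4 * v)
    && Nat.ble r 2792451910000000000
    && Nat.ble (10000 * y + 33394 * x + 2 * r) (4 * 2792451910000000000)

/-- `checkCell` for all pairs of consecutive points. -/
def checkGrid : List (ℕ × ℕ) → Bool
  | p :: q :: ps => checkCell p.1 p.2 q.1 q.2 && checkGrid (q :: ps)
  | _ => true

/-- Numerators and denominators of the end points of the intervals covering `[1 / 8, 45]`. -/
def grid : List (ℕ × ℕ) :=
  [(1, 8), (2, 5), (30, 41), (59, 62), (59, 54), (13, 11), (67, 54), (73, 57), (72, 55),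
    (85, 64), (50, 37), (11, 8), (83, 59), (45, 31), (41, 27), (34, 21), (86, 49), (69, 37),
    (51, 26), (107, 52), (95, 44), (98, 43), (17, 7), (13, 5), (118, 43), (112, 39), (119, 40),
    (34, 11), (106, 33), (87, 26), (115, 33), (117, 32), (85, 22), (37, 9), (119, 27),
    (119, 25), (119, 23), (113, 20), (99, 16), (34, 5), (112, 15), (115, 14), (9, 1), (69, 7),
    (97, 9), (47, 4), (115, 9), (97, 7), (15, 1), (81, 5), (87, 5), (56, 3), (20, 1), (107, 5),
    (114, 5), (97, 4), (103, 4), (82, 3), (29, 1), (92, 3), (97, 3), (34, 1), (107, 3),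
    (75, 2), (118, 3), (41, 1), (43, 1), (45, 1)]

set_option maxRecDepth 100000 in
theorem checkGrid_grid : checkGrid grid = true := by decide +kernel

/-! ### Moments of the I-divergence on the middle range, by convexity -/

/-- A function that is convex in each variable separately is bounded on the diagonal of a square by
its values at the corners. -/
theorem diag_le_of_separately_convex {F : ℝ → ℝ → ℝ} {a b : ℝ} (hab : a ≤ b)
    (h1 : ∀ y ∈ Set.Icc a b, ConvexOn ℝ (Set.Icc a b) fun x => F x y)
    (h2 : ∀ x ∈ Set.Icc a b, ConvexOn ℝ (Set.Icc a b) (F x)) {m X g : ℝ}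
    (ha : F a a ≤ m) (hb : F b b ≤ m) (hX : F a b + F b a ≤ X) (hm : m ≤ g)
    (hg : X + 2 * m ≤ 4 * g) {x : ℝ} (hx : x ∈ Set.Icc a b) : F x x ≤ g := by
  have ha' : a ∈ Set.Icc a b := ⟨le_rfl, hab⟩
  have hb' : b ∈ Set.Icc a b := ⟨hab, le_rfl⟩
  obtain ⟨s, t, hs, ht, hst, rfl⟩ : ∃ s t : ℝ, 0 ≤ s ∧ 0 ≤ t ∧ s + t = 1 ∧ s • a + t • b = x := by
    rwa [← segment_eq_Icc hab] at hx
  have e1 := (h1 _ hx).2 ha' hb' hs ht hst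
  have e2 := (h2 a ha').2 ha' hb' hs ht hst
  have e3 := (h2 b hb').2 ha' hb' hs ht hst
  simp only [smul_eq_mul] at e1 e2 e3 ⊢
  obtain rfl : t = 1 - s := by linarith
  have e4 := mul_le_mul_of_nonneg_left e2 hs
  have e5 := mul_le_mul_of_nonneg_left e3 ht
  have e6 := mul_le_mul_of_nonneg_left ha (mul_nonneg hs hs)
  have e7 := mul_le_mul_of_nonneg_left hb (mul_nonneg ht ht)
  have e8 := mul_le_mul_of_nonneg_left hX (mul_nonneg hs ht)
  have e9 := mul_le_mul_of_nonneg_left hg (mul_nonneg hs ht)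
  nlinarith [mul_nonneg (sq_nonneg (2 * s - 1)) (sub_nonneg.2 hm)]

theorem convexOn_poissonDiv_param (k : ℕ) : ConvexOn ℝ (Set.Ioi 0) fun l => poissonDiv l k := by
  have h1 : ConvexOn ℝ (Set.Ioi 0) fun l : ℝ => (k : ℝ) * -Real.log l :=
    (strictConcaveOn_log_Ioi.concaveOn.neg).smul (Nat.cast_nonneg k)
  have h2 : ConvexOn ℝ (Set.Ioi 0) fun l : ℝ => (k : ℝ) * -Real.log l + (l + (k * Real.log k - k)) :=
    h1.add ((convexOn_id (convex_Ioi 0)).add (convexOn_const _ (convex_Ioi 0)))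
  refine h2.congr fun l hl => ?_
  rw [poissonDiv_eq hl]; ring

theorem convexOn_poissonDiv_sq_param (k : ℕ) :
    ConvexOn ℝ (Set.Ioi 0) fun l => poissonDiv l k ^ 2 :=
  (convexOn_poissonDiv_param k).pow (fun _ hl => poissonDiv_nonneg hl k) 2

theorem convexOn_poissonExp_param {l : ℝ} (hl : 0 ≤ l) {s : Set ℝ} (hs : Convex ℝ s)
    {f : ℝ → ℕ → ℝ} (hf : ∀ n ∈ s, ExpGrowth (f n)) (h : ∀ k, ConvexOn ℝ s fun n => f n k) :
    ConvexOn ℝ s fun n => poissonExp l (f n) := by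
  refine ⟨hs, fun x hx y hy p q hp hq hpq => ?_⟩
  simp only [smul_eq_mul]
  rw [← poissonExp_const_mul, ← poissonExp_const_mul,
    ← poissonExp_add ((hf x hx).const_mul p) ((hf y hy).const_mul q)]
  exact poissonExp_mono (hf _ (hs hx hy hp hq hpq))
    (((hf x hx).const_mul p).add ((hf y hy).const_mul q)) hl fun k => (h k).2 hx hy hp hq hpq

/-- The second difference of `k log k` is between `0` and `2 / (k + 1)`. -/
theorem diff2_mul_log_mem (k : ℕ) :
    0 ≤ ((k + 2 : ℕ) : ℝ) * Real.log (k + 2 : ℕ) - 2 * (((k + 1 : ℕ) : ℝ) * Real.log (k + 1 : ℕ))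
        + k * Real.log k ∧
      ((k + 2 : ℕ) : ℝ) * Real.log (k + 2 : ℕ) - 2 * (((k + 1 : ℕ) : ℝ) * Real.log (k + 1 : ℕ))
        + k * Real.log k ≤ 2 / (k + 1) := by
  push_cast
  have hk : (0 : ℝ) ≤ k := Nat.cast_nonneg k
  constructor
  · have h := Real.convexOn_mul_log.2 (show (k : ℝ) ∈ Set.Ici 0 from hk)
      (show (k : ℝ) + 2 ∈ Set.Ici 0 from add_nonneg hk zero_le_two)
      one_half_pos.le one_half_pos.le (add_halves 1)
    simp only [smul_eq_mul] at h
    rw [show 1 / 2 * (k : ℝ) + 1 / 2 * (k + 2) = k + 1 by ring] at h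
    linarith
  · have h1 : Real.log (k + 2) - Real.log (k + 1) ≤ 1 / (k + 1) := by
      rw [← Real.log_div (by positivity) (by positivity)]
      refine (Real.log_le_sub_one_of_pos (by positivity)).trans_eq ?_
      field_simp; ring
    have h2 : (k : ℝ) / (k + 1) ≤ k * (Real.log (k + 1) - Real.log k) := by
      rcases hk.eq_or_lt with h | h
      · rw [← h]; simp
      · have h3 := Real.log_le_sub_one_of_pos (show (0 : ℝ) < k / (k + 1) by positivity)
        rw [Real.log_div (by positivity) (by positivity)] at h3
        have h4 : (1 : ℝ) / (k + 1) = 1 - k / (k + 1) := by field_simp; ring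
        have : 1 / ((k : ℝ) + 1) ≤ Real.log (k + 1) - Real.log k := by linarith
        calc (k : ℝ) / (k + 1) = k * (1 / (k + 1)) := by ring
          _ ≤ _ := by gcongr
    have h3 := mul_le_mul_of_nonneg_left h1 (by positivity : (0 : ℝ) ≤ k + 2)
    have h4 : (2 : ℝ) / (k + 1) = (k + 2) * (1 / (k + 1)) - k / (k + 1) := by field_simp; ring
    rw [h4]; linarith

theorem diff2_poissonDiv {l : ℝ} (hl : 0 < l) (k : ℕ) :
    0 ≤ poissonDiv l (k + 2) - 2 * poissonDiv l (k + 1) + poissonDiv l k := by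
  have h := (diff2_mul_log_mem k).1
  rw [poissonDiv_eq hl, poissonDiv_eq hl, poissonDiv_eq hl]
  push_cast at h ⊢
  linarith

theorem diff2_poissonDiv_sq {l : ℝ} (hl : 0 < l) (k : ℕ) :
    0 ≤ poissonDiv l (k + 2) ^ 2 - 2 * poissonDiv l (k + 1) ^ 2 + poissonDiv l k ^ 2 := by
  have h := diff2_poissonDiv hl k
  have h1 := poissonDiv_nonneg hl (k + 1)
  nlinarith [sq_nonneg (poissonDiv l (k + 2) - poissonDiv l k),
    mul_nonneg h h1, poissonDiv_nonneg hl k, poissonDiv_nonneg hl (k + 2)]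

theorem poissonExp_natCast (l : ℝ) : poissonExp l (fun k => (k : ℝ)) = l := by
  have h := poissonExp_natCast_mul (ExpGrowth.const 1) l
  simpa [poissonExp_one] using h

theorem expGrowth_mul_log : ExpGrowth fun k : ℕ => (k : ℝ) * Real.log k :=
  ExpGrowth.natCast.mul ExpGrowth.log

theorem poissonExp_poissonDiv {l : ℝ} (hl : 0 < l) :
    poissonExp l (poissonDiv l) = poissonExp l (fun k => k * Real.log k) - l * Real.log l := by
  have e : poissonDiv l = fun k : ℕ => (k * Real.log k - (Real.log l + 1) * k) + l := by
    ext k; rw [poissonDiv_eq hl]; ring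
  have g1 : ExpGrowth fun k : ℕ => (Real.log l + 1) * (k : ℝ) := ExpGrowth.natCast.const_mul _
  rw [e, poissonExp_add (expGrowth_mul_log.sub g1) (ExpGrowth.const l),
    poissonExp_sub expGrowth_mul_log g1, poissonExp_const_mul, poissonExp_natCast, poissonExp_const]
  ring

/-- `E[1 / (Y + 1)] ≤ 1 / l`. -/
theorem poissonExp_inv_succ_le {l : ℝ} (hl : 0 < l) :
    poissonExp l (fun k => 1 / ((k : ℝ) + 1)) ≤ 1 / l := by
  have hg : ExpGrowth fun k : ℕ => 1 / (k : ℝ) := (ExpGrowth.const 1).mono fun k => by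
    rw [abs_one, abs_of_nonneg (by positivity)]
    rcases Nat.eq_zero_or_pos k with rfl | hk
    · simp
    · rw [div_le_one (by positivity)]; exact_mod_cast hk
  have h := poissonExp_natCast_mul hg l
  push_cast at h
  rw [le_div_iff₀ hl, mul_comm, ← h]
  refine le_trans ?_ (poissonExp_one l).le
  refine poissonExp_mono (ExpGrowth.natCast.mul hg) (ExpGrowth.const 1) hl.le fun k => ?_
  rw [mul_one_div]
  exact div_self_le_one _

/-- The mean `μ(l)` of the I-divergence satisfies `μ'' ≤ 1 / l`, so that `μ(l) - l log l` is
concave. -/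
theorem concaveOn_mean_sub : ConcaveOn ℝ (Set.Ioi 0)
    fun l => poissonExp l (fun k => k * Real.log k) - 2 * (l * Real.log l) := by
  set f : ℕ → ℝ := fun k => k * Real.log k with hf
  have hfg : ExpGrowth f := expGrowth_mul_log
  have hd1 := hasDerivAt_poissonExp hfg
  have hd2 := hasDerivAt_poissonExp (hfg.succ.sub hfg)
  have hD : ∀ l ∈ Set.Ioi (0 : ℝ), HasDerivAt (fun l => poissonExp l f - 2 * (l * Real.log l))
      (poissonExp l (fun k => f (k + 1) - f k) - 2 * (Real.log l + 1)) l := fun l hl =>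
    (hd1 l).sub ((Real.hasDerivAt_mul_log (ne_of_gt hl)).const_mul 2)
  have hD2 : ∀ l ∈ Set.Ioi (0 : ℝ), HasDerivAt
      (fun l => poissonExp l (fun k => f (k + 1) - f k) - 2 * (Real.log l + 1))
      (poissonExp l (fun k => (f (k + 1 + 1) - f (k + 1)) - (f (k + 1) - f k)) - 2 * l⁻¹) l :=
    fun l hl => (hd2 l).sub (((Real.hasDerivAt_log (ne_of_gt hl)).add_const 1).const_mul 2)
  refine AntitoneOn.concaveOn_of_deriv (convex_Ioi 0)
    (fun l hl => (hD l hl).continuousAt.continuousWithinAt) ?_ ?_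
  · rw [interior_Ioi]
    exact fun l hl => (hD l hl).differentiableAt.differentiableWithinAt
  · rw [interior_Ioi]
    have hA : AntitoneOn (fun l => poissonExp l (fun k => f (k + 1) - f k)
        - 2 * (Real.log l + 1)) (Set.Ioi 0) := by
      refine antitoneOn_of_deriv_nonpos (convex_Ioi 0)
        (fun l hl => (hD2 l hl).continuousAt.continuousWithinAt) ?_ fun l hl => ?_
      · rw [interior_Ioi]
        exact fun l hl => (hD2 l hl).differentiableAt.differentiableWithinAt
      · rw [interior_Ioi] at hl
        rw [(hD2 l hl).deriv]
        have hinv : ExpGrowth fun k : ℕ => 1 / ((k : ℝ) + 1) :=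
          (ExpGrowth.const 1).mono fun k => by
            rw [abs_one, abs_of_nonneg (by positivity), div_le_one (by positivity)]
            linarith [(Nat.cast_nonneg k : (0 : ℝ) ≤ k)]
        have h1 : poissonExp l (fun k => (f (k + 1 + 1) - f (k + 1)) - (f (k + 1) - f k))
            ≤ poissonExp l (fun k => 2 * (1 / ((k : ℝ) + 1))) := by
          refine poissonExp_mono ((hfg.succ.succ.sub hfg.succ).sub (hfg.succ.sub hfg))
            (hinv.const_mul 2) (le_of_lt hl) fun k => ?_
          have := (diff2_mul_log_mem k).2
          rw [mul_one_div]
          simp only [hf]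
          rw [show k + 1 + 1 = k + 2 by ring]
          linarith
        rw [poissonExp_const_mul] at h1
        have h2 := poissonExp_inv_succ_le (l := l) hl
        rw [one_div] at h2
        linarith
    intro x hx y hy hxy
    rw [(hD x hx).deriv, (hD y hy).deriv]
    exact hA hx hy hxy

theorem mean_ge_on_cell {a b g : ℝ} (ha0 : 0 < a) (hab : a ≤ b)
    (ha : g ≤ poissonExp a (poissonDiv a)) (hb : g ≤ poissonExp b (poissonDiv b)) {x : ℝ}
    (hx : x ∈ Set.Icc a b) : g - (b - a) ^ 2 / (4 * a) ≤ poissonExp x (poissonDiv x) := by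
  have hb0 : 0 < b := ha0.trans_le hab
  have hx0 : 0 < x := ha0.trans_le hx.1
  obtain ⟨s, t, hs, ht, hst, hxe⟩ : ∃ s t : ℝ, 0 ≤ s ∧ 0 ≤ t ∧ s + t = 1 ∧ s • a + t • b = x := by
    rwa [← segment_eq_Icc hab] at hx
  have h := concaveOn_mean_sub.2 (show a ∈ Set.Ioi 0 from ha0) (show b ∈ Set.Ioi 0 from hb0) hs ht hst
  rw [hxe] at h
  simp only [smul_eq_mul] at h hxe
  rw [poissonExp_poissonDiv ha0] at ha
  rw [poissonExp_poissonDiv hb0] at hb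
  rw [poissonExp_poissonDiv hx0]
  -- `x log x` deviates from its chord by at most `s t (b - a) ^ 2 / x`
  have la : a * (Real.log a - Real.log x) ≤ a * (a / x - 1) := by
    rw [← Real.log_div ha0.ne' hx0.ne']
    exact mul_le_mul_of_nonneg_left (Real.log_le_sub_one_of_pos (by positivity)) ha0.le
  have lb : b * (Real.log b - Real.log x) ≤ b * (b / x - 1) := by
    rw [← Real.log_div hb0.ne' hx0.ne']
    exact mul_le_mul_of_nonneg_left (Real.log_le_sub_one_of_pos (by positivity)) hb0.le
  have l1 := mul_le_mul_of_nonneg_left la hs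
  have l2 := mul_le_mul_of_nonneg_left lb ht
  have l3 : s * (a * (a / x - 1)) + t * (b * (b / x - 1)) ≤ (b - a) ^ 2 / (4 * a) := by
    have e : s * (a * (a / x - 1)) + t * (b * (b / x - 1)) = s * t * (b - a) ^ 2 / x := by
      have : s = 1 - t := by linarith
      field_simp
      rw [← hxe, this]; ring
    rw [e]
    have : s * t * (b - a) ^ 2 ≤ (b - a) ^ 2 / 4 := by
      have : s = 1 - t := by linarith
      subst this
      nlinarith [mul_nonneg (sq_nonneg (b - a)) (sq_nonneg (1 - 2 * t))]
    calc _ ≤ (b - a) ^ 2 / 4 / a := div_le_div₀ (by positivity) this ha0 hx.1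
      _ = _ := by rw [div_div]
  have l4 : x * Real.log x = s * (a * Real.log x) + t * (b * Real.log x) := by
    rw [← hxe]; ring
  have m1 := mul_le_mul_of_nonneg_left ha hs
  have m2 := mul_le_mul_of_nonneg_left hb ht
  have m3 : g = s * g + t * g := by rw [← add_mul, hst, one_mul]
  linarith

/-- The bounds on the first two moments of `Z = I(Y ‖ l)` on which the theorem rests: `E Z ≤ C`,
`E (Z - C) ^ 2 ≤ v + 4.5 (C - E Z)` for `C = 0.5803` and `v = 0.51785` (here with the square
expanded), and `Var Z ≤ 0.608`. -/
structure MomentBounds (l : ℝ) : Prop where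
  mean_le : poissonExp l (poissonDiv l) ≤ 0.5803
  sq_le : poissonExp l (fun k => poissonDiv l k ^ 2) + 3.3394 * poissonExp l (poissonDiv l)
    ≤ 2.79245191
  var_le : poissonExp l (fun k => poissonDiv l k ^ 2) ≤ 0.608 + poissonExp l (poissonDiv l) ^ 2

theorem diag_poissonExp_le {a b : ℝ} (ha0 : 0 < a) (hab : a ≤ b) {F : ℝ → ℝ → ℝ} {w₁ w₂ : ℝ}
    (hw₁ : 0 ≤ w₁) (hw₂ : 0 ≤ w₂)
    (hF : ∀ x y, F x y = w₂ * poissonExp x (fun k => poissonDiv y k ^ 2)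
      + w₁ * poissonExp x (poissonDiv y)) {m X g : ℝ}
    (ha : F a a ≤ m) (hb : F b b ≤ m) (hX : F a b + F b a ≤ X) (hm : m ≤ g)
    (hg : X + 2 * m ≤ 4 * g) {x : ℝ} (hx : x ∈ Set.Icc a b) : F x x ≤ g := by
  have hsub : Set.Icc a b ⊆ Set.Ioi 0 := fun y hy => ha0.trans_le hy.1
  have hsub' : Set.Icc a b ⊆ Set.Ici 0 := fun y hy => (ha0.trans_le hy.1).le
  have hF' : F = fun x y => w₂ * poissonExp x (fun k => poissonDiv y k ^ 2)
      + w₁ * poissonExp x (poissonDiv y) := by ext x y; exact hF x y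
  refine diag_le_of_separately_convex hab (fun y hy => ?_) (fun z hz => ?_) ha hb hX hm hg hx
  · have hy0 : 0 < y := hsub hy
    rw [hF']
    exact (((convexOn_poissonExp ((expGrowth_poissonDiv hy0).pow 2)
      (diff2_poissonDiv_sq hy0)).subset hsub' (convex_Icc a b)).smul hw₂).add
      (((convexOn_poissonExp (expGrowth_poissonDiv hy0)
      (diff2_poissonDiv hy0)).subset hsub' (convex_Icc a b)).smul hw₁)
  · rw [hF']
    exact ((convexOn_poissonExp_param (hsub' hz) (convex_Icc a b)
      (fun n hn => (expGrowth_poissonDiv (hsub hn)).pow 2)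
      fun k => (convexOn_poissonDiv_sq_param k).subset hsub (convex_Icc a b)).smul hw₂).add
      ((convexOn_poissonExp_param (hsub' hz) (convex_Icc a b)
      (fun n hn => expGrowth_poissonDiv (hsub hn))
      fun k => (convexOn_poissonDiv_param k).subset hsub (convex_Icc a b)).smul hw₁)

theorem momentBounds_of_checkCell {a b c d : ℕ} (h : checkCell a b c d = true) :
    ∀ x ∈ Set.Icc ((a : ℝ) / b) (c / d), MomentBounds x := by
  set m := 20 + 5 * c / (2 * d) with hm
  simp only [checkCell, Bool.and_eq_true, Nat.ble_eq, ← hm] at h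
  obtain ⟨⟨⟨⟨⟨⟨⟨⟨⟨⟨⟨⟨hm1, ha⟩, hb⟩, hd⟩, hac⟩, hba⟩, hmax⟩, h1⟩, h2⟩, h3⟩, h4⟩, h5⟩, h6⟩ := h
  have hc : 0 < c := by
    rcases Nat.eq_zero_or_pos c with rfl | h
    · have := Nat.mul_pos ha hd; omega
    · exact h
  simp only [max_le_iff] at hmax
  obtain ⟨⟨ha', hb'⟩, hc', hd'⟩ := hmax
  intro x hx
  have hm20 : 20 ≤ m := Nat.le_add_right _ _
  have hcm : 5 * c ≤ 2 * (m + 1) * d := by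
    have := Nat.lt_div_mul_add (a := 5 * c) (b := 2 * d) (by positivity)
    have e : 2 * (m + 1) * d = 5 * c / (2 * d) * (2 * d) + 42 * d := by rw [hm]; ring
    rw [e]
    linarith [Nat.mul_le_mul_right 40 hd]
  have ham : 5 * a ≤ 2 * (m + 1) * b := by
    have : 5 * a * d ≤ 2 * (m + 1) * b * d :=
      calc 5 * a * d = 5 * (a * d) := by ring
        _ ≤ 5 * (c * b) := by gcongr
        _ = 5 * c * b := by ring
        _ ≤ 2 * (m + 1) * d * b := by gcongr
        _ = _ := by ring
    exact Nat.le_of_mul_le_mul_right this hd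
  have hdc : d ≤ 8 * c := by
    have : b * d ≤ b * (8 * c) :=
      calc b * d ≤ 8 * a * d := by gcongr
        _ = 8 * (a * d) := by ring
        _ ≤ 8 * (c * b) := by gcongr
        _ = _ := by ring
    exact Nat.le_of_mul_le_mul_left this hb
  have ha0 : (0 : ℝ) < a / b := by positivity
  have hb0 : (0 : ℝ) < c / d := by positivity
  have hab : (a : ℝ) / b ≤ c / d := by
    rw [div_le_div_iff₀ (by positivity) (by positivity)]; exact_mod_cast hac
  have u1 := le_meanUp hm20 hm1 ha hb ha hb ham ham hba ha' hb'
  have u2 := le_meanUp hm20 hm1 hc hd hc hd hcm hcm hdc hc' hd'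
  have u3 := le_meanUp hm20 hm1 ha hb hc hd ham hcm hdc hc' hd'
  have u4 := le_meanUp hm20 hm1 hc hd ha hb hcm ham hba ha' hb'
  have v1 := le_sqMeanUp hm20 hm1 ha hb ha hb ham ham hba ha' hb'
  have v2 := le_sqMeanUp hm20 hm1 hc hd hc hd hcm hcm hdc hc' hd'
  have v3 := le_sqMeanUp hm20 hm1 ha hb hc hd ham hcm hdc hc' hd'
  have v4 := le_sqMeanUp hm20 hm1 hc hd ha hb hcm ham hba ha' hb'
  have l1 := meanDown_le hm20 hm1 ha hb ha hb ham ha' hb'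
  have l2 := meanDown_le hm20 hm1 hc hd hc hd hcm hc' hd'
  have w1 : 10 ^ 14 * (((c : ℝ) / d - a / b) ^ 2 / (4 * (a / b)))
      ≤ ((10 ^ 14 * (c * b - a * d) ^ 2 / (4 * a * b * d ^ 2) + 1 : ℕ) : ℝ) := by
    have h := (natDiv_le_and_le (10 ^ 14 * (c * b - a * d) ^ 2) (4 * a * b * d ^ 2)).2
    rw [Nat.cast_add, Nat.cast_one]
    refine le_trans (le_of_eq ?_) h
    rw [Nat.cast_mul, Nat.cast_pow (c * b - a * d), Nat.cast_sub hac]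
    push_cast
    field_simp
    ring
  generalize hA : meanUp m a b a b = A at *
  generalize hB : meanUp m c d c d = B at *
  generalize hX : meanUp m a b c d = X at *
  generalize hY : meanUp m c d a b = Y at *
  generalize hA2 : sqMeanUp m a b a b = A2 at *
  generalize hB2 : sqMeanUp m c d c d = B2 at *
  generalize hX2 : sqMeanUp m a b c d = X2 at *
  generalize hY2 : sqMeanUp m c d a b = Y2 at *
  generalize hl1 : meanDown m a b a b = L1 at *
  generalize hl2 : meanDown m c d c d = L2 at *
  generalize hW : 10 ^ 14 * (c * b - a * d) ^ 2 / (4 * a * b * d ^ 2) + 1 = W at *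
  have hmean : poissonExp x (poissonDiv x) ≤ 0.5803 := by
    refine diag_poissonExp_le (F := fun x y => poissonExp x (poissonDiv y)) ha0 hab
      zero_le_one le_rfl (fun _ _ => by ring) (m := (max A B : ℕ) / 10 ^ 14)
      (X := (X + Y : ℕ) / 10 ^ 14) ?_ ?_ ?_ ?_ ?_ hx
    · rw [le_div_iff₀ (by positivity), mul_comm]
      exact u1.trans (by exact_mod_cast le_max_left _ _)
    · rw [le_div_iff₀ (by positivity), mul_comm]
      exact u2.trans (by exact_mod_cast le_max_right _ _)
    · rw [le_div_iff₀ (by positivity), mul_comm]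
      push_cast; linarith
    · have : ((max A B : ℕ) : ℝ) ≤ 58030000000000 := by exact_mod_cast h1
      rw [div_le_iff₀ (by positivity)]; linarith
    · have : ((X + Y : ℕ) : ℝ) + 2 * (max A B : ℕ) ≤ 4 * 58030000000000 := by exact_mod_cast h2
      linarith
  refine ⟨hmean, ?_, ?_⟩
  · set R := max (10000 * A2 + 33394 * A) (10000 * B2 + 33394 * B)
    have hR1 : (10000 * A2 + 33394 * A : ℝ) ≤ R := by
      exact_mod_cast le_max_left (10000 * A2 + 33394 * A) (10000 * B2 + 33394 * B)
    have hR2 : (10000 * B2 + 33394 * B : ℝ) ≤ R := by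
      exact_mod_cast le_max_right (10000 * A2 + 33394 * A) (10000 * B2 + 33394 * B)
    have h5' : (R : ℝ) ≤ 2792451910000000000 := by exact_mod_cast h5
    have h6' : (10000 * (X2 + Y2) + 33394 * (X + Y) + 2 * R : ℝ) ≤ 4 * 2792451910000000000 := by
      exact_mod_cast h6
    refine diag_poissonExp_le (F := fun x y => poissonExp x (fun k => poissonDiv y k ^ 2)
      + 3.3394 * poissonExp x (poissonDiv y)) ha0 hab
      (w₁ := 3.3394) (w₂ := 1) (by norm_num) zero_le_one (fun _ _ => by ring) (m := R / 10 ^ 18)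
      (X := (10000 * (X2 + Y2) + 33394 * (X + Y)) / 10 ^ 18) ?_ ?_ ?_ ?_ ?_ hx
    all_goals linarith
  · set q := max A2 B2
    set l := min L1 L2 - W
    have hq1 : (A2 : ℝ) ≤ q := by exact_mod_cast le_max_left A2 B2
    have hq2 : (B2 : ℝ) ≤ q := by exact_mod_cast le_max_right A2 B2
    have hl : (l : ℝ) ≤ 10 ^ 14 * poissonExp x (poissonDiv x) := by
      rcases le_total (min L1 L2) W with h | h
      · have hx0 : 0 < x := ha0.trans_le hx.1
        have := poissonExp_nonneg hx0.le (poissonDiv_nonneg hx0)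
        have e : l = 0 := Nat.sub_eq_zero_of_le h
        rw [e, Nat.cast_zero]; positivity
      · have h1 : ((min L1 L2 : ℕ) : ℝ) ≤ L1 := by exact_mod_cast min_le_left L1 L2
        have h2 : ((min L1 L2 : ℕ) : ℝ) ≤ L2 := by exact_mod_cast min_le_right L1 L2
        have h3 := mean_ge_on_cell ha0 hab (g := (min L1 L2 : ℕ) / 10 ^ 14)
          (by linarith) (by linarith) hx
        rw [Nat.cast_sub h]
        linarith
    have hv := (natDiv_le_and_le (l ^ 2) (10 ^ 14)).1
    have hl2 := pow_le_pow_left₀ (Nat.cast_nonneg l) hl 2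
    generalize hz : l ^ 2 / 10 ^ 14 = z at *
    have hz' : (z : ℝ) ≤ 10 ^ 14 * poissonExp x (poissonDiv x) ^ 2 := by
      rw [Nat.cast_pow, Nat.cast_pow] at hv
      push_cast at hv
      rw [le_div_iff₀ (by positivity)] at hv
      linarith
    have h3' : (q : ℝ) ≤ 60800000000000 + z := by exact_mod_cast h3
    have h4' : (X2 + Y2 + 2 * q : ℝ) ≤ 4 * (60800000000000 + z) := by exact_mod_cast h4
    refine diag_poissonExp_le (F := fun x y => poissonExp x (fun k => poissonDiv y k ^ 2))
      ha0 hab (w₁ := 0) (w₂ := 1) le_rfl zero_le_one (fun _ _ => by ring) (m := q / 10 ^ 14)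
      (X := (X2 + Y2) / 10 ^ 14) ?_ ?_ ?_ ?_ ?_ hx
    all_goals linarith

theorem momentBounds_of_checkGrid {L : List (ℕ × ℕ)} {p q : ℕ × ℕ}
    (h : checkGrid (p :: L) = true) (hq : (p :: L).getLast (List.cons_ne_nil p L) = q)
    (hL : L ≠ []) {x : ℝ} (hx : x ∈ Set.Icc ((p.1 : ℝ) / p.2) (q.1 / q.2)) : MomentBounds x := by
  induction L generalizing p with
  | nil => exact absurd rfl hL
  | cons r rs ih =>
    rw [checkGrid, Bool.and_eq_true] at h
    have hc := momentBounds_of_checkCell h.1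
    rcases le_total x ((r.1 : ℝ) / r.2) with hxr | hxr
    · exact hc x ⟨hx.1, hxr⟩
    · rcases eq_or_ne rs [] with rfl | hrs
      · have e : r = q := by simpa using hq
        rw [← e] at hx
        exact hc x ⟨hx.1, hx.2⟩
      · refine ih h.2 ?_ hrs ⟨hxr, hx.2⟩
        rwa [List.getLast_cons (List.cons_ne_nil r rs)] at hq

theorem momentBounds_of_mem_Icc {x : ℝ} (h1 : 1 / 8 ≤ x) (h2 : x ≤ 45) : MomentBounds x :=
  momentBounds_of_checkGrid (p := (1, 8)) (q := (45, 1)) checkGrid_grid (by decide) (by simp)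
    ⟨by simpa using h1, by simpa using h2⟩

/-! ### Moments of the I-divergence for small and for large means -/

theorem expGrowth_sub_pow (a : ℝ) (j : ℕ) : ExpGrowth fun k : ℕ => ((k : ℝ) - a) ^ j :=
  (ExpGrowth.natCast.sub (ExpGrowth.const a)).pow j

theorem expGrowth_sum {ι : Type*} (s : Finset ι) {f : ι → ℕ → ℝ} (hf : ∀ i ∈ s, ExpGrowth (f i)) :
    ExpGrowth fun k => ∑ i ∈ s, f i k := by
  classical
  induction s using Finset.induction_on with
  | empty => simpa using ExpGrowth.const 0
  | insert i s hi ih =>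
    simp only [Finset.sum_insert hi]
    exact (hf i (Finset.mem_insert_self i s)).add (ih fun j hj => hf j (Finset.mem_insert_of_mem hj))

theorem poissonExp_sum {ι : Type*} (s : Finset ι) {f : ι → ℕ → ℝ} (hf : ∀ i ∈ s, ExpGrowth (f i))
    (l : ℝ) : poissonExp l (fun k => ∑ i ∈ s, f i k) = ∑ i ∈ s, poissonExp l (f i) := by
  classical
  induction s using Finset.induction_on with
  | empty => simpa using poissonExp_const 0 l
  | insert i s hi ih =>
    simp only [Finset.sum_insert hi]
    have h := fun j hj => hf j (Finset.mem_insert_of_mem hj)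
    rw [poissonExp_add (hf i (Finset.mem_insert_self i s)) (expGrowth_sum s h), ih h]

/-- The recursion for the moments of a Poisson variable about the point `a`. -/
theorem poissonExp_sub_pow_succ (l a : ℝ) (j : ℕ) :
    poissonExp l (fun k => ((k : ℝ) - a) ^ (j + 1))
      = l * ∑ i ∈ Finset.range (j + 1), (j.choose i : ℝ) * poissonExp l (fun k => ((k : ℝ) - a) ^ i)
        - a * poissonExp l (fun k => ((k : ℝ) - a) ^ j) := by
  have hj := expGrowth_sub_pow a j
  have e : (fun k : ℕ => ((k : ℝ) - a) ^ (j + 1))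
      = fun k : ℕ => k * ((k : ℝ) - a) ^ j - a * ((k : ℝ) - a) ^ j := by ext k; ring
  rw [e, poissonExp_sub (ExpGrowth.natCast.mul hj) (hj.const_mul a), poissonExp_const_mul,
    poissonExp_natCast_mul hj]
  congr 2
  simp only [← poissonExp_const_mul]
  rw [← poissonExp_sum _ fun i _ => (expGrowth_sub_pow a i).const_mul _]
  congr 1
  ext k
  rw [show ((k + 1 : ℕ) : ℝ) - a = (k - a) + 1 by push_cast; ring, add_pow]
  exact Finset.sum_congr rfl fun i _ => by rw [one_pow]; ring

theorem poissonExp_sub_pow_zero (l a : ℝ) : poissonExp l (fun k => ((k : ℝ) - a) ^ 0) = 1 := by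
  simp only [pow_zero, poissonExp_one]

theorem poissonExp_raw (l : ℝ) :
    poissonExp l (fun k => ((k : ℝ) - 0) ^ 2) = l ^ 2 + l ∧
    poissonExp l (fun k => ((k : ℝ) - 0) ^ 3) = l ^ 3 + 3 * l ^ 2 + l ∧
    poissonExp l (fun k => ((k : ℝ) - 0) ^ 4) = l ^ 4 + 6 * l ^ 3 + 7 * l ^ 2 + l := by
  have h1 := poissonExp_sub_pow_succ l 0 0
  have h2 := poissonExp_sub_pow_succ l 0 1
  have h3 := poissonExp_sub_pow_succ l 0 2
  have h4 := poissonExp_sub_pow_succ l 0 3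
  simp only [Finset.sum_range_succ, Finset.sum_range_zero, Nat.choose, poissonExp_sub_pow_zero]
    at h1 h2 h3 h4
  norm_num only at h1 h2 h3 h4
  rw [h1] at h2
  rw [h1, h2] at h3
  rw [h1, h2, h3] at h4
  exact ⟨by rw [h2]; ring, by rw [h3]; ring, by rw [h4]; ring⟩

theorem poissonExp_central (l : ℝ) :
    poissonExp l (fun k => ((k : ℝ) - l) ^ 2) = l ∧
    poissonExp l (fun k => ((k : ℝ) - l) ^ 3) = l ∧
    poissonExp l (fun k => ((k : ℝ) - l) ^ 4) = 3 * l ^ 2 + l ∧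
    poissonExp l (fun k => ((k : ℝ) - l) ^ 5) = 10 * l ^ 2 + l ∧
    poissonExp l (fun k => ((k : ℝ) - l) ^ 6) = 15 * l ^ 3 + 25 * l ^ 2 + l ∧
    poissonExp l (fun k => ((k : ℝ) - l) ^ 7) = 105 * l ^ 3 + 56 * l ^ 2 + l ∧
    poissonExp l (fun k => ((k : ℝ) - l) ^ 8) = 105 * l ^ 4 + 490 * l ^ 3 + 119 * l ^ 2 + l := by
  have h1 := poissonExp_sub_pow_succ l l 0
  have h2 := poissonExp_sub_pow_succ l l 1
  have h3 := poissonExp_sub_pow_succ l l 2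
  have h4 := poissonExp_sub_pow_succ l l 3
  have h5 := poissonExp_sub_pow_succ l l 4
  have h6 := poissonExp_sub_pow_succ l l 5
  have h7 := poissonExp_sub_pow_succ l l 6
  have h8 := poissonExp_sub_pow_succ l l 7
  simp only [Finset.sum_range_succ, Finset.sum_range_zero, Nat.choose, poissonExp_sub_pow_zero]
    at h1 h2 h3 h4 h5 h6 h7 h8
  norm_num only at h1 h2 h3 h4 h5 h6 h7 h8
  have e1 : poissonExp l (fun k => ((k : ℝ) - l) ^ 1) = 0 := by rw [h1]; ring
  rw [e1] at h2 h3 h4 h5 h6 h7 h8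
  have e2 : poissonExp l (fun k => ((k : ℝ) - l) ^ 2) = l := by rw [h2]; ring
  rw [e2] at h3 h4 h5 h6 h7 h8
  have e3 : poissonExp l (fun k => ((k : ℝ) - l) ^ 3) = l := by rw [h3]; ring
  rw [e3] at h4 h5 h6 h7 h8
  have e4 : poissonExp l (fun k => ((k : ℝ) - l) ^ 4) = 3 * l ^ 2 + l := by rw [h4]; ring
  rw [e4] at h5 h6 h7 h8
  have e5 : poissonExp l (fun k => ((k : ℝ) - l) ^ 5) = 10 * l ^ 2 + l := by rw [h5]; ring
  rw [e5] at h6 h7 h8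
  have e6 : poissonExp l (fun k => ((k : ℝ) - l) ^ 6) = 15 * l ^ 3 + 25 * l ^ 2 + l := by
    rw [h6]; ring
  rw [e6] at h7 h8
  have e7 : poissonExp l (fun k => ((k : ℝ) - l) ^ 7) = 105 * l ^ 3 + 56 * l ^ 2 + l := by
    rw [h7]; ring
  rw [e7] at h8
  exact ⟨e2, e3, e4, e5, e6, e7, by rw [h8]; ring⟩

theorem momentBounds_of_le {l : ℝ} (hl : 0 < l) (hl' : l ≤ 1 / 8) : MomentBounds l := by
  set s := √l with hs
  have hs0 : 0 < s := Real.sqrt_pos.2 hl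
  have hsl : l = s ^ 2 := (Real.sq_sqrt hl.le).symm
  have hs1 : s ≤ 0.354 := by rw [hs, Real.sqrt_le_left (by norm_num)]; linarith
  set L := -Real.log l - 1 + l with hL
  -- the tangent of the logarithm at `4 s = 1`
  have hlog : s * -Real.log l ≤ 1 / 2 + 0.7726 * s := by
    have h1 := Real.log_le_sub_one_of_pos (show 0 < 1 / (4 * s) by positivity)
    have h2 : Real.log (1 / (4 * s)) = -(2 * Real.log 2) - Real.log s := by
      rw [one_div, Real.log_inv, Real.log_mul (by norm_num) hs0.ne',
        show (4 : ℝ) = 2 ^ 2 by norm_num, Real.log_pow]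
      push_cast; ring
    have h3 : Real.log l = 2 * Real.log s := by rw [hsl, Real.log_pow]; norm_num
    have h4 : s * (1 / (4 * s)) = 1 / 4 := by field_simp
    have h5 : -Real.log s ≤ 1 / (4 * s) + 0.3863 := by linarith [Real.log_two_lt_d9]
    have := mul_le_mul_of_nonneg_left h5 hs0.le
    rw [h3]; linarith
  have hsL : s * L ≤ 1 / 2 := by
    have : s * L = s * -Real.log l - s + s * s ^ 2 := by rw [hL, hsl]; ring
    nlinarith
  have hL0 : 0 ≤ L := by
    have := Real.log_le_sub_one_of_pos (show 0 < 8 * l by positivity)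
    have h8 : Real.log (8 * l) = 3 * Real.log 2 + Real.log l := by
      rw [Real.log_mul (by norm_num) hl.ne', show (8 : ℝ) = 2 ^ 3 by norm_num, Real.log_pow]
      norm_num
    linarith [Real.log_two_gt_d9]
  have hlL : l * L ≤ 0.177 := by rw [hsl]; nlinarith
  have hlL2 : l * L ^ 2 ≤ 1 / 4 := by
    rw [hsl, ← mul_pow]
    nlinarith [mul_nonneg hs0.le hL0]
  have hmean : poissonExp l (poissonDiv l) ≤ 0.3 := by
    rw [poissonExp_poissonDiv hl, poissonExp_natCast_mul ExpGrowth.log]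
    have h1 : poissonExp l (fun k => Real.log (k + 1 : ℕ)) ≤ l := by
      refine (poissonExp_mono ExpGrowth.log.succ ExpGrowth.natCast hl.le fun k => ?_).trans_eq
        (poissonExp_natCast l)
      refine (Real.log_le_sub_one_of_pos (by positivity)).trans_eq ?_
      push_cast; ring
    have h2 := mul_le_mul_of_nonneg_left h1 hl.le
    have h3 : l * -Real.log l ≤ 0.28 := by
      have : l * -Real.log l = s * (s * -Real.log l) := by rw [← mul_assoc, ← sq, ← hsl]
      rw [this]
      nlinarith
    nlinarith
  have hsq : poissonExp l (fun k => poissonDiv l k ^ 2) ≤ 0.5 := by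
    obtain ⟨m2, m3, m4⟩ := poissonExp_raw l
    have g := expGrowth_sub_pow 0
    have g4 := g 4
    have g3 := (g 3).const_mul (2 * L - 2)
    have g2 := (g 2).const_mul (1 - 2 * L + L ^ 2)
    have hle : poissonExp l (fun k => poissonDiv l k ^ 2)
        ≤ poissonExp l (fun k : ℕ => ((k : ℝ) - 0) ^ 4 + (2 * L - 2) * ((k : ℝ) - 0) ^ 3
          + (1 - 2 * L + L ^ 2) * ((k : ℝ) - 0) ^ 2 + l ^ 2) := by
      refine poissonExp_mono ((expGrowth_poissonDiv hl).pow 2)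
        (((g4.add g3).add g2).add (ExpGrowth.const _)) hl.le fun k => ?_
      have e : ((k : ℝ) - 0) ^ 4 + (2 * L - 2) * ((k : ℝ) - 0) ^ 3
          + (1 - 2 * L + L ^ 2) * ((k : ℝ) - 0) ^ 2 + l ^ 2
          = (k * (k - 1 + L)) ^ 2 + l ^ 2 := by ring
      rw [e]
      rcases Nat.eq_zero_or_pos k with rfl | hk
      · rw [poissonDiv_zero]; simp
      · have hk1 : (1 : ℝ) ≤ k := by exact_mod_cast hk
        have h1 := Real.log_le_sub_one_of_pos (show (0 : ℝ) < k by linarith)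
        have h2 : poissonDiv l k ≤ k * (k - 1 + L) := by
          rw [poissonDiv_eq hl, hL]
          nlinarith [mul_le_mul_of_nonneg_left h1 (by linarith : (0 : ℝ) ≤ k)]
        have := pow_le_pow_left₀ (poissonDiv_nonneg hl k) h2 2
        linarith [sq_nonneg l]
    rw [poissonExp_add ((g4.add g3).add g2) (ExpGrowth.const _), poissonExp_add (g4.add g3) g2,
      poissonExp_add g4 g3, poissonExp_const_mul, poissonExp_const_mul, poissonExp_const,
      m2, m3, m4] at hle
    refine hle.trans ?_
    have e : l ^ 4 + 6 * l ^ 3 + 7 * l ^ 2 + l + (2 * L - 2) * (l ^ 3 + 3 * l ^ 2 + l)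
        + (1 - 2 * L + L ^ 2) * (l ^ 2 + l) + l ^ 2
        = l ^ 4 + 4 * l ^ 3 + 3 * l ^ 2 + 2 * (l * L) * (l ^ 2 + 2 * l) + l * L ^ 2 * (1 + l) := by
      ring
    rw [e]
    have p2 : l ^ 2 ≤ 1 / 64 := by nlinarith
    have p3 : l ^ 3 ≤ 1 / 512 := by nlinarith
    have p4 : l ^ 4 ≤ 1 / 4096 := by nlinarith [sq_nonneg l]
    have q1 : 2 * (l * L) * (l ^ 2 + 2 * l) ≤ 2 * 0.177 * (1 / 64 + 2 * (1 / 8)) := by gcongr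
    have q2 : l * L ^ 2 * (1 + l) ≤ 1 / 4 * (1 + 1 / 8) := by gcongr
    linarith
  exact ⟨by linarith, by linarith, by linarith [sq_nonneg (poissonExp l (poissonDiv l))]⟩

/-- The mean value theorem on `(-1, ∞)` with base point `0`; the intermediate point `c` lies on the
same side of `0` as `u`. -/
theorem exists_eq_deriv_mul {f f' : ℝ → ℝ} (hf : ∀ u, -1 < u → HasDerivAt f (f' u) u)
    (h0 : f 0 = 0) {u : ℝ} (hu : -1 < u) : ∃ c, -1 < c ∧ 0 ≤ c * u ∧ f u = f' c * u := by
  rcases lt_trichotomy u 0 with h | rfl | h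
  · obtain ⟨c, hc, he⟩ := exists_hasDerivAt_eq_slope f f' h
      (fun x hx => (hf x (hu.trans_le hx.1)).continuousAt.continuousWithinAt)
      (fun x hx => hf x (hu.trans hx.1))
    refine ⟨c, hu.trans hc.1, (mul_pos_of_neg_of_neg hc.2 h).le, ?_⟩
    rw [he, h0]; field_simp; ring
  · exact ⟨0, hu, by simp, by simp [h0]⟩
  · obtain ⟨c, hc, he⟩ := exists_hasDerivAt_eq_slope f f' h
      (fun x hx => (hf x (by linarith [hx.1])).continuousAt.continuousWithinAt)
      (fun x hx => hf x (by linarith [hx.1]))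
    refine ⟨c, by linarith [hc.1], (mul_pos hc.1 h).le, ?_⟩
    rw [he, h0]; field_simp; ring

theorem hasDerivAt_log_one_add {u : ℝ} (hu : -1 < u) :
    HasDerivAt (fun u : ℝ => Real.log (1 + u)) (1 / (1 + u)) u :=
  ((hasDerivAt_id u).const_add 1).log (by simp; linarith)

theorem log_one_add_le_cubic {u : ℝ} (hu : -1 < u) :
    Real.log (1 + u) ≤ u - u ^ 2 / 2 + u ^ 3 / 3 := by
  obtain ⟨c, hc, hcu, he⟩ := exists_eq_deriv_mul
    (f := fun u => u - u ^ 2 / 2 + u ^ 3 / 3 - Real.log (1 + u)) (f' := fun u => u ^ 3 / (1 + u))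
    (fun u hu => by
      refine HasDerivAt.congr_deriv (((((hasDerivAt_id u).sub ((hasDerivAt_pow 2 u).div_const 2))).add
        ((hasDerivAt_pow 3 u).div_const 3)).sub (hasDerivAt_log_one_add hu)) ?_
      have : 1 + u ≠ 0 := by linarith
      push_cast
      field_simp
      ring) (by simp) hu
  have h1 : 0 < 1 + c := by linarith
  have h2 : c ^ 3 / (1 + c) * u = c ^ 2 * (c * u) / (1 + c) := by ring
  have : 0 ≤ c ^ 2 * (c * u) / (1 + c) := by positivity
  linarith

theorem mul_log_one_add_ge {u : ℝ} (hu : -1 < u) :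
    u ^ 2 / 2 - u ^ 3 / 6 ≤ (1 + u) * Real.log (1 + u) - u := by
  obtain ⟨c, hc, hcu, he⟩ := exists_eq_deriv_mul
    (f := fun u => (1 + u) * Real.log (1 + u) - u - u ^ 2 / 2 + u ^ 3 / 6)
    (f' := fun u => Real.log (1 + u) - u + u ^ 2 / 2)
    (fun u hu => by
      refine HasDerivAt.congr_deriv ((((((hasDerivAt_id u).const_add 1).mul
        (hasDerivAt_log_one_add hu)).sub (hasDerivAt_id u)).sub
        ((hasDerivAt_pow 2 u).div_const 2)).add ((hasDerivAt_pow 3 u).div_const 6)) ?_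
      have : 1 + u ≠ 0 := by linarith
      push_cast
      simp only [id]
      field_simp
      ring) (by simp) hu
  obtain ⟨e, he', heu, hee⟩ := exists_eq_deriv_mul
    (f := fun u => Real.log (1 + u) - u + u ^ 2 / 2) (f' := fun u => u ^ 2 / (1 + u))
    (fun u hu => by
      refine HasDerivAt.congr_deriv (((hasDerivAt_log_one_add hu).sub (hasDerivAt_id u)).add
        ((hasDerivAt_pow 2 u).div_const 2)) ?_
      have : 1 + u ≠ 0 := by linarith
      push_cast
      field_simp
      ring) (by simp) hc
  have h1 : 0 < 1 + e := by linarith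
  rw [hee] at he
  have h2 : e ^ 2 / (1 + e) * c * u = e ^ 2 * (c * u) / (1 + e) := by ring
  have : 0 ≤ e ^ 2 * (c * u) / (1 + e) := by positivity
  linarith

theorem poissonDiv_le_quartic {l : ℝ} (hl : 0 < l) (k : ℕ) :
    poissonDiv l k ≤ ((k : ℝ) - l) ^ 2 / (2 * l) - ((k : ℝ) - l) ^ 3 / (6 * l ^ 2)
      + ((k : ℝ) - l) ^ 4 / (3 * l ^ 3) := by
  rcases Nat.eq_zero_or_pos k with rfl | hk
  · rw [poissonDiv_zero]
    refine le_of_eq ?_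
    push_cast; field_simp; ring
  · have hk0 : (0 : ℝ) < k := by exact_mod_cast hk
    have h := log_one_add_le_cubic (u := k / l - 1) (by linarith [div_pos hk0 hl])
    rw [add_sub_cancel] at h
    rw [poissonDiv]
    have := mul_le_mul_of_nonneg_left h hk0.le
    refine (sub_le_sub_right (add_le_add_left this l) (k : ℝ)).trans_eq ?_
    field_simp; ring

theorem cubic_le_poissonDiv {l : ℝ} (hl : 0 < l) (k : ℕ) :
    ((k : ℝ) - l) ^ 2 / (2 * l) - ((k : ℝ) - l) ^ 3 / (6 * l ^ 2) ≤ poissonDiv l k := by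
  rcases Nat.eq_zero_or_pos k with rfl | hk
  · rw [poissonDiv_zero]
    have : (((0 : ℕ) : ℝ) - l) ^ 2 / (2 * l) - (((0 : ℕ) : ℝ) - l) ^ 3 / (6 * l ^ 2) = 2 / 3 * l := by
      push_cast; field_simp; ring
    linarith
  · have hk0 : (0 : ℝ) < k := by exact_mod_cast hk
    have h := mul_log_one_add_ge (u := k / l - 1) (by linarith [div_pos hk0 hl])
    rw [add_sub_cancel] at h
    have := mul_le_mul_of_nonneg_left h hl.le
    rw [poissonDiv]
    have e1 : l * ((k : ℝ) / l * Real.log (k / l) - (k / l - 1)) = k * Real.log (k / l) + l - k := by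
      field_simp
      ring
    have e2 : l * (((k : ℝ) / l - 1) ^ 2 / 2 - ((k : ℝ) / l - 1) ^ 3 / 6)
        = ((k : ℝ) - l) ^ 2 / (2 * l) - ((k : ℝ) - l) ^ 3 / (6 * l ^ 2) := by
      field_simp
    rw [e1, e2] at this
    exact this

theorem momentBounds_of_ge {l : ℝ} (hl' : 45 ≤ l) : MomentBounds l := by
  have hl : 0 < l := by linarith
  obtain ⟨c2, c3, c4, c5, c6, c7, c8⟩ := poissonExp_central l
  have g := expGrowth_sub_pow l
  set r := 1 / l with hr
  have hr0 : 0 < r := by positivity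
  have hr1 : r ≤ 1 / 45 := one_div_le_one_div_of_le (by norm_num) hl'
  have hrl : r * l = 1 := by rw [hr]; field_simp
  have hle : ∀ k : ℕ, poissonDiv l k ≤ r / 2 * ((k : ℝ) - l) ^ 2 + -(r ^ 2 / 6) * ((k : ℝ) - l) ^ 3
      + r ^ 3 / 3 * ((k : ℝ) - l) ^ 4 := fun k => by
    refine (poissonDiv_le_quartic hl k).trans_eq ?_
    rw [hr]; field_simp
    ring
  have hge : ∀ k : ℕ, r / 2 * ((k : ℝ) - l) ^ 2 + -(r ^ 2 / 6) * ((k : ℝ) - l) ^ 3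
      ≤ poissonDiv l k := fun k => by
    refine le_trans (le_of_eq ?_) (cubic_le_poissonDiv hl k)
    rw [hr]; field_simp
    ring
  have hZ := expGrowth_poissonDiv hl
  have u1 : poissonExp l (poissonDiv l) ≤ 0.52 := by
    refine (poissonExp_mono hZ ((((g 2).const_mul _).add ((g 3).const_mul _)).add
      ((g 4).const_mul _)) hl.le hle).trans ?_
    rw [poissonExp_add (((g 2).const_mul _).add ((g 3).const_mul _)) ((g 4).const_mul _),
      poissonExp_add ((g 2).const_mul _) ((g 3).const_mul _), poissonExp_const_mul,
      poissonExp_const_mul, poissonExp_const_mul, c2, c3, c4]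
    have e : r / 2 * l + -(r ^ 2 / 6) * l + r ^ 3 / 3 * (3 * l ^ 2 + l)
        = (r * l) / 2 - r * (r * l) / 6 + r * (r * l) ^ 2 + r ^ 2 * (r * l) / 3 := by ring
    rw [e, hrl]
    nlinarith
  have u2 : 0.496 ≤ poissonExp l (poissonDiv l) := by
    refine le_trans ?_ (poissonExp_mono (((g 2).const_mul _).add ((g 3).const_mul _)) hZ hl.le hge)
    rw [poissonExp_add ((g 2).const_mul _) ((g 3).const_mul _), poissonExp_const_mul,
      poissonExp_const_mul, c2, c3]
    have e : r / 2 * l + -(r ^ 2 / 6) * l = (r * l) / 2 - r * (r * l) / 6 := by ring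
    rw [e, hrl]
    linarith
  have u3 : poissonExp l (fun k => poissonDiv l k ^ 2) ≤ 0.85 := by
    have hle2 : ∀ k : ℕ, poissonDiv l k ^ 2 ≤ r ^ 2 / 4 * ((k : ℝ) - l) ^ 4
        + -(r ^ 3 / 6) * ((k : ℝ) - l) ^ 5 + 13 / 36 * r ^ 4 * ((k : ℝ) - l) ^ 6
        + -(r ^ 5 / 9) * ((k : ℝ) - l) ^ 7 + r ^ 6 / 9 * ((k : ℝ) - l) ^ 8 := fun k =>
      (pow_le_pow_left₀ (poissonDiv_nonneg hl k) (hle k) 2).trans_eq (by ring)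
    have G4 := (g 4).const_mul (r ^ 2 / 4)
    have G5 := G4.add ((g 5).const_mul (-(r ^ 3 / 6)))
    have G6 := G5.add ((g 6).const_mul (13 / 36 * r ^ 4))
    have G7 := G6.add ((g 7).const_mul (-(r ^ 5 / 9)))
    refine (poissonExp_mono (hZ.pow 2) (G7.add ((g 8).const_mul (r ^ 6 / 9))) hl.le hle2).trans ?_
    rw [poissonExp_add G7 ((g 8).const_mul _), poissonExp_add G6 ((g 7).const_mul _),
      poissonExp_add G5 ((g 6).const_mul _), poissonExp_add G4 ((g 5).const_mul _),
      poissonExp_const_mul, poissonExp_const_mul, poissonExp_const_mul, poissonExp_const_mul,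
      poissonExp_const_mul, c4, c5, c6, c7, c8]
    have e : r ^ 2 / 4 * (3 * l ^ 2 + l) + -(r ^ 3 / 6) * (10 * l ^ 2 + l)
        + 13 / 36 * r ^ 4 * (15 * l ^ 3 + 25 * l ^ 2 + l)
        + -(r ^ 5 / 9) * (105 * l ^ 3 + 56 * l ^ 2 + l)
        + r ^ 6 / 9 * (105 * l ^ 4 + 490 * l ^ 3 + 119 * l ^ 2 + l)
        = 3 / 4 * (r * l) ^ 2 + r * (r * l) / 4 - 5 / 3 * r * (r * l) ^ 2 - r ^ 2 * (r * l) / 6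
        + 13 / 36 * (15 * r * (r * l) ^ 3 + 25 * r ^ 2 * (r * l) ^ 2 + r ^ 3 * (r * l))
        - (105 * r ^ 2 * (r * l) ^ 3 + 56 * r ^ 3 * (r * l) ^ 2 + r ^ 4 * (r * l)) / 9
        + (105 * r ^ 2 * (r * l) ^ 4 + 490 * r ^ 3 * (r * l) ^ 3 + 119 * r ^ 4 * (r * l) ^ 2
          + r ^ 5 * (r * l)) / 9 := by ring
    rw [e, hrl]
    have p2 : r ^ 2 ≤ r / 45 := by nlinarith
    have p3 : r ^ 3 ≤ r / 2025 := by nlinarith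
    have p4 : r ^ 4 ≤ r / 2025 := by nlinarith [pow_pos hr0 3]
    have p5 : r ^ 5 ≤ r / 2025 := by nlinarith [pow_pos hr0 4]
    nlinarith [pow_pos hr0 2, pow_pos hr0 3, pow_pos hr0 4]
  exact ⟨by linarith, by linarith, by nlinarith⟩

theorem momentBounds {l : ℝ} (hl : 0 < l) : MomentBounds l := by
  rcases le_total l (1 / 8) with h | h
  · exact momentBounds_of_le hl h
  rcases le_total l 45 with h' | h'
  · exact momentBounds_of_mem_Icc h h'
  · exact momentBounds_of_ge h'

/-! ### The third central moment of the I-divergence -/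

theorem integral_exp_neg_mul_pow (n : ℕ) :
    IntegrableOn (fun x : ℝ => Real.exp (-x) * x ^ n) (Set.Ioi 0) ∧
      ∫ x in Set.Ioi (0 : ℝ), Real.exp (-x) * x ^ n = n.factorial := by
  have h1 := Real.GammaIntegral_convergent (s := (n : ℝ) + 1) (by positivity)
  have h2 := Real.Gamma_eq_integral (s := (n : ℝ) + 1) (by positivity)
  simp only [add_sub_cancel_right, Real.rpow_natCast] at h1 h2
  exact ⟨h1, by rw [← h2, Real.Gamma_nat_eq_factorial]⟩

/-- Integration of the exponential tail bound: the part of `Z = I(Y ‖ l)` above `3.5`. -/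
theorem poissonExp_excess_le {l : ℝ} (hl : 0 < l) :
    poissonExp l (fun k => max (poissonDiv l k - 3.5) 0 * (max (poissonDiv l k - 3.5) 0 + 3.5) ^ 2)
      ≤ 1.46 * Real.exp (-3.5) * 32.25 := by
  set X : ℕ → ℝ := fun k => max (poissonDiv l k - 3.5) 0 with hX
  have hX0 : ∀ k, 0 ≤ X k := fun k => le_max_right _ _
  have hXg : ExpGrowth X := (expGrowth_poissonDiv hl).mono fun k => by
    rw [abs_of_nonneg (hX0 k), abs_of_nonneg (poissonDiv_nonneg hl k)]
    exact max_le (by linarith) (poissonDiv_nonneg hl k)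
  have hfg : ExpGrowth fun k => X k * (X k + 3.5) ^ 2 :=
    hXg.mul ((hXg.add (ExpGrowth.const _)).pow 2)
  set r : NNReal := ⟨l, hl.le⟩
  have hr : (r : ℝ) = l := rfl
  -- the derivative of `x * (x + 3.5) ^ 2`
  set g : ℝ → ℝ := fun t => 3 * t ^ 2 + 14 * t + 12.25 with hg
  have hgi : ∀ x, ∫ t in (0 : ℝ)..x, g t = x * (x + 3.5) ^ 2 := fun x => by
    have : ∀ t ∈ Set.uIcc 0 x, HasDerivAt (fun x : ℝ => x * (x + 3.5) ^ 2) (g t) t := fun t _ => by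
      refine ((hasDerivAt_id t).mul (((hasDerivAt_id t).add_const 3.5).pow 2)).congr_deriv ?_
      simp only [hg, id, Pi.pow_apply]; push_cast; ring
    rw [intervalIntegral.integral_eq_sub_of_hasDerivAt this
      ((by fun_prop : Continuous g).intervalIntegrable _ _)]
    ring
  have hcake := lintegral_comp_eq_lintegral_meas_le_mul (poissonMeasure r) (f := X) (g := g)
    (ae_of_all _ hX0) (measurable_from_top).aemeasurable
    (fun t _ => (by fun_prop : Continuous g).intervalIntegrable _ _)
    ((ae_restrict_iff' measurableSet_Ioi).2 (ae_of_all _ fun t (ht : 0 < t) => by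
      simp only [hg]; positivity))
  simp only [hgi] at hcake
  obtain ⟨i0, e0⟩ := integral_exp_neg_mul_pow 0
  obtain ⟨i1, e1⟩ := integral_exp_neg_mul_pow 1
  obtain ⟨i2, e2⟩ := integral_exp_neg_mul_pow 2
  set h : ℝ → ℝ := fun t => 1.46 * Real.exp (-3.5) * (3 * (Real.exp (-t) * t ^ 2)
    + 14 * (Real.exp (-t) * t ^ 1) + 12.25 * (Real.exp (-t) * t ^ 0)) with hh
  have hint : IntegrableOn h (Set.Ioi 0) :=
    ((((i2.const_mul 3).add (i1.const_mul 14))).add (i0.const_mul 12.25)).const_mul _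
  have hA : IntegrableOn (fun t : ℝ => 3 * (Real.exp (-t) * t ^ 2) + 14 * (Real.exp (-t) * t ^ 1))
      (Set.Ioi 0) := (i2.const_mul 3).add (i1.const_mul 14)
  have hval : ∫ t in Set.Ioi (0 : ℝ), h t = 1.46 * Real.exp (-3.5) * 32.25 := by
    rw [hh, integral_const_mul, integral_add hA (i0.const_mul 12.25), integral_add (i2.const_mul 3) (i1.const_mul 14),
      integral_const_mul, integral_const_mul, integral_const_mul, e0, e1, e2]
    norm_num [Nat.factorial]
  have hh0 : ∀ t ∈ Set.Ioi (0 : ℝ), 0 ≤ h t := fun t ht => by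
    have : (0 : ℝ) < t := ht
    simp only [hh]; positivity
  rw [← hr, ← integral_poissonMeasure_eq, hr,
    ← ENNReal.ofReal_le_ofReal_iff (by positivity), ← hval,
    ofReal_integral_eq_lintegral_ofReal (hfg.integrable r)
      (ae_of_all _ fun k => mul_nonneg (hX0 k) (sq_nonneg _)), hcake,
    ofReal_integral_eq_lintegral_ofReal hint
      ((ae_restrict_iff' measurableSet_Ioi).2 (ae_of_all _ hh0))]
  refine setLIntegral_mono' measurableSet_Ioi fun t ht => ?_
  have ht0 : (0 : ℝ) < t := ht
  have htail : poissonMeasure r {k | t ≤ X k} ≤ ENNReal.ofReal (1.46 * Real.exp (-(t + 3.5))) := by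
    rw [← ofReal_measureReal (measure_ne_top _ _)]
    refine ENNReal.ofReal_le_ofReal ?_
    have := poissonExp_indicator_poissonDiv_le hl (t + 3.5)
    rw [← hr, ← integral_poissonMeasure_eq, integral_indicator_const _ (MeasurableSet.of_discrete),
      smul_eq_mul, mul_one] at this
    refine le_trans (measureReal_mono fun k hk => ?_) this
    have hk' : t ≤ max (poissonDiv l k - 3.5) 0 := hk
    rcases le_max_iff.1 hk' with h | h
    · simp only [Set.mem_ofPred_eq, hr]; linarith
    · linarith
  calc _ ≤ ENNReal.ofReal (1.46 * Real.exp (-(t + 3.5))) * ENNReal.ofReal (g t) := by gcongr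
    _ = ENNReal.ofReal (h t) := by
        rw [← ENNReal.ofReal_mul (by positivity)]
        congr 1
        simp only [hh, hg]
        rw [show -(t + 3.5) = -3.5 + -t by ring, Real.exp_add]
        ring

theorem exp_neg_three_and_half_le : Real.exp (-3.5) ≤ 0.0302 := by
  have h1 := Real.exp_one_gt_d9
  have h2 : Real.exp 3.5 ^ 2 = Real.exp 1 ^ 7 := by
    rw [← Real.exp_nat_mul, ← Real.exp_nat_mul]; norm_num
  have h3 : (2.7182818283 : ℝ) ^ 7 ≤ Real.exp 1 ^ 7 := by gcongr
  have h4 : 33.115 ≤ Real.exp 3.5 := by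
    refine le_of_sq_le_sq ?_ (Real.exp_pos _).le
    rw [h2]
    exact le_trans (by norm_num) h3
  rw [Real.exp_neg, inv_le_comm₀ (Real.exp_pos _) (by norm_num)]
  exact le_trans (by norm_num) h4

theorem poissonExp_third_central_le {l : ℝ} (hl : 0 < l) :
    poissonExp l (fun k => (poissonDiv l k - poissonExp l (poissonDiv l)) ^ 3) ≤ 3.56 := by
  obtain ⟨hm, -, hv⟩ := momentBounds hl
  have hZ := expGrowth_poissonDiv hl
  have hm0 := poissonExp_nonneg hl.le (poissonDiv_nonneg hl)
  set μ := poissonExp l (poissonDiv l) with hμ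
  have h3 : poissonExp l (fun k => poissonDiv l k ^ 3)
      ≤ 3.5 * poissonExp l (fun k => poissonDiv l k ^ 2) + 1.422 := by
    have hXg : ExpGrowth fun k => max (poissonDiv l k - 3.5) 0 := hZ.mono fun k => by
      rw [abs_of_nonneg (le_max_right _ _), abs_of_nonneg (poissonDiv_nonneg hl k)]
      exact max_le (by linarith) (poissonDiv_nonneg hl k)
    have hfg := hXg.mul ((hXg.add (ExpGrowth.const 3.5)).pow 2)
    have h := poissonExp_mono (hZ.pow 3) (((hZ.pow 2).const_mul 3.5).add hfg) hl.le fun k => by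
      have h0 := poissonDiv_nonneg hl k
      rcases le_total (poissonDiv l k) 3.5 with h | h
      · rw [max_eq_right (by linarith)]
        nlinarith [sq_nonneg (poissonDiv l k)]
      · rw [max_eq_left (by linarith)]
        exact le_of_eq (by ring)
    rw [poissonExp_add ((hZ.pow 2).const_mul 3.5) hfg, poissonExp_const_mul] at h
    have h' := poissonExp_excess_le hl
    linarith [exp_neg_three_and_half_le]
  have e : poissonExp l (fun k => (poissonDiv l k - μ) ^ 3) = poissonExp l (fun k => poissonDiv l k ^ 3)
      - 3 * μ * poissonExp l (fun k => poissonDiv l k ^ 2) + 2 * μ ^ 3 := by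
    have e' : (fun k => (poissonDiv l k - μ) ^ 3) = fun k => (poissonDiv l k ^ 3
        + (-3 * μ) * poissonDiv l k ^ 2) + (3 * μ ^ 2) * poissonDiv l k + -μ ^ 3 := by
      ext k; ring
    have g2 := (hZ.pow 2).const_mul (-3 * μ)
    have g1 := hZ.const_mul (3 * μ ^ 2)
    rw [e', poissonExp_add (((hZ.pow 3).add g2).add g1) (ExpGrowth.const _),
      poissonExp_add ((hZ.pow 3).add g2) g1, poissonExp_add (hZ.pow 3) g2, poissonExp_const_mul,
      poissonExp_const_mul, poissonExp_const, ← hμ]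
    ring
  rw [e]
  have h4 := mul_le_mul_of_nonneg_left hv (by linarith : 0 ≤ 3.5 - 3 * μ)
  nlinarith [mul_nonneg hm0 (by linarith : 0 ≤ 0.5803 - μ),
    mul_nonneg (mul_nonneg hm0 hm0) (by linarith : 0 ≤ 0.5803 - μ)]

/-! ### Tail bounds for sums of independent variables -/

section Sums

variable {Ω : Type*} [MeasurableSpace Ω] {P : Measure Ω} [IsProbabilityMeasure P]

/-- If the tail of `Z` is bounded by the function `q`, then conditioning on the independent variable
`X` bounds the tail of `X + Z`. -/
theorem measureReal_le_add_le_integral {X Z : Ω → ℝ} (hX : AEMeasurable X P)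
    (hZ : AEMeasurable Z P) (hXZ : IndepFun X Z P) {q : ℝ → ℝ}
    (hq : ∀ y, P.real {ω | y ≤ Z ω} ≤ q y) (A : ℝ) (hqi : Integrable (fun ω => q (A - X ω)) P)
    (hqm : Measurable q) : P.real {ω | A ≤ X ω + Z ω} ≤ ∫ ω, q (A - X ω) ∂P := by
  have hq0 : ∀ y, 0 ≤ q y := fun y => measureReal_nonneg.trans (hq y)
  have hmeas : MeasurableSet {p : ℝ × ℝ | A ≤ p.1 + p.2} :=
    measurableSet_le measurable_const (measurable_fst.add measurable_snd)
  have h1 : P {ω | A ≤ X ω + Z ω} = ((P.map X).prod (P.map Z)) {p : ℝ × ℝ | A ≤ p.1 + p.2} := by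
    rw [← hXZ.map_prod_eq_prod_map_map hX hZ, Measure.map_apply_of_aemeasurable (hX.prodMk hZ) hmeas]
    rfl
  rw [Measure.real, ← ENNReal.toReal_ofReal (integral_nonneg fun ω => hq0 (A - X ω))]
  refine ENNReal.toReal_mono ENNReal.ofReal_ne_top ?_
  have : SFinite (P.map Z) := inferInstance
  rw [h1, Measure.prod_apply hmeas,
    ofReal_integral_eq_lintegral_ofReal hqi (ae_of_all _ fun ω => hq0 _)]
  rw [← lintegral_map' (f := fun x => ENNReal.ofReal (q (A - x)))
    ((hqm.comp (measurable_const.sub measurable_id)).ennreal_ofReal.aemeasurable) hX]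
  refine lintegral_mono fun x => ?_
  rw [Measure.map_apply_of_aemeasurable hZ (hmeas.preimage measurable_prodMk_left)]
  rw [← ofReal_measureReal (measure_ne_top _ _)]
  refine ENNReal.ofReal_le_ofReal (le_trans (le_of_eq ?_) (hq (A - x)))
  congr 1
  ext ω
  simp [add_comm x]

/-- The tangent at `w` of the convex function `z ↦ (1 - exp (-z)) / z`. -/
theorem one_sub_exp_neg_ge {w z : ℝ} (hw : 0 < w) (hz : 0 < z) :
    (1 - Real.exp (-w)) / w - (z - w) * ((1 - Real.exp (-w) - w * Real.exp (-w)) / w ^ 2)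
      ≤ (1 - Real.exp (-z)) / z := by
  -- both sides are integrals over `s ∈ [0, 1]`; the integrands are compared in the derivative
  set H : ℝ → ℝ := fun s => (1 - Real.exp (-(z * s))) / z - ((1 - Real.exp (-(w * s))) / w
    - (z - w) * ((1 - Real.exp (-(w * s)) - w * s * Real.exp (-(w * s))) / w ^ 2)) with hH
  have hexp : ∀ c s : ℝ, HasDerivAt (fun s => Real.exp (-(c * s))) (-c * Real.exp (-(c * s))) s :=
    fun c s => by
      have h : HasDerivAt (fun s : ℝ => -(c * s)) (-c) s := by
        simpa using ((hasDerivAt_id s).const_mul (-c))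
      exact h.exp.congr_deriv (mul_comm _ _)
  have hd : ∀ s, HasDerivAt H (Real.exp (-(z * s)) - Real.exp (-(w * s))
      + (z - w) * s * Real.exp (-(w * s))) s := fun s => by
    refine ((((hexp z s).const_sub 1).div_const z).sub ((((hexp w s).const_sub 1).div_const w).sub
      (((((hexp w s).const_sub 1).sub (((hasDerivAt_id s).const_mul w).mul (hexp w s))).div_const
        (w ^ 2)).const_mul (z - w)))).congr_deriv ?_
    simp only [id]
    field_simp
    ring
  have hmono : MonotoneOn H (Set.Icc 0 1) := by
    refine monotoneOn_of_deriv_nonneg (convex_Icc 0 1)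
      (fun s _ => (hd s).continuousAt.continuousWithinAt)
      (fun s _ => (hd s).differentiableAt.differentiableWithinAt) fun s _ => ?_
    rw [(hd s).deriv]
    have h1 := Real.add_one_le_exp (-((z - w) * s))
    have h2 := mul_le_mul_of_nonneg_left h1 (Real.exp_pos (-(w * s))).le
    rw [← Real.exp_add, show -(w * s) + -((z - w) * s) = -(z * s) by ring] at h2
    linarith
  have h := hmono (Set.left_mem_Icc.2 zero_le_one) (Set.right_mem_Icc.2 zero_le_one) zero_le_one
  simp only [hH, mul_zero, neg_zero, Real.exp_zero, sub_self, zero_div, mul_one] at h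
  linarith

/-- A quadratic upper bound of `min 1 (exp (-z))`, with contact at `0` and double contact at `w`. -/
theorem min_one_exp_neg_le {w : ℝ} (hw : 0 < w) {a b : ℝ}
    (hb : b = (1 - Real.exp (-w) - w * Real.exp (-w)) / w ^ 2)
    (ha : a = Real.exp (-w) + 2 * b * w) (z : ℝ) :
    0 ≤ b ∧ min 1 (Real.exp (-z)) ≤ 1 - a * z + b * z ^ 2 := by
  have hb0 : 0 ≤ b := by
    rw [hb]
    refine div_nonneg ?_ (sq_nonneg w)
    have h1 := Real.add_one_le_exp w
    have h2 := mul_le_mul_of_nonneg_left h1 (Real.exp_pos (-w)).le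
    rw [← Real.exp_add, neg_add_cancel, Real.exp_zero] at h2
    linarith
  have ha0 : 0 ≤ a := by rw [ha]; positivity
  refine ⟨hb0, ?_⟩
  rcases le_or_gt z 0 with hz | hz
  · refine (min_le_left _ _).trans ?_
    nlinarith [mul_nonneg ha0 (neg_nonneg.2 hz), mul_nonneg hb0 (sq_nonneg z)]
  · refine (min_le_right _ _).trans ?_
    have h := one_sub_exp_neg_ge hw hz
    rw [← hb] at h
    have e : (1 - Real.exp (-w)) / w = a - b * w := by
      rw [ha, hb]; field_simp; ring
    rw [e, le_div_iff₀ hz] at h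
    nlinarith

/-- A tail bound for `X + Z` with `X`, `Z` independent, when `Z` has the exponential tail
`κ exp (-y)` and only the mean and the variance of `X` are known. Here `Q` is the distance of
`A - log κ` from the mean of `X`. -/
theorem measureReal_le_add_le_of_exp_tail {X Z : Ω → ℝ} (hX : MemLp X 2 P)
    (hZ : AEMeasurable Z P) (hXZ : IndepFun X Z P) {κ : ℝ} (hκ : 0 < κ)
    (htail : ∀ y, P.real {ω | y ≤ Z ω} ≤ κ * Real.exp (-y)) {A Q R w : ℝ}
    (hQ : Q = A - Real.log κ - P[X]) (hQ0 : 0 < Q) (hR : variance X P ≤ R) (hw : w * Q = Q ^ 2 + R) :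
    P.real {ω | A ≤ X ω + Z ω} ≤ 1 - Q * ((1 - Real.exp (-w)) / w) := by
  have hR0 : 0 ≤ R := (variance_nonneg X P).trans hR
  have hw0 : 0 < w := by
    by_contra! h
    nlinarith [mul_nonneg (neg_nonneg.2 h) hQ0.le, pow_pos hQ0 2]
  set b := (1 - Real.exp (-w) - w * Real.exp (-w)) / w ^ 2 with hb
  set a := Real.exp (-w) + 2 * b * w with ha
  have hbd := min_one_exp_neg_le hw0 hb ha
  have hb0 : 0 ≤ b := (hbd 0).1
  set q : ℝ → ℝ := fun y => 1 - a * (y - Real.log κ) + b * (y - Real.log κ) ^ 2 with hq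
  have hXi : Integrable X P := hX.integrable (by norm_num)
  have hX2 : Integrable (fun ω => (X ω) ^ 2) P := hX.integrable_sq
  -- the variance of `X` enters through the centred variable
  set V : Ω → ℝ := fun ω => X ω - P[X] with hV
  have hVi : Integrable V P := hXi.sub (integrable_const _)
  have hV2 : Integrable (fun ω => V ω ^ 2) P := (hX.sub (memLp_const _)).integrable_sq
  have hV0 : ∫ ω, V ω ∂P = 0 := by
    rw [hV, integral_sub hXi (integrable_const _)]; simp
  have hVv : ∫ ω, V ω ^ 2 ∂P = variance X P := (variance_eq_integral hX.1.aemeasurable).symm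
  have e : ∀ ω, q (A - X ω) = (1 - a * Q + b * Q ^ 2) + ((a - 2 * b * Q) * V ω + b * V ω ^ 2) :=
    fun ω => by
      have : A - X ω - Real.log κ = Q - V ω := by rw [hQ, hV]; ring
      simp only [hq, this]; ring
  have hi : Integrable (fun ω => (a - 2 * b * Q) * V ω + b * V ω ^ 2) P :=
    (hVi.const_mul _).add (hV2.const_mul _)
  have h := measureReal_le_add_le_integral (q := q) hX.1.aemeasurable hZ hXZ (fun y => by
      refine le_trans ?_ (hbd (y - Real.log κ)).2
      refine le_min measureReal_le_one ((htail y).trans_eq ?_)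
      rw [neg_sub, Real.exp_sub, Real.exp_log hκ, Real.exp_neg, div_eq_mul_inv]) A
    (by simp only [e]; exact (integrable_const _).add hi) (by fun_prop)
  refine h.trans ?_
  simp only [e]
  rw [integral_add (integrable_const _) hi, integral_add (hVi.const_mul _) (hV2.const_mul _),
    integral_const_mul, integral_const_mul, hV0, hVv]
  simp only [integral_const, probReal_univ, one_smul, mul_zero, zero_add]
  have h1 : b * variance X P ≤ b * R := mul_le_mul_of_nonneg_left hR hb0
  have h2 : (1 - Real.exp (-w)) / w = a - b * w := by
    rw [ha, hb]; field_simp; ring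
  rw [h2]
  have h3 : b * (w * Q) = b * (Q ^ 2 + R) := by rw [hw]
  linarith

/-- Third central moments are additive over independent variables. -/
theorem integral_third_central_add {X Y : Ω → ℝ} (hX : MemLp X 3 P) (hY : MemLp Y 3 P)
    (hXY : IndepFun X Y P) :
    ∫ ω, ((X + Y) ω - P[X + Y]) ^ 3 ∂P
      = ∫ ω, (X ω - P[X]) ^ 3 ∂P + ∫ ω, (Y ω - P[Y]) ^ 3 ∂P := by
  have hXi : Integrable X P := hX.integrable (by norm_num)
  have hYi : Integrable Y P := hY.integrable (by norm_num)
  set V : Ω → ℝ := fun ω => X ω - P[X] with hV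
  set W : Ω → ℝ := fun ω => Y ω - P[Y] with hW
  have hVp : MemLp V 3 P := hX.sub (memLp_const _)
  have hWp : MemLp W 3 P := hY.sub (memLp_const _)
  have hp : ∀ {U : Ω → ℝ}, MemLp U 3 P → Integrable U P ∧ Integrable (fun ω => U ω ^ 2) P ∧
      Integrable (fun ω => U ω ^ 3) P := fun {U} hU =>
    ⟨hU.integrable (by norm_num), (hU.mono_exponent (by norm_num)).integrable_sq, by
      have h3 := hU.integrable_norm_pow (p := 3) (by norm_num)
      refine h3.mono' ((hU.1.aemeasurable.pow_const 3).aestronglyMeasurable) (ae_of_all _ fun ω => ?_)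
      rw [norm_pow]⟩
  obtain ⟨v1, v2, v3⟩ := hp hVp
  obtain ⟨w1, w2, w3⟩ := hp hWp
  have hV0 : ∫ ω, V ω ∂P = 0 := by
    rw [hV, integral_sub hXi (integrable_const _)]; simp
  have hW0 : ∫ ω, W ω ∂P = 0 := by
    rw [hW, integral_sub hYi (integrable_const _)]; simp
  have hind : IndepFun V W P := hXY.comp (measurable_id.sub_const (∫ ω, X ω ∂P))
    (measurable_id.sub_const (∫ ω, Y ω ∂P))
  have i21 : IndepFun (fun ω => V ω ^ 2) W P := hind.comp (φ := fun x => x ^ 2) (ψ := id)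
    (by fun_prop) measurable_id
  have i12 : IndepFun V (fun ω => W ω ^ 2) P := hind.comp (φ := id) (ψ := fun x => x ^ 2)
    measurable_id (by fun_prop)
  have m21 := i21.integral_fun_mul_eq_mul_integral v2.1 w1.1
  have m12 := i12.integral_fun_mul_eq_mul_integral v1.1 w2.1
  rw [hW0, mul_zero] at m21
  rw [hV0, zero_mul] at m12
  have j21 : Integrable (fun ω => V ω ^ 2 * W ω) P := i21.integrable_mul v2 w1
  have j12 : Integrable (fun ω => V ω * W ω ^ 2) P := i12.integrable_mul v1 w2
  have hm : P[X + Y] = P[X] + P[Y] := integral_add hXi hYi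
  have e : ∀ ω, ((X + Y) ω - P[X + Y]) ^ 3
      = (V ω ^ 3 + W ω ^ 3) + (3 * (V ω ^ 2 * W ω) + 3 * (V ω * W ω ^ 2)) := fun ω => by
    rw [hm, Pi.add_apply]; simp only [hV, hW]; ring
  simp only [e]
  have i3 : Integrable (fun ω => V ω ^ 3 + W ω ^ 3) P := v3.add w3
  have i4 : Integrable (fun ω => 3 * (V ω ^ 2 * W ω) + 3 * (V ω * W ω ^ 2)) P :=
    (j21.const_mul 3).add (j12.const_mul 3)
  rw [integral_add i3 i4, integral_add v3 w3, integral_add (j21.const_mul 3) (j12.const_mul 3), integral_const_mul, integral_const_mul,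
    m21, m12]
  ring

theorem integral_third_central_sum {ι : Type*} {Z : ι → Ω → ℝ} (hZ : ∀ i, MemLp (Z i) 3 P)
    (hind : iIndepFun Z P) (s : Finset ι) :
    ∫ ω, ((∑ i ∈ s, Z i) ω - P[∑ i ∈ s, Z i]) ^ 3 ∂P
      = ∑ i ∈ s, ∫ ω, (Z i ω - P[Z i]) ^ 3 ∂P := by
  classical
  induction s using Finset.induction_on with
  | empty => simp
  | insert i s hi ih =>
    have hS : MemLp (∑ j ∈ s, Z j) 3 P := memLp_finsetSum' s fun j _ => hZ j
    have hiS := (hind.indepFun_finsetSum_of_notMem₀ (fun j => (hZ j).1.aemeasurable) hi).symm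
    simp only [Finset.sum_insert hi]
    rw [integral_third_central_add (hZ i) hS hiS, ih]

/-- Markov's inequality for `S (S - E S) ^ 2`, where `S ≥ 0`. -/
theorem measureReal_le_of_third_moment {S : Ω → ℝ} (hS0 : ∀ ω, 0 ≤ S ω) (hS : MemLp S 3 P)
    {A : ℝ} (hA : P[S] < A) :
    P.real {ω | A ≤ S ω} * (A * (A - P[S]) ^ 2)
      ≤ ∫ ω, (S ω - P[S]) ^ 3 ∂P + P[S] * variance S P := by
  set m := P[S] with hm
  have hm0 : 0 ≤ m := integral_nonneg hS0
  set V : Ω → ℝ := fun ω => S ω - m with hV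
  have hVp : MemLp V 3 P := hS.sub (memLp_const _)
  have v2 : Integrable (fun ω => V ω ^ 2) P := (hVp.mono_exponent (by norm_num)).integrable_sq
  have v3 : Integrable (fun ω => V ω ^ 3) P := by
    have h3 := hVp.integrable_norm_pow (p := 3) (by norm_num)
    refine h3.mono' ((hVp.1.aemeasurable.pow_const 3).aestronglyMeasurable) (ae_of_all _ fun ω => ?_)
    rw [norm_pow]
  have hvar : ∫ ω, V ω ^ 2 ∂P = variance S P := (variance_eq_integral hS.1.aemeasurable).symm
  rw [← hvar, ← integral_const_mul, ← integral_add v3 (v2.const_mul m)]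
  have hc : 0 < A * (A - m) ^ 2 := by
    have : 0 < A - m := by linarith
    have : 0 < A := by linarith
    positivity
  have h := mul_meas_ge_le_integral_of_nonneg (μ := P) (f := fun ω => V ω ^ 3 + m * V ω ^ 2)
    (ae_of_all _ fun ω => by
      have : V ω ^ 3 + m * V ω ^ 2 = S ω * V ω ^ 2 := by simp only [hV]; ring
      simp only [Pi.zero_apply, this]
      exact mul_nonneg (hS0 ω) (sq_nonneg _)) (v3.add (v2.const_mul m)) (A * (A - m) ^ 2)
  refine le_trans ?_ h
  rw [mul_comm]
  refine mul_le_mul_of_nonneg_left (measureReal_mono fun ω (hω : A ≤ S ω) => ?_) hc.le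
  have : V ω ^ 3 + m * V ω ^ 2 = S ω * V ω ^ 2 := by simp only [hV]; ring
  simp only [Set.mem_ofPred_eq, this]
  have h1 : A - m ≤ V ω := by simp only [hV]; linarith
  have h2 : 0 ≤ A - m := by linarith
  have h3 : 0 ≤ A := by linarith
  exact mul_le_mul hω (pow_le_pow_left₀ h2 h1 2) (sq_nonneg _) (hS0 ω)

end Sums

/-! ### Real inequalities behind the tail bounds -/

theorem exp_ge_cubic (x : ℝ) : 1 + x + x ^ 2 / 2 + x ^ 3 / 6 ≤ Real.exp x := by
  rcases le_total 0 x with h | h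
  · have := Real.sum_le_exp_of_nonneg h 4
    norm_num [Finset.sum_range_succ, Nat.factorial] at this
    linarith
  · -- for `x ≤ 0` the difference is antitone
    have hd : ∀ y : ℝ, HasDerivAt (fun y => Real.exp y - (1 + y + y ^ 2 / 2 + y ^ 3 / 6))
        (Real.exp y - (1 + y + y ^ 2 / 2)) y := fun y => by
      refine ((Real.hasDerivAt_exp y).sub ((((hasDerivAt_id y).const_add 1).add
        ((hasDerivAt_pow 2 y).div_const 2)).add ((hasDerivAt_pow 3 y).div_const 6))).congr_deriv ?_
      push_cast; ring
    have hanti : AntitoneOn (fun y => Real.exp y - (1 + y + y ^ 2 / 2 + y ^ 3 / 6)) (Set.Iic 0) := by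
      refine antitoneOn_of_deriv_nonpos (convex_Iic 0)
        (fun y _ => (hd y).continuousAt.continuousWithinAt)
        (fun y _ => (hd y).differentiableAt.differentiableWithinAt) fun y hy => ?_
      rw [interior_Iic] at hy
      have hy0 : y < 0 := hy
      rw [(hd y).deriv]
      have h1 := Real.quadratic_le_exp_of_nonneg (x := -y) (by linarith)
      have h2 : Real.exp y * Real.exp (-y) = 1 := by rw [← Real.exp_add]; simp
      have h3 := mul_le_mul_of_nonneg_left h1 (Real.exp_pos y).le
      nlinarith [Real.exp_pos y, sq_nonneg y, sq_nonneg (y ^ 2), pow_pos (neg_pos.2 hy0) 3,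
        pow_pos (neg_pos.2 hy0) 4]
    have := hanti (Set.mem_Iic.2 h) (Set.mem_Iic.2 le_rfl) h
    simp at this
    linarith

theorem sq_add_le_mul_exp {t : ℝ} (ht : 0 ≤ t) : t ^ 2 + 0.51785 ≤ 0.6336 * Real.exp t := by
  rcases le_total t 1 with h | h
  · have := Real.quadratic_le_exp_of_nonneg ht
    nlinarith
  · -- Taylor expansion about a point close to the minimum
    have h1 := exp_ge_cubic (t - 1.7)
    have h2 : 5.473 ≤ Real.exp 1.7 := by
      have := Real.sum_le_exp_of_nonneg (show (0 : ℝ) ≤ 1.7 by norm_num) 12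
      norm_num [Finset.sum_range_succ, Nat.factorial] at this
      linarith
    have h3 : Real.exp t = Real.exp 1.7 * Real.exp (t - 1.7) := by rw [← Real.exp_add]; ring_nf
    have h4 : 0 ≤ 1 + (t - 1.7) + (t - 1.7) ^ 2 / 2 + (t - 1.7) ^ 3 / 6 := by
      nlinarith [sq_nonneg (t - 1.7 + 1)]
    have h5 : 5.473 * (1 + (t - 1.7) + (t - 1.7) ^ 2 / 2 + (t - 1.7) ^ 3 / 6) ≤ Real.exp t := by
      rw [h3]; exact mul_le_mul h2 h1 h4 (Real.exp_pos _).le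
    nlinarith [mul_nonneg (sub_nonneg.2 h) (sq_nonneg (t - 1.7)), sq_nonneg (t - 1.65)]

/-- The one-variable case of the inequality for small deviations. -/
theorem sq_le_mul_exp_sub_one {t : ℝ} (ht : 0 ≤ t) :
    t ^ 2 ≤ 0.51785 * (Real.exp (t + 0.2018) - 1) := by
  have h1 := sq_add_le_mul_exp ht
  have h2 : 1.22358 ≤ Real.exp 0.2018 := by
    have := Real.sum_le_exp_of_nonneg (show (0 : ℝ) ≤ 0.2018 by norm_num) 6
    norm_num [Finset.sum_range_succ, Nat.factorial] at this
    linarith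
  rw [Real.exp_add]
  nlinarith [Real.exp_pos t]

theorem sq_le_seven_tenths_mul {T : ℝ} (hT : 0 ≤ T) : T ^ 2 ≤ 0.7 * (Real.exp T - 1) := by
  have := Real.sum_le_exp_of_nonneg hT 5
  norm_num [Finset.sum_range_succ, Nat.factorial] at this
  have h : 0 ≤ T * (0.7 - 0.65 * T + 0.7 / 6 * T ^ 2 + 0.7 / 24 * T ^ 3) :=
    mul_nonneg hT (by nlinarith [sq_nonneg (T - 1.7), mul_nonneg hT (sq_nonneg (T - 1.7))])
  nlinarith

/-- A bound `T ^ 2 / (exp T - 1) ≤ z` at `T = T₀ ≥ 2` persists for larger `T`. -/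
theorem sq_le_mul_exp_of_ge {T T₀ z e : ℝ} (hT : T₀ ≤ T) (hT₀ : 2 ≤ T₀) (he : e ≤ Real.exp T₀)
    (hz : 0 ≤ z) (h : T₀ ^ 2 + z ≤ z * e) : T ^ 2 ≤ z * (Real.exp T - 1) := by
  obtain ⟨x, hx, rfl⟩ : ∃ x, 0 ≤ x ∧ T = T₀ + x := ⟨T - T₀, by linarith, by ring⟩
  have h1 := Real.quadratic_le_exp_of_nonneg hx
  rw [Real.exp_add]
  have h2 : z * e ≤ z * Real.exp T₀ := mul_le_mul_of_nonneg_left he hz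
  have h3 : (T₀ ^ 2 + z) * (1 + x + x ^ 2 / 2) ≤ z * Real.exp T₀ * Real.exp x :=
    mul_le_mul (h.trans h2) h1 (by positivity) (by positivity)
  have h4 : 4 * x ≤ T₀ ^ 2 * x := mul_le_mul_of_nonneg_right (by nlinarith) hx
  have h5 : 2 * T₀ * x ≤ T₀ ^ 2 * x := mul_le_mul_of_nonneg_right (by nlinarith) hx
  have h6 : 4 * x ^ 2 ≤ T₀ ^ 2 * x ^ 2 := mul_le_mul_of_nonneg_right (by nlinarith) (sq_nonneg x)
  nlinarith [mul_nonneg hz hx, mul_nonneg hz (sq_nonneg x)]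

theorem exp_lower_bounds : 12.8 ≤ Real.exp 2.55 ∧ 18.17 ≤ Real.exp 2.9 ∧ 66.6 ≤ Real.exp 4.2 ∧
    492 ≤ Real.exp 6.2 ∧ 3640 ≤ Real.exp 8.2 := by
  refine ⟨?_, ?_, ?_, ?_, ?_⟩
  · refine le_trans ?_ (Real.sum_le_exp_of_nonneg (by norm_num) 12)
    norm_num [Finset.sum_range_succ, Nat.factorial]
  · refine le_trans ?_ (Real.sum_le_exp_of_nonneg (by norm_num) 13)
    norm_num [Finset.sum_range_succ, Nat.factorial]
  · refine le_trans ?_ (Real.sum_le_exp_of_nonneg (by norm_num) 15)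
    norm_num [Finset.sum_range_succ, Nat.factorial]
  · refine le_trans ?_ (Real.sum_le_exp_of_nonneg (by norm_num) 19)
    norm_num [Finset.sum_range_succ, Nat.factorial]
  · refine le_trans ?_ (Real.sum_le_exp_of_nonneg (by norm_num) 25)
    norm_num [Finset.sum_range_succ, Nat.factorial]

theorem peel_endpoint_of_le {m t c z c₁ z₁ : ℝ} (hm : 0 ≤ m) (ht : 0 ≤ t) (hc : c ≤ c₁)
    (hz : z ≤ z₁) (h : 0 ≤ (4.5 + c₁) * (0.02004 * m) + z₁ - 0.51785 →
      t * ((4.5 + c₁) * (0.02004 * m) + z₁ - 0.51785)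
        ≤ 2 * 0.51785 * (m + 1) * (0.2018 + 0.02004 * m)) :
    t * ((4.5 + c) * (0.02004 * m) + z)
      ≤ t * 0.51785 + 2 * 0.51785 * (m + 1) * (0.2018 + 0.02004 * m) := by
  have h1 : t * ((4.5 + c) * (0.02004 * m) + z) ≤ t * ((4.5 + c₁) * (0.02004 * m) + z₁) := by
    gcongr
  rcases le_total 0 ((4.5 + c₁) * (0.02004 * m) + z₁ - 0.51785) with h2 | h2
  · linarith [h h2]
  · have h3 := mul_nonneg ht (neg_nonneg.2 h2)
    have h4 : 0 ≤ 2 * 0.51785 * (m + 1) * (0.2018 + 0.02004 * m) := by positivity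
    linarith

/-- The inequality for small deviations, at the upper end of the range of `D`. Here `c` and `z` stand
for `T / (exp T - 1)` and `T ^ 2 / (exp T - 1)`, with `T = t + 0.2018`. -/
theorem peel_endpoint {m t c z : ℝ} (hm : 0 ≤ m) (ht : 2.35 ≤ t) (htm : t ≤ 7 + 0.13 * (m + 1))
    (hT : c * (t + 0.2018) = z) (hz : z * (Real.exp (t + 0.2018) - 1) = (t + 0.2018) ^ 2) :
    t * ((4.5 + c) * (0.02004 * m) + z)
      ≤ t * 0.51785 + 2 * 0.51785 * (m + 1) * (0.2018 + 0.02004 * m) := by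
  have ht0 : 0 ≤ t := by linarith
  have hE : 0 < Real.exp (t + 0.2018) - 1 := by
    have := Real.add_one_le_exp (t + 0.2018); linarith
  have bound : ∀ T₀ e z₁ c₁ : ℝ, T₀ ≤ t + 0.2018 → 2 ≤ T₀ → e ≤ Real.exp T₀ → 0 ≤ z₁ →
      T₀ ^ 2 + z₁ ≤ z₁ * e → z₁ ≤ c₁ * T₀ → c ≤ c₁ ∧ z ≤ z₁ := fun T₀ e z₁ c₁ h1 h2 h3 h4 h5 h6 => by
    have hzz : z ≤ z₁ := by
      have := sq_le_mul_exp_of_ge h1 h2 h3 h4 h5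
      rw [← hz] at this
      exact le_of_mul_le_mul_right this hE
    refine ⟨?_, hzz⟩
    have hc1 : 0 ≤ c₁ := by
      by_contra! hneg
      nlinarith
    have : c * (t + 0.2018) ≤ c₁ * (t + 0.2018) := by
      rw [hT]; nlinarith
    exact le_of_mul_le_mul_right this (by linarith)
  obtain ⟨e1, e2, e3, e4, e5⟩ := exp_lower_bounds
  -- on each range of `t`, with `c` and `z` replaced by their bounds, the claim is linear in `t`, and
  -- at the right end point it is the positivity of a quadratic polynomial in `m`
  rcases le_total t 2.7 with h1 | h1
  · obtain ⟨hc, hz'⟩ := bound 2.55 12.8 0.5512 0.2162 (by linarith) (by norm_num) e1 (by norm_num)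
      (by norm_num) (by norm_num)
    exact peel_endpoint_of_le hm ht0 hc hz' fun h => by
      nlinarith [mul_le_mul_of_nonneg_right h1 h, sq_nonneg (m - 0.6)]
  rcases le_total t 4 with h2 | h2
  · obtain ⟨hc, hz'⟩ := bound 2.9 18.17 0.49 0.169 (by linarith) (by norm_num) e2 (by norm_num)
      (by norm_num) (by norm_num)
    exact peel_endpoint_of_le hm ht0 hc hz' fun h => by
      nlinarith [mul_le_mul_of_nonneg_right h2 h, sq_nonneg (m - 3.5)]
  rcases le_total t 6 with h3 | h3
  · obtain ⟨hc, hz'⟩ := bound 4.2 66.6 0.269 0.0641 (by linarith) (by norm_num) e3 (by norm_num)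
      (by norm_num) (by norm_num)
    exact peel_endpoint_of_le hm ht0 hc hz' fun h => by
      nlinarith [mul_le_mul_of_nonneg_right h3 h, sq_nonneg (m - 7.7)]
  rcases le_total t 8 with h4 | h4
  · obtain ⟨hc, hz'⟩ := bound 6.2 492 0.0783 0.01264 (by linarith) (by norm_num) e4 (by norm_num)
      (by norm_num) (by norm_num)
    exact peel_endpoint_of_le hm ht0 hc hz' fun h => by
      nlinarith [mul_le_mul_of_nonneg_right h4 h, sq_nonneg (m - 11.9)]
  · obtain ⟨hc, hz'⟩ := bound 8.2 3640 0.0185 0.00226 (by linarith) (by norm_num) e5 (by norm_num)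
      (by norm_num) (by norm_num)
    exact peel_endpoint_of_le hm ht0 hc hz' fun h => by
      nlinarith [mul_le_mul_of_nonneg_right htm h, sq_nonneg (m - 19.3)]

theorem affine_nonneg {a b x u : ℝ} (hx : 0 ≤ x) (hxu : x ≤ u) (h0 : 0 ≤ a) (h1 : 0 ≤ a + b * u) :
    0 ≤ a + b * x := by
  rcases le_total 0 b with hb | hb
  · positivity
  · nlinarith

/-- The inequality for small deviations: with `m` summands besides the distinguished one, whose
variances add up to at most `0.51785 m + 4.5 D` when the means fall short of `0.5803 m` by `D`. -/
theorem peel_ineq {m t D Q T c : ℝ} (hm : 0 ≤ m) (ht : 0 < t) (htm : t ≤ 7 + 0.13 * (m + 1))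
    (hD : 0 ≤ D) (hDm : D ≤ 0.02004 * m) (hT : T = t + 0.2018) (hQ : T + D ≤ Q)
    (hc : c = T / (Real.exp T - 1)) :
    t ^ 2 * (m * 0.51785 + 4.5 * D + Q * c) ≤ 0.51785 * (m + 1) * Q ^ 2 := by
  have hT0 : 0 < T := by linarith
  have hE : 0 < Real.exp T - 1 := by have := Real.add_one_le_exp T; linarith
  have hc0 : 0 < c := by rw [hc]; positivity
  set z := c * T with hzdef
  have hz : z * (Real.exp T - 1) = T ^ 2 := by rw [hzdef, hc]; field_simp
  have hz7 : z ≤ 0.7 := by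
    have := sq_le_seven_tenths_mul hT0.le
    rw [← hz] at this
    exact le_of_mul_le_mul_right this hE
  have hz1 : t ^ 2 * z ≤ 0.51785 * T ^ 2 := by
    have h1 := sq_le_mul_exp_sub_one ht.le
    rw [← hT] at h1
    have hz0 : 0 ≤ z := by positivity
    calc t ^ 2 * z ≤ 0.51785 * (Real.exp T - 1) * z := by gcongr
      _ = 0.51785 * T ^ 2 := by rw [← hz]; ring
  -- the case `Q = T + D`, which is affine in `D` once the square of `D` is dropped
  have hlin : 0 ≤ (0.51785 * t ^ 2 + 0.51785 * (m + 1) * (2 * t * 0.2018 + 0.2018 ^ 2) - t ^ 2 * z)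
      + (0.51785 * (m + 1) * (2 * t) - t ^ 2 * (4.5 + c)) * D := by
    have hbase : 0 ≤ 0.51785 * t ^ 2 + 0.51785 * (m + 1) * (2 * t * 0.2018 + 0.2018 ^ 2)
        - t ^ 2 * z := by
      rw [hT] at hz1
      nlinarith [mul_nonneg hm ht.le]
    refine affine_nonneg hD hDm hbase ?_
    rcases le_total t 2.35 with h | h
    · have htc : t * c ≤ 0.7 := by
        have : t * c ≤ T * c := by gcongr; linarith
        linarith [mul_comm T c]
      have h1 : 0 ≤ (m * t) * (0.22976 - (4.5 * t + t * c) * 0.02004) := by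
        have : (4.5 * t + t * c) * 0.02004 ≤ 0.22976 := by linarith
        exact mul_nonneg (by positivity) (by linarith)
      rw [hT] at hz1
      nlinarith [mul_nonneg hm ht.le, mul_nonneg (mul_nonneg hm hm) ht.le]
    · have h1 := peel_endpoint hm h htm (by rw [← hT]) (by rw [← hT]; exact hz)
      nlinarith [mul_le_mul_of_nonneg_left h1 ht.le]
  have hQ1 : t ^ 2 * (m * 0.51785 + 4.5 * D + (T + D) * c) ≤ 0.51785 * (m + 1) * (T + D) ^ 2 := by
    have e : (T + D) * c = z + c * D := by rw [hzdef]; ring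
    rw [e]
    have : t ^ 2 + 2 * t * (0.2018 + D) + 0.2018 ^ 2 ≤ (T + D) ^ 2 := by
      rw [hT]; nlinarith
    have := mul_le_mul_of_nonneg_left this (by positivity : 0 ≤ 0.51785 * (m + 1))
    nlinarith
  have hQ0 : 0 < T + D := by linarith
  set Q₁ := T + D
  have h1 : Q₁ ^ 2 ≤ Q ^ 2 := by gcongr
  have h2 : t ^ 2 * (m * 0.51785 + 4.5 * D + Q * c) * Q₁ ^ 2
      ≤ 0.51785 * (m + 1) * Q ^ 2 * Q₁ ^ 2 := by
    calc _ = t ^ 2 * ((m * 0.51785 + 4.5 * D) * Q₁ ^ 2 + Q * c * Q₁ * Q₁) := by ring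
      _ ≤ t ^ 2 * ((m * 0.51785 + 4.5 * D) * Q ^ 2 + Q * c * Q₁ * Q) := by
          have : 0 < Q := hQ0.trans_le hQ
          gcongr
      _ = Q ^ 2 * (t ^ 2 * (m * 0.51785 + 4.5 * D + Q₁ * c)) := by ring
      _ ≤ Q ^ 2 * (0.51785 * (m + 1) * Q₁ ^ 2) := by gcongr
      _ = _ := by ring
  exact le_of_mul_le_mul_right h2 (by positivity)

theorem mul_exp_sub_one_le {T w : ℝ} (hTw : T ≤ w) (hT : 0 ≤ T) :
    w * (Real.exp T - 1) ≤ T * (Real.exp w - 1) := by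
  obtain ⟨x, hx, rfl⟩ : ∃ x, 0 ≤ x ∧ w = T + x := ⟨w - T, by linarith, by ring⟩
  have h1 := Real.add_one_le_exp x
  have h2 := Real.add_one_le_exp (-T)
  have h3 := mul_le_mul_of_nonneg_left h2 (Real.exp_pos T).le
  rw [← Real.exp_add, add_neg_cancel, Real.exp_zero] at h3
  rw [Real.exp_add]
  have h4 := mul_le_mul_of_nonneg_left h1 (mul_nonneg hT (Real.exp_pos T).le)
  nlinarith [mul_le_mul_of_nonneg_left h3 hx]

/-- The conclusion for small deviations, in the form delivered by the exponential tail of one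
summand. -/
theorem peel_bound {m t D Q R w : ℝ} (hm : 0 ≤ m) (ht : 0 < t) (htm : t ≤ 7 + 0.13 * (m + 1))
    (hD : 0 ≤ D) (hDm : D ≤ 0.02004 * m) (hQ : t + 0.2018 + D ≤ Q)
    (hR : R = m * 0.51785 + 4.5 * D) (hw : w * Q = Q ^ 2 + R) :
    1 - Q * ((1 - Real.exp (-w)) / w) ≤ 0.51785 * (m + 1) / (0.51785 * (m + 1) + t ^ 2) := by
  set T := t + 0.2018 with hT
  set c := T / (Real.exp T - 1) with hc
  have h := peel_ineq hm ht htm hD hDm hT hQ hc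
  have hT0 : 0 < T := by linarith
  have hQ0 : 0 < Q := by linarith
  have hQw : Q ≤ w := by
    have : Q * Q ≤ w * Q := by rw [hw, hR]; nlinarith
    exact le_of_mul_le_mul_right this hQ0
  have hw0 : 0 < w := hQ0.trans_le hQw
  have hE : 0 < Real.exp T - 1 := by have := Real.add_one_le_exp T; linarith
  have hc0 : 0 < c := by positivity
  have h1 : w ≤ c * (Real.exp w - 1) := by
    have := mul_exp_sub_one_le (by linarith : T ≤ w) hT0.le
    rw [hc, div_mul_eq_mul_div, le_div_iff₀ hE]
    exact this
  have h2 : w ≤ (1 - Real.exp (-w)) * (w + c) := by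
    have := mul_le_mul_of_nonneg_left h1 (Real.exp_pos (-w)).le
    have e : Real.exp (-w) * (c * (Real.exp w - 1)) = c * (1 - Real.exp (-w)) := by
      have : Real.exp (-w) * Real.exp w = 1 := by rw [← Real.exp_add]; simp
      linear_combination c * this
    rw [e] at this
    linarith
  have h3 : Q / (w + c) ≤ Q * ((1 - Real.exp (-w)) / w) := by
    rw [div_le_iff₀ (by positivity), mul_assoc]
    refine le_mul_of_one_le_right hQ0.le ?_
    rw [div_mul_eq_mul_div, one_le_div hw0]
    exact h2
  have h4 : t ^ 2 / (0.51785 * (m + 1) + t ^ 2) ≤ Q / (w + c) := by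
    rw [div_le_div_iff₀ (by positivity) (by positivity)]
    have h5 : t ^ 2 * (w + c) * Q ≤ Q * (0.51785 * (m + 1) + t ^ 2) * Q := by
      have e : t ^ 2 * (w + c) * Q = t ^ 2 * (w * Q) + t ^ 2 * (Q * c) := by ring
      rw [e, hw, hR]
      nlinarith
    exact le_of_mul_le_mul_right h5 hQ0
  have h6 : 0.51785 * (m + 1) / (0.51785 * (m + 1) + t ^ 2)
      = 1 - t ^ 2 / (0.51785 * (m + 1) + t ^ 2) := by
    field_simp; ring
  rw [h6]
  linarith

/-- The inequality for large deviations, to be combined with Markov's inequality for a third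
moment. -/
theorem cubic_ineq {n t D : ℝ} (hn : 1 ≤ n) (ht : 7 + 0.13 * n ≤ t) (hD : 0 ≤ D)
    (hDn : D ≤ 0.02004 * n) :
    (3.56 * n + (0.5803 * n - D) * (0.51785 * n + 4.5 * D)) * (0.51785 * n + t ^ 2)
      ≤ 0.51785 * n * ((t + 0.5803 * n) * (t + D) ^ 2) := by
  obtain ⟨δ, rfl⟩ : ∃ δ, D = n * δ := ⟨D / n, by field_simp⟩
  have hδ : 0 ≤ δ := nonneg_of_mul_nonneg_right hD (by linarith)
  have hδ' : δ ≤ 0.02004 := by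
    rw [mul_comm] at hDn
    exact le_of_mul_le_mul_right hDn (by linarith)
  obtain ⟨x, hx, rfl⟩ : ∃ x, 0 ≤ x ∧ t = 7 + 0.13 * n + x := ⟨t - (7 + 0.13 * n), by linarith, by ring⟩
  have ht0 : 0 < 7 + 0.13 * n + x := by linarith
  have hn0 : 0 < n := by linarith
  have hlin : 0 ≤ (0.51785 * (7 + 0.13 * n + x) ^ 3 - 3.56 * (7 + 0.13 * n + x) ^ 2
      - 3.56 * 0.51785 * n - 0.5803 * 0.51785 ^ 2 * n ^ 2)
      + (n * (2 * 0.51785 * (7 + 0.13 * n + x) * (7 + 0.13 * n + x + 0.5803 * n)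
        - 2.0935 * (0.51785 * n + (7 + 0.13 * n + x) ^ 2))) * δ := by
    obtain ⟨y, hy, rfl⟩ : ∃ y, 0 ≤ y ∧ n = 1 + y := ⟨n - 1, by linarith, by ring⟩
    refine affine_nonneg hδ hδ' ?_ ?_
    · ring_nf
      nlinarith [mul_nonneg hx hy, mul_nonneg hx hx, mul_nonneg (mul_nonneg hx hx) hx,
        mul_nonneg (mul_nonneg hx hx) hy, mul_nonneg (mul_nonneg hx hy) hy,
        mul_nonneg hy (sq_nonneg (y - 15))]
    · ring_nf
      nlinarith [mul_nonneg hx hy, mul_nonneg hx hx, mul_nonneg (mul_nonneg hx hx) hx,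
        mul_nonneg (mul_nonneg hx hx) hy, mul_nonneg (mul_nonneg hx hy) hy,
        mul_nonneg hy (sq_nonneg (y - 5))]
  set t := 7 + 0.13 * n + x
  have h1 : (0.5803 * n - n * δ) * (0.51785 * n + 4.5 * (n * δ))
      ≤ n ^ 2 * (0.5803 * 0.51785 + 2.0935 * δ) := by
    have : 0 ≤ n ^ 2 * (4.5 * δ ^ 2 + 0.00001 * δ) := by positivity
    nlinarith
  have h2 : t ^ 2 + 2 * t * (n * δ) ≤ (t + n * δ) ^ 2 := by nlinarith [sq_nonneg (n * δ)]
  calc _ ≤ (3.56 * n + n ^ 2 * (0.5803 * 0.51785 + 2.0935 * δ)) * (0.51785 * n + t ^ 2) := by gcongr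
    _ ≤ 0.51785 * n * ((t + 0.5803 * n) * (t ^ 2 + 2 * t * (n * δ))) := by
        have := mul_nonneg hn0.le hlin
        nlinarith
    _ ≤ _ := by gcongr

/-! ### Sums of independent variables with the moment bounds -/

section Main

variable {Ω : Type*} [MeasurableSpace Ω] {P : Measure Ω}

/-- The properties of `I(Y ‖ l)`, for a Poisson variable `Y` with mean `l`, that enter into the
bound for the sum. -/
structure HasDivergenceBounds (Z : Ω → ℝ) (P : Measure Ω) : Prop where
  nonneg : ∀ ω, 0 ≤ Z ω
  memLp : MemLp Z 3 P
  mean_le : P[Z] ≤ 0.5803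
  variance_le : variance Z P ≤ 0.608
  variance_le_add : variance Z P ≤ 0.51785 + 4.5 * (0.5803 - P[Z])
  third_le : ∫ ω, (Z ω - P[Z]) ^ 3 ∂P ≤ 3.56
  tail_le : ∀ a, P.real {ω | a ≤ Z ω} ≤ 1.46 * Real.exp (-a)

theorem log_146_le : Real.log 1.46 ≤ 0.3785 := by
  rw [Real.log_le_iff_le_exp (by norm_num)]
  have := Real.sum_le_exp_of_nonneg (show (0 : ℝ) ≤ 0.3785 by norm_num) 6
  norm_num [Finset.sum_range_succ, Nat.factorial] at this
  linarith

variable [IsProbabilityMeasure P] {ι : Type*} {Z : ι → Ω → ℝ}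

/-- The sum `D` of the excesses of the variances over `0.51785`, divided by `4.5`, is a lower bound
for the amount by which the means fall short of `0.5803`. -/
theorem exists_excess (hZ : ∀ i, HasDivergenceBounds (Z i) P) (hind : iIndepFun Z P)
    (s : Finset ι) : ∃ D, 0 ≤ D ∧ D ≤ 0.02004 * (s.card : ℝ) ∧
      P[∑ i ∈ s, Z i] ≤ 0.5803 * s.card - D ∧
      variance (∑ i ∈ s, Z i) P ≤ s.card * 0.51785 + 4.5 * D := by
  have hp : ∀ i, Integrable (Z i) P := fun i => (hZ i).memLp.integrable (by norm_num)
  have hcard : ∀ c : ℝ, c * (s.card : ℝ) = ∑ i ∈ s, c := fun c => by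
    rw [Finset.sum_const, nsmul_eq_mul, mul_comm]
  refine ⟨∑ i ∈ s, max 0 ((variance (Z i) P - 0.51785) / 4.5),
    Finset.sum_nonneg fun i _ => le_max_left _ _, ?_, ?_, ?_⟩
  · rw [hcard]
    refine Finset.sum_le_sum fun i _ => max_le (by norm_num) ?_
    have := (hZ i).variance_le
    rw [div_le_iff₀ (by norm_num)]; linarith
  · have e : P[∑ i ∈ s, Z i] = ∑ i ∈ s, P[Z i] := by
      simp only [Finset.sum_apply]
      exact integral_finsetSum s fun i _ => hp i
    rw [e, hcard, ← Finset.sum_sub_distrib]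
    refine Finset.sum_le_sum fun i _ => ?_
    have h1 := (hZ i).variance_le_add
    have h2 := (hZ i).mean_le
    have : max 0 ((variance (Z i) P - 0.51785) / 4.5) ≤ 0.5803 - P[Z i] := by
      refine max_le (by linarith) ?_
      rw [div_le_iff₀ (by norm_num)]; linarith
    linarith
  · rw [IndepFun.variance_sum (fun i _ => (hZ i).memLp.mono_exponent (by norm_num))
      fun i _ j _ hij => hind.indepFun hij, mul_comm, hcard, Finset.mul_sum,
      ← Finset.sum_add_distrib]
    refine Finset.sum_le_sum fun i _ => ?_
    have := le_max_right 0 ((variance (Z i) P - 0.51785) / 4.5)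
    rw [div_le_iff₀ (by norm_num)] at this
    linarith

theorem measureReal_sum_ge_le_of_small [Fintype ι] (hZ : ∀ i, HasDivergenceBounds (Z i) P)
    (hind : iIndepFun Z P) (i₀ : ι) {t : ℝ} (ht : 0 < t) (htn : t ≤ 7 + 0.13 * Fintype.card ι) :
    P.real {ω | 0.5803 * (Fintype.card ι : ℝ) + t ≤ ∑ i, Z i ω}
      ≤ 0.51785 * (Fintype.card ι : ℝ) / (0.51785 * (Fintype.card ι : ℝ) + t ^ 2) := by
  classical
  set s := Finset.univ.erase i₀ with hs
  have hcard : (Fintype.card ι : ℝ) = s.card + 1 := by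
    rw [hs, ← Finset.card_univ, ← Finset.card_erase_add_one (Finset.mem_univ i₀)]
    push_cast; ring
  obtain ⟨D, hD0, hD, hm, hv⟩ := exists_excess hZ hind s
  have hS : MemLp (∑ i ∈ s, Z i) 2 P :=
    memLp_finsetSum' s fun i _ => (hZ i).memLp.mono_exponent (by norm_num)
  have hi : IndepFun (∑ i ∈ s, Z i) (Z i₀) P :=
    hind.indepFun_finsetSum_of_notMem₀ (fun j => (hZ j).memLp.1.aemeasurable)
      (Finset.notMem_erase i₀ _)
  rw [hcard] at htn ⊢
  set m : ℝ := (s.card : ℝ)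
  have hm0 : 0 ≤ m := Nat.cast_nonneg _
  set Q := 0.5803 * (m + 1) + t - Real.log 1.46 - P[∑ i ∈ s, Z i] with hQ
  have hQ' : t + 0.2018 + D ≤ Q := by rw [hQ]; linarith [log_146_le]
  have hQ0 : 0 < Q := by linarith
  have hw : (Q ^ 2 + (m * 0.51785 + 4.5 * D)) / Q * Q = Q ^ 2 + (m * 0.51785 + 4.5 * D) := by
    field_simp
  have h := measureReal_le_add_le_of_exp_tail hS (hZ i₀).memLp.1.aemeasurable hi
    (by norm_num : (0 : ℝ) < 1.46) (hZ i₀).tail_le hQ hQ0 hv hw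
  refine le_trans (le_of_eq ?_) (h.trans (peel_bound hm0 ht htn hD0 hD hQ' rfl hw))
  congr 1
  ext ω
  rw [Set.mem_ofPred_eq, Set.mem_ofPred_eq, ← Finset.sum_erase_add _ _ (Finset.mem_univ i₀),
    Finset.sum_apply]

theorem measureReal_sum_ge_le_of_large [Fintype ι] [Nonempty ι]
    (hZ : ∀ i, HasDivergenceBounds (Z i) P) (hind : iIndepFun Z P) {t : ℝ}
    (htn : 7 + 0.13 * Fintype.card ι ≤ t) :
    P.real {ω | 0.5803 * (Fintype.card ι : ℝ) + t ≤ ∑ i, Z i ω}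
      ≤ 0.51785 * (Fintype.card ι : ℝ) / (0.51785 * (Fintype.card ι : ℝ) + t ^ 2) := by
  obtain ⟨D, hD0, hD, hm, hv⟩ := exists_excess hZ hind Finset.univ
  rw [Finset.card_univ] at hD hm hv
  have hn : (1 : ℝ) ≤ Fintype.card ι := by exact_mod_cast Fintype.card_pos
  have h3 := integral_third_central_sum (fun i => (hZ i).memLp) hind Finset.univ
  have h3' : ∑ i, ∫ ω, (Z i ω - P[Z i]) ^ 3 ∂P ≤ 3.56 * (Fintype.card ι : ℝ) := by
    refine (Finset.sum_le_sum fun i _ => (hZ i).third_le).trans_eq ?_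
    rw [Finset.sum_const, nsmul_eq_mul, Finset.card_univ, mul_comm]
  set n : ℝ := (Fintype.card ι : ℝ)
  set S : Ω → ℝ := ∑ i, Z i with hS
  have hSp : MemLp S 3 P := memLp_finsetSum' _ fun i _ => (hZ i).memLp
  have hS0 : ∀ ω, 0 ≤ S ω := fun ω => by
    rw [hS, Finset.sum_apply]; exact Finset.sum_nonneg fun i _ => (hZ i).nonneg ω
  have hm0 : 0 ≤ P[S] := integral_nonneg hS0
  have ht0 : 0 < t := by linarith
  have h := measureReal_le_of_third_moment hS0 hSp (A := 0.5803 * n + t) (by linarith)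
  rw [h3] at h
  have hset : {ω | 0.5803 * n + t ≤ ∑ i, Z i ω} = {ω | 0.5803 * n + t ≤ S ω} := by
    ext ω; rw [hS, Set.mem_ofPred_eq, Set.mem_ofPred_eq, Finset.sum_apply]
  rw [hset]
  set p := P.real {ω | 0.5803 * n + t ≤ S ω}
  have hp0 : 0 ≤ p := measureReal_nonneg
  have h4 : p * ((t + 0.5803 * n) * (t + D) ^ 2)
      ≤ 3.56 * n + (0.5803 * n - D) * (0.51785 * n + 4.5 * D) := by
    calc p * ((t + 0.5803 * n) * (t + D) ^ 2)
        ≤ p * ((0.5803 * n + t) * (0.5803 * n + t - P[S]) ^ 2) := by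
          rw [add_comm t]
          gcongr
          linarith
      _ ≤ _ := h
      _ ≤ 3.56 * n + (0.5803 * n - D) * (0.51785 * n + 4.5 * D) := by
          refine add_le_add h3' (mul_le_mul hm (by linarith) (variance_nonneg _ _) (by linarith))
  have h5 := cubic_ineq hn htn hD0 hD
  rw [le_div_iff₀ (by positivity)]
  have h6 : p * (0.51785 * n + t ^ 2) * ((t + 0.5803 * n) * (t + D) ^ 2)
      ≤ 0.51785 * n * ((t + 0.5803 * n) * (t + D) ^ 2) := by
    refine le_trans ?_ h5
    calc _ = p * ((t + 0.5803 * n) * (t + D) ^ 2) * (0.51785 * n + t ^ 2) := by ring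
      _ ≤ _ := by gcongr
  exact le_of_mul_le_mul_right h6 (by positivity)

/-- The one-sided Chebyshev bound with the constants `0.5803` and `0.51785`, although the variances
may exceed the latter. -/
theorem measureReal_sum_ge_le [Fintype ι] [Nonempty ι] (hZ : ∀ i, HasDivergenceBounds (Z i) P)
    (hind : iIndepFun Z P) {t : ℝ} (ht : 0 < t) :
    P.real {ω | 0.5803 * (Fintype.card ι : ℝ) + t ≤ ∑ i, Z i ω}
      ≤ 0.51785 * (Fintype.card ι : ℝ) / (0.51785 * (Fintype.card ι : ℝ) + t ^ 2) := by
  rcases le_total t (7 + 0.13 * Fintype.card ι) with h | h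
  · exact measureReal_sum_ge_le_of_small hZ hind (Classical.arbitrary ι) ht h
  · exact measureReal_sum_ge_le_of_large hZ hind h

/-! ### Poisson observations -/

/-- The divergence `I(k ‖ l)`, with the value `0` at `l = 0`, where `k = 0` almost surely. -/
noncomputable def poissonDiv' (l : ℝ) (k : ℕ) : ℝ := if l = 0 then 0 else poissonDiv l k

omit [IsProbabilityMeasure P] in
theorem integral_comp_poisson {r : NNReal} {Y : Ω → ℕ} (hY : HasLaw Y (poissonMeasure r) P)
    (f : ℕ → ℝ) : ∫ ω, f (Y ω) ∂P = poissonExp r f := by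
  rw [← integral_poissonMeasure_eq]
  exact hY.integral_comp (f := f) (measurable_of_countable f).aestronglyMeasurable

omit [IsProbabilityMeasure P] in
theorem memLp_comp_poisson {r : NNReal} {Y : Ω → ℕ} (hY : HasLaw Y (poissonMeasure r) P)
    {f : ℕ → ℝ} (hf : ExpGrowth f) : MemLp (fun ω => f (Y ω)) 3 P := by
  have h : MemLp f 3 (poissonMeasure r) := by
    rw [← integrable_norm_rpow_iff (measurable_of_countable f).aestronglyMeasurable
      (by norm_num) (by norm_num)]
    have := ((hf.pow 3).integrable r).norm
    refine this.congr (ae_of_all _ fun k => ?_)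
    simp only [norm_pow]
    norm_num
  rw [← hY.map_eq] at h
  exact h.comp_of_map hY.aemeasurable

theorem hasDivergenceBounds_poisson {r : NNReal} {Y : Ω → ℕ}
    (hY : HasLaw Y (poissonMeasure r) P) :
    HasDivergenceBounds (fun ω => poissonDiv' r (Y ω)) P := by
  rcases eq_or_ne (r : ℝ) 0 with h0 | h0
  · have e : (fun ω => poissonDiv' r (Y ω)) = fun _ => (0 : ℝ) := by
      ext ω; rw [poissonDiv', if_pos h0]
    rw [e]
    have hv : variance (fun _ : Ω => (0 : ℝ)) P = 0 := variance_zero P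
    refine ⟨fun _ => le_rfl, memLp_const _, by simp; norm_num, by rw [hv]; norm_num,
      by rw [hv]; simp; norm_num, by norm_num, fun a => ?_⟩
    rcases le_or_gt a 0 with ha | ha
    · refine measureReal_le_one.trans ?_
      have := Real.one_le_exp (neg_nonneg.2 ha)
      linarith
    · simp only [not_le.2 ha, Set.ofPred_false, measureReal_empty]
      positivity
  · have hr : 0 < (r : ℝ) := lt_of_le_of_ne r.coe_nonneg (Ne.symm h0)
    have e : (fun ω => poissonDiv' r (Y ω)) = fun ω => poissonDiv r (Y ω) := by
      ext ω; rw [poissonDiv', if_neg h0]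
    rw [e]
    obtain ⟨b1, b2, b3⟩ := momentBounds hr
    have hm := integral_comp_poisson hY (poissonDiv r)
    have hL := memLp_comp_poisson hY (expGrowth_poissonDiv hr)
    have hv : variance (fun ω => poissonDiv r (Y ω)) P
        = poissonExp r (fun k => poissonDiv r k ^ 2) - poissonExp r (poissonDiv r) ^ 2 := by
      rw [variance_eq_sub (hL.mono_exponent (by norm_num)), hm]
      congr 1
      exact integral_comp_poisson hY (fun k => poissonDiv r k ^ 2)
    refine ⟨fun ω => poissonDiv_nonneg hr _, hL, by rw [hm]; exact b1, by rw [hv]; linarith, ?_, ?_,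
      fun a => ?_⟩
    · rw [hv, hm]
      nlinarith [sq_nonneg (poissonExp r (poissonDiv r) - 0.5803)]
    · rw [hm]
      exact (integral_comp_poisson hY _).trans_le (poissonExp_third_central_le hr)
    · refine le_trans (le_of_eq ?_) (poissonExp_indicator_poissonDiv_le hr a)
      rw [← integral_poissonMeasure_eq, integral_indicator_const _ MeasurableSet.of_discrete,
        smul_eq_mul, mul_one]
      exact hY.measureReal_eq (p := fun k => a ≤ poissonDiv r k) MeasurableSet.of_discrete

omit [IsProbabilityMeasure P] in
theorem ae_eq_zero_of_hasLaw_poisson_zero {r : NNReal} (hr : r = 0) {Y : Ω → ℕ}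
    (hY : HasLaw Y (poissonMeasure r) P) : ∀ᵐ ω ∂P, Y ω = 0 := by
  rw [hY.ae_iff (p := fun k => k = 0) (measurable_of_countable _), hr]
  have h : poissonMeasure 0 {0} = 1 := by rw [poissonMeasure_singleton]; simp
  exact (prob_compl_eq_zero_iff (MeasurableSet.singleton 0)).2 h

theorem iDivergence_eq_sum_poissonDiv' {D : ℕ} {x : Fin D → ℕ} {y : Fin D → ℝ}
    (h : ∀ j, y j = 0 → x j = 0) :
    iDivergence (fun j => (x j : ℝ)) y = ((∑ j, poissonDiv' (y j) (x j) : ℝ) : EReal) := by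
  rw [iDivergence, if_pos]
  · congr 1
    refine Finset.sum_congr rfl fun j _ => ?_
    rcases eq_or_ne (y j) 0 with hy | hy
    · rw [poissonDiv', if_pos hy, hy, h j hy]; simp
    · rw [poissonDiv', if_neg hy, poissonDiv]
  · intro j hj hy
    exact hj (by simp [h j hy])

theorem coe_sum_ereal {κ : Type*} (s : Finset κ) (f : κ → ℝ) :
    ((∑ i ∈ s, f i : ℝ) : EReal) = ∑ i ∈ s, (f i : EReal) := by
  classical
  induction s using Finset.induction_on with
  | empty => simp
  | insert i s hi ih => rw [Finset.sum_insert hi, Finset.sum_insert hi, EReal.coe_add, ih]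

end Main

theorem mainTheorem3 :
    ∃ Cμ Cσ2 : ℝ, |Cμ - 0.5801| ≤ 0.0002 ∧ |Cσ2 - 0.5178| ≤ 0.00005 ∧
      ∀ (K M N : ℕ) (A : Fin N → Matrix (Fin M) (Fin K) ℝ) (X : Matrix (Fin K) (Fin N) ℝ)
        (Ω : Type*) [MeasurableSpace Ω] (P : Measure Ω) [IsProbabilityMeasure P]
        (Y : Ω → Matrix (Fin M) (Fin N) ℕ) (p : ℝ),
        (∀ i j l, 0 ≤ A i j l) → (∀ l i, 0 ≤ X l i) →
        IsPoissonObservation P A X Y →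
        0 < p → p < 1 →
        1 - p ≤ P.real {ω | X ∈ mlConfidenceSet A (Y ω) (mlRadius Cμ Cσ2 M N p)} := by
  refine ⟨0.5803, 0.51785, by rw [abs_le]; norm_num, by rw [abs_le]; norm_num, ?_⟩
  intro K M N A X Ω _ P _ Y p hA hX hY hp0 hp1
  set l : Fin M × Fin N → NNReal := fun q => ((A q.2 *ᵥ X.col q.2) q.1).toNNReal with hl
  have hl0 : ∀ q : Fin M × Fin N, 0 ≤ (A q.2 *ᵥ X.col q.2) q.1 := fun q => by
    rw [Matrix.mulVec, dotProduct]
    exact Finset.sum_nonneg fun k _ => mul_nonneg (hA _ _ _) (hX _ _)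
  have hlc : ∀ q : Fin M × Fin N, (l q : ℝ) = (A q.2 *ᵥ X.col q.2) q.1 := fun q =>
    Real.coe_toNNReal _ (hl0 q)
  have hlaw : ∀ q : Fin M × Fin N, HasLaw (fun ω => Y ω q.1 q.2) (poissonMeasure (l q)) P :=
    fun q => hY.hasLaw q.1 q.2
  set Z : Fin M × Fin N → Ω → ℝ := fun q ω => poissonDiv' (l q) (Y ω q.1 q.2) with hZ
  have hZb : ∀ q, HasDivergenceBounds (Z q) P := fun q => hasDivergenceBounds_poisson (hlaw q)
  have hind : iIndepFun Z P := hY.indep.comp (fun q k => poissonDiv' (l q) k)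
    fun q => measurable_of_countable _
  set ε := mlRadius 0.5803 0.51785 M N p with hε
  set n : ℝ := (Fintype.card (Fin M × Fin N) : ℝ) with hn
  have hnMN : n = M * N := by rw [hn]; simp
  -- outside a null set, `X` can only fail to be in the confidence set if the sum is too large
  have hae : ∀ᵐ ω ∂P, ω ∈ {ω | X ∈ mlConfidenceSet A (Y ω) ε} ∪ {ω | ε < ∑ q, Z q ω} := by
    have h0 : ∀ᵐ ω ∂P, ∀ q : Fin M × Fin N, l q = 0 → Y ω q.1 q.2 = 0 := by
      rw [ae_all_iff]
      intro q
      by_cases hq : l q = 0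
      · filter_upwards [ae_eq_zero_of_hasLaw_poisson_zero hq (hlaw q)] with ω hω _ using hω
      · exact ae_of_all _ fun ω h => absurd h hq
    filter_upwards [h0] with ω hω
    rcases le_or_gt (∑ q, Z q ω) ε with h | h
    · refine Or.inl ⟨hX, ?_⟩
      have e : ∀ i : Fin N, iDivergence (fun j => (Y ω j i : ℝ)) (A i *ᵥ X.col i)
          = ((∑ j, Z (j, i) ω : ℝ) : EReal) := fun i => by
        rw [iDivergence_eq_sum_poissonDiv' (x := fun j => Y ω j i) fun j hj =>
          hω (j, i) (by rw [← NNReal.coe_eq_zero, hlc]; exact hj)]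
        simp only [hZ, hlc]
      simp only [e]
      rw [← coe_sum_ereal, EReal.coe_le_coe_iff]
      rwa [Fintype.sum_prod_type_right] at h
    · exact Or.inr h
  have hsum : 1 ≤ P.real {ω | X ∈ mlConfidenceSet A (Y ω) ε} + P.real {ω | ε < ∑ q, Z q ω} := by
    refine le_trans ?_ (measureReal_union_le _ _)
    rw [← probReal_univ (μ := P)]
    exact ENNReal.toReal_mono (measure_ne_top _ _) (measure_mono_ae (hae.mono fun ω hω _ => hω))
  suffices h : P.real {ω | ε < ∑ q, Z q ω} ≤ p by linarith
  have hpinv : 0 < 1 / p - 1 := by rw [sub_pos, one_lt_div hp0]; exact hp1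
  rcases isEmpty_or_nonempty (Fin M × Fin N) with hE | hE
  · have h0 : 0 ≤ ε := by rw [hε, mlRadius]; positivity
    simp only [Finset.univ_eq_empty, Finset.sum_empty, not_lt.2 h0, Set.ofPred_false,
      measureReal_empty]
    exact hp0.le
  · have hn0 : 0 < n := by rw [hn]; exact_mod_cast Fintype.card_pos
    set t := Real.sqrt (1 / p - 1) * Real.sqrt (0.51785 * n) with ht
    have ht0 : 0 < t := by positivity
    have hεt : ε = 0.5803 * n + t := by rw [hε, mlRadius, ht, hnMN]
    have ht2 : t ^ 2 = (1 / p - 1) * (0.51785 * n) := by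
      rw [ht, mul_pow, Real.sq_sqrt hpinv.le, Real.sq_sqrt (by positivity)]
    calc P.real {ω | ε < ∑ q, Z q ω} ≤ P.real {ω | 0.5803 * n + t ≤ ∑ q, Z q ω} :=
          measureReal_mono fun ω hω => by
            rw [Set.mem_ofPred_eq, ← hεt]; exact le_of_lt hω
      _ ≤ 0.51785 * n / (0.51785 * n + t ^ 2) := measureReal_sum_ge_le hZb hind ht0
      _ = p := by rw [ht2]; field_simp; ring
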